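/- An instance of Maximum Betweenness Centrality (MBC) is a finite, undirected, connected, simple graph $G=(V,E)$ with $n=|V|$ nodes, node costs $c\colon V\to\mathbb{R}_{\ge 0}$ and a budget $b\ge 0$. For nodes $s\ne t$ let $\sigma_{s,t}$ be the number of shortest $s$--$t$ paths and, for $C\subseteq V$, let $\sigma_{s,t}(C)$ be the number of those that contain at least one node of $C$ (end points $s,t$ included). Let $$\operatorname{GBC}(C)=\sum_{s,t\in V,\ s\neq t}\frac{\sigma_{s,t}(C)}{\sigma_{s,t}}.$$ The task is to find a set $C\subseteq V$ with $c(C)=\sum_{v\in C}c(v)\le b$ that maximizes $\operatorname{GBC}(C)$. A set $C$ is an $\alpha$-approximate solution if $c(C)\le b$ and $\operatorname{GBC}(C)\ge\alpha\operatorname{GBC}(D)$ for every $D\subseteq V$ with $c(D)\le b$. The computational model is the real RAM: a program is finite and the same for all inputs; it uses registers and arrays (cells addressed by two natural numbers) for natural numbers and for real numbers. Each access, each addition or truncated subtraction of natural numbers, each operation $+,-,\cdot,/$ on real numbers (with $x/0=0$), and each comparison takes unit time. The only real constants are $0$ and $1$, and there is no conversion between the two kinds of numbers. The input is $n$, the adjacency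 matrix, the cost vector and the budget. Consider the following greedy algorithm. Put $H:=\emptyset$. For each $C\subseteq V$ with $|C|\le 3$ and $c(C)\le b$, in any order: put $U:=V\setminus C$; while $U\neq\emptyset$, choose $u\in U$ that maximizes the relative gain $(\operatorname{GBC}(C\cup\{u\})-\operatorname{GBC}(C))/c(u)$ (ties broken arbitrarily; for $c(u)=0$ the quotient is $\infty$ if the numerator is positive and $0$ otherwise), replace $C$ by $C\cup\{u\}$ if $c(C\cup\{u\})\le b$, and in any case remove $u$ from $U$; when $U=\emptyset$, put $H:=C$ if $\operatorname{GBC}(C)>\operatorname{GBC}(H)$. Return $H$. **Theorem.** 1. There is an algorithm that, for every MBC instance, computes a $(1-1/\sqrt{e})$-approximate solution in $O(n^3)$ time. 2. There is an algorithm that, for every MBC instance, computes in $O(n^6)$ time a set that is a possible result of the greedy algorithm above and is a $(1-1/e)$-approximate solution. Moreover, every possible result of the greedy algorithm, for any order of the starts and any way of breaking ties, is a $(1-1/e)$-approximate solution. The constants in the $O$-notation are absolute. -/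

import Mathlib

/-! ## Group betweenness centrality -/

namespace SimpleGraph

variable {V : Type*} (G : SimpleGraph V)

/-- The set of shortest `s`--`t` paths of `G`. -/
def shortestPaths (s t : V) : Set (G.Walk s t) :=
  {p | p.IsPath ∧ p.length = G.dist s t}

/-- `σ_{s,t}`: the number of shortest `s`--`t` paths (a finite number if `V` is finite). -/
noncomputable def numShortest (s t : V) : ℕ :=
  (G.shortestPaths s t).ncard

/-- `σ_{s,t}(C)`: the number of shortest `s`--`t` paths containing at least one node of `C`.
The end points `s` and `t` belong to the path. -/
noncomputable def numShortestMeeting (C : Finset V) (s t : V) : ℕ :=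
  {p ∈ G.shortestPaths s t | ∃ v ∈ C, v ∈ p.support}.ncard

/-- Group betweenness centrality: the sum of `σ_{s,t}(C) / σ_{s,t}` over all ordered pairs of
distinct nodes. -/
noncomputable def gbc [Fintype V] [DecidableEq V] (C : Finset V) : ℝ :=
  ∑ st ∈ (Finset.univ : Finset V).offDiag,
    (G.numShortestMeeting C st.1 st.2 : ℝ) / (G.numShortest st.1 st.2 : ℝ)

end SimpleGraph

/-- An instance of Maximum Betweenness Centrality: a connected graph on the nodes `0, …, n - 1`
with nonnegative real node costs and a nonnegative real budget. -/
structure MBC where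
  n : ℕ
  graph : SimpleGraph (Fin n)
  connected : graph.Connected
  cost : Fin n → ℝ
  cost_nonneg : ∀ v, 0 ≤ cost v
  budget : ℝ
  budget_nonneg : 0 ≤ budget

namespace MBC

variable (I : MBC)

/-- The objective function. -/
noncomputable def gbc (C : Finset (Fin I.n)) : ℝ := I.graph.gbc C

/-- `C` respects the budget. -/
def Feasible (C : Finset (Fin I.n)) : Prop := ∑ v ∈ C, I.cost v ≤ I.budget

/-- `C` is a feasible solution whose value is at least `α` times the value of every feasible
solution, that is, at least `α` times the optimum. -/
def IsApproxSolution (α : ℝ) (C : Finset (Fin I.n)) : Prop :=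
  I.Feasible C ∧ ∀ D : Finset (Fin I.n), I.Feasible D → α * I.gbc D ≤ I.gbc C

/-! ## The greedy algorithm with enumeration of starts of at most three nodes -/

/-- The relative gain `(GBC(C + v) - GBC(C)) / c(v)`, in `[0, ∞]`. The numerator is never
negative. If `c(v) = 0`, the quotient is `∞` for a positive gain and `0` for a zero gain. -/
noncomputable def relGain (C : Finset (Fin I.n)) (v : Fin I.n) : ENNReal :=
  ENNReal.ofReal (I.gbc (insert v C) - I.gbc C) / ENNReal.ofReal (I.cost v)

/-- `u` is a node of `U` of maximum relative gain with respect to `C`; ties may be broken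
arbitrarily. -/
def IsArgMax (C U : Finset (Fin I.n)) (u : Fin I.n) : Prop :=
  u ∈ U ∧ ∀ v ∈ U, I.relGain C v ≤ I.relGain C u

/-- The inner loop: `Augment C U D` says that, with current solution `C` and set `U` of nodes not
yet considered, the loop may end with the solution `D`. While `U` is nonempty, a node `u` of
maximum relative gain is chosen from `U`, added to `C` if this respects the budget, and in any case
removed from `U`. -/
inductive Augment : Finset (Fin I.n) → Finset (Fin I.n) → Finset (Fin I.n) → Prop
  | finish (C : Finset (Fin I.n)) : Augment C ∅ C
  | take {C U D : Finset (Fin I.n)} {u : Fin I.n} :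
      I.IsArgMax C U u → I.Feasible (insert u C) →
      Augment (insert u C) (U.erase u) D → Augment C U D
  | drop {C U D : Finset (Fin I.n)} {u : Fin I.n} :
      I.IsArgMax C U u → ¬ I.Feasible (insert u C) →
      Augment C (U.erase u) D → Augment C U D

/-- The outer loop: `Search L H H'` says that going through the list `L` of starts, with best
solution `H` so far, may end with best solution `H'`. -/
inductive Search : List (Finset (Fin I.n)) → Finset (Fin I.n) → Finset (Fin I.n) → Prop
  | finish (H : Finset (Fin I.n)) : Search [] H H
  | better {C D H H' : Finset (Fin I.n)} {L : List (Finset (Fin I.n))} :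
      I.Augment C Cᶜ D → I.gbc H < I.gbc D → Search L D H' → Search (C :: L) H H'
  | keep {C D H H' : Finset (Fin I.n)} {L : List (Finset (Fin I.n))} :
      I.Augment C Cᶜ D → ¬ I.gbc H < I.gbc D → Search L H H' → Search (C :: L) H H'

/-- `H` is a possible result of the greedy algorithm: the starts `C` with `|C| ≤ 3` that respect
the budget are tried in some order, beginning with the best solution `∅`. -/
def IsGreedyResult (H : Finset (Fin I.n)) : Prop :=
  ∃ L : List (Finset (Fin I.n)), L.Nodup ∧ (∀ C, C ∈ L ↔ C.card ≤ 3 ∧ I.Feasible C) ∧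
    I.Search L ∅ H

end MBC

/-! ## A real RAM

Programs are finite. They work on registers and arrays for natural numbers (indices, counters) and
for real numbers, have unit-cost exact arithmetic and comparisons, and no conversion between the
two kinds of numbers; the only constants of real type are `0` and `1`. -/

namespace RealRAM

/-- The store. Registers and arrays are named by natural numbers; the cells of an array are
addressed by two indices. -/
structure Store where
  nreg : ℕ → ℕ
  rreg : ℕ → ℝ
  narr : ℕ → ℕ → ℕ → ℕ
  rarr : ℕ → ℕ → ℕ → ℝ

/-- Expressions for natural numbers. -/
inductive NExp
  | const (k : ℕ)
  | reg (x : ℕ)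
  | cell (A : ℕ) (i j : NExp)
  | add (e f : NExp)
  | sub (e f : NExp)

/-- Expressions for real numbers. -/
inductive RExp
  | zero
  | one
  | reg (x : ℕ)
  | cell (A : ℕ) (i j : NExp)
  | add (e f : RExp)
  | sub (e f : RExp)
  | mul (e f : RExp)
  | div (e f : RExp)

/-- Tests. -/
inductive Test
  | nlt (e f : NExp)
  | rlt (e f : RExp)
  | neg (b : Test)
  | and (b c : Test)

/-- Programs. Each program names only finitely many registers and arrays. -/
inductive Prog
  | nop
  | setNReg (x : ℕ) (e : NExp)
  | setRReg (x : ℕ) (e : RExp)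
  | setNCell (A : ℕ) (i j e : NExp)
  | setRCell (A : ℕ) (i j : NExp) (e : RExp)
  | seq (p q : Prog)
  | ite (b : Test) (p q : Prog)
  | loop (b : Test) (p : Prog)

/-- The value of an expression; subtraction of natural numbers is truncated at `0`. -/
def NExp.val (s : Store) : NExp → ℕ
  | const k => k
  | reg x => s.nreg x
  | cell A i j => s.narr A (i.val s) (j.val s)
  | add e f => e.val s + f.val s
  | sub e f => e.val s - f.val s

/-- The number of operations in the evaluation of an expression. -/
def NExp.time : NExp → ℕ
  | const _ => 1
  | reg _ => 1
  | cell _ i j => i.time + j.time + 1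
  | add e f => e.time + f.time + 1
  | sub e f => e.time + f.time + 1

/-- The value of an expression; division by zero yields `0`. -/
noncomputable def RExp.val (s : Store) : RExp → ℝ
  | zero => 0
  | one => 1
  | reg x => s.rreg x
  | cell A i j => s.rarr A (i.val s) (j.val s)
  | add e f => e.val s + f.val s
  | sub e f => e.val s - f.val s
  | mul e f => e.val s * f.val s
  | div e f => e.val s / f.val s

/-- The number of operations in the evaluation of an expression. -/
def RExp.time : RExp → ℕ
  | zero => 1
  | one => 1
  | reg _ => 1
  | cell _ i j => i.time + j.time + 1
  | add e f => e.time + f.time + 1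
  | sub e f => e.time + f.time + 1
  | mul e f => e.time + f.time + 1
  | div e f => e.time + f.time + 1

/-- The test succeeds. -/
def Test.Holds (s : Store) : Test → Prop
  | nlt e f => e.val s < f.val s
  | rlt e f => e.val s < f.val s
  | neg b => ¬ b.Holds s
  | and b c => b.Holds s ∧ c.Holds s

/-- The number of operations in the evaluation of a test. -/
def Test.time : Test → ℕ
  | nlt e f => e.time + f.time + 1
  | rlt e f => e.time + f.time + 1
  | neg b => b.time + 1
  | and b c => b.time + c.time + 1

/-- `Run p s t s'`: started in the store `s`, the program `p` halts after exactly `t` steps in the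
store `s'`. -/
inductive Run : Prog → Store → ℕ → Store → Prop
  | nop (s : Store) : Run .nop s 1 s
  | setNReg (s : Store) (x : ℕ) (e : NExp) :
      Run (.setNReg x e) s (e.time + 1)
        { s with nreg := Function.update s.nreg x (e.val s) }
  | setRReg (s : Store) (x : ℕ) (e : RExp) :
      Run (.setRReg x e) s (e.time + 1)
        { s with rreg := Function.update s.rreg x (e.val s) }
  | setNCell (s : Store) (A : ℕ) (i j e : NExp) :
      Run (.setNCell A i j e) s (i.time + j.time + e.time + 1)
        { s with narr := Function.update s.narr A (Function.update (s.narr A) (i.val s)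
            (Function.update (s.narr A (i.val s)) (j.val s) (e.val s))) }
  | setRCell (s : Store) (A : ℕ) (i j : NExp) (e : RExp) :
      Run (.setRCell A i j e) s (i.time + j.time + e.time + 1)
        { s with rarr := Function.update s.rarr A (Function.update (s.rarr A) (i.val s)
            (Function.update (s.rarr A (i.val s)) (j.val s) (e.val s))) }
  | seq {p q : Prog} {s s₁ s₂ : Store} {t₁ t₂ : ℕ} :
      Run p s t₁ s₁ → Run q s₁ t₂ s₂ → Run (.seq p q) s (t₁ + t₂) s₂
  | iteTrue {b : Test} {p q : Prog} {s s₁ : Store} {t : ℕ} :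
      b.Holds s → Run p s t s₁ → Run (.ite b p q) s (b.time + t + 1) s₁
  | iteFalse {b : Test} {p q : Prog} {s s₁ : Store} {t : ℕ} :
      ¬ b.Holds s → Run q s t s₁ → Run (.ite b p q) s (b.time + t + 1) s₁
  | loopTrue {b : Test} {p : Prog} {s s₁ s₂ : Store} {t₁ t₂ : ℕ} :
      b.Holds s → Run p s t₁ s₁ → Run (.loop b p) s₁ t₂ s₂ →
      Run (.loop b p) s (b.time + t₁ + t₂ + 1) s₂
  | loopFalse {b : Test} {p : Prog} {s : Store} :
      ¬ b.Holds s → Run (.loop b p) s (b.time + 1) s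

/-- The machine is deterministic: running time and final store are determined by the program and
the initial store. -/
theorem Run.det {p : Prog} {s s₁ s₂ : Store} {t₁ t₂ : ℕ}
    (h₁ : Run p s t₁ s₁) (h₂ : Run p s t₂ s₂) : t₁ = t₂ ∧ s₁ = s₂ := by
  induction h₁ generalizing t₂ s₂ with
  | nop | setNReg | setRReg | setNCell | setRCell => cases h₂; exact ⟨rfl, rfl⟩
  | seq _ _ ih ih' =>
    cases h₂ with
    | seq a b =>
      obtain ⟨rfl, rfl⟩ := ih a
      obtain ⟨rfl, rfl⟩ := ih' b
      exact ⟨rfl, rfl⟩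
  | iteTrue hb _ ih =>
    cases h₂ with
    | iteTrue _ a => obtain ⟨rfl, rfl⟩ := ih a; exact ⟨rfl, rfl⟩
    | iteFalse hb' _ => exact absurd hb hb'
  | iteFalse hb _ ih =>
    cases h₂ with
    | iteTrue hb' _ => exact absurd hb' hb
    | iteFalse _ a => obtain ⟨rfl, rfl⟩ := ih a; exact ⟨rfl, rfl⟩
  | loopTrue hb _ _ ih ih' =>
    cases h₂ with
    | loopTrue _ a b =>
      obtain ⟨rfl, rfl⟩ := ih a
      obtain ⟨rfl, rfl⟩ := ih' b
      exact ⟨rfl, rfl⟩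
    | loopFalse hb' => exact absurd hb hb'
  | loopFalse hb =>
    cases h₂ with
    | loopTrue hb' _ _ => exact absurd hb' hb
    | loopFalse _ => exact ⟨rfl, rfl⟩

open Classical in
/-- The initial store for an instance: the number of nodes is in the natural register `0`, the
adjacency matrix in the natural array `0`, the budget in the real register `0`, the cost of node
`v` in cell `(v, 0)` of the real array `0`; everything else is zero. -/
noncomputable def input (I : MBC) : Store where
  nreg x := if x = 0 then I.n else 0
  rreg x := if x = 0 then I.budget else 0
  narr A i j :=
    if A = 0 ∧ ∃ (hi : i < I.n) (hj : j < I.n), I.graph.Adj ⟨i, hi⟩ ⟨j, hj⟩ then 1 else 0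
  rarr A i j := if h : A = 0 ∧ i < I.n ∧ j = 0 then I.cost ⟨i, h.2.1⟩ else 0

/-- The output: the set of the nodes `v` for which cell `(v, 0)` of the natural array `1` is
nonzero. -/
def output (n : ℕ) (s : Store) : Finset (Fin n) :=
  {v : Fin n | s.narr 1 v 0 ≠ 0}

/-- On the instance `I`, the program `P` halts after `t` steps with output `C`. -/
def Returns (P : Prog) (I : MBC) (t : ℕ) (C : Finset (Fin I.n)) : Prop :=
  ∃ s : Store, Run P (input I) t s ∧ output I.n s = C

end RealRAM

/-! Counting the paths that avoid a set instead of those that meet it shows that the marginal gain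
of `v` at `C` is the weighted number of shortest paths through `v` that avoid `C`. It is nonnegative
and shrinks as `C` grows (`gain_anti`). So GBC is monotone and submodular, and both approximation
factors come from budgeted submodular maximization.

The basic estimate is `IsArgMax.deficit_le`: if the target `T` lies in `C ∪ U` and `T \ C` costs at
most `β`, then a greedy choice `u` multiplies a bound on the deficit GBC(T) - GBC(C) by
exp(-c(u)/β). `Augment.exists_first_drop` iterates this up to the first node of `T` that does not
fit.

For 1 - 1/e, start with three nodes of an optimum `O` picked by largest gain. When `u` in `O` is
first rejected at the solution `S`, the set S + u exceeds the budget, so its deficit is at most 1/e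
of the initial one. The gain of `u` is at most a third of the value of the start, and 1/3 ≤ 1/e
absorbs its loss.

For 1 - 1/√e, the empty start and the best single node suffice. A rejection after half the budget is
spent does no harm, and a valuable rejected `u` is a good solution by itself. Otherwise the run is
followed further with target O - u, which costs less than what has been spent so far; this makes the
second phase converge fast enough (`le_gbc_of_augment_empty`).

For the running time, distances and path counts come from Floyd–Warshall recursions in cubic time.
Afterwards adding a node updates all avoiding counts (`numAvoid_insert`) and all gains
(`gain_insert`) in quadratic time, because the sum over one end point is collected once in
`dependency`. A greedy run is therefore cubic; part 1 needs two runs, part 2 one run for each of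
O(n^3) starts. The programs are verified with the predicate `Ensures`, whose time bound is program
size times a power of `m` with the loop depth as exponent. The nesting depths 3 and 6 thus give the
two bounds. -/

namespace SimpleGraph

/-! ### Counting shortest paths by cutting them at a node -/

variable {V : Type*} {G : SimpleGraph V}

theorem mem_shortestPaths {s t : V} {p : G.Walk s t} :
    p ∈ G.shortestPaths s t ↔ p.length = G.dist s t :=
  ⟨fun h => h.2, fun h => ⟨p.isPath_of_length_eq_dist h, h⟩⟩

theorem finite_shortestPaths [Finite V] (s t : V) : (G.shortestPaths s t).Finite := by
  classical
  have := Fintype.ofFinite V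
  refine Set.Finite.subset (Set.toFinite {p : G.Walk s t | p.length = G.dist s t}) ?_
  exact fun p hp => hp.2

variable (G) in
/-- The number of shortest paths from `s` to `t` all of whose nodes satisfy `P`. -/
noncomputable def numWithin (P : V → Prop) (s t : V) : ℕ :=
  {p ∈ G.shortestPaths s t | ∀ w ∈ p.support, P w}.ncard

variable (G) in
/-- The node `v` lies on a shortest path from `s` to `t`. -/
def IsBetween (s v t : V) : Prop := G.dist s v + G.dist v t = G.dist s t

noncomputable instance (s v t : V) : Decidable (G.IsBetween s v t) :=
  inferInstanceAs (Decidable (G.dist s v + G.dist v t = G.dist s t))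

/-- All first factors have length `G.dist s v`, so the node list of the concatenation is cut at a
fixed position, and a walk is determined by its node list. -/
theorem append_injOn_shortestPaths (s v t : V) :
    Set.InjOn (fun x : G.Walk s v × G.Walk v t => x.1.append x.2)
      (G.shortestPaths s v ×ˢ G.shortestPaths v t) := by
  rintro ⟨p, q⟩ ⟨hp, hq⟩ ⟨p', q'⟩ ⟨hp', hq'⟩ h
  have h' := congrArg Walk.support h
  simp only [Walk.support_append] at h'
  have hl : p.support.length = p'.support.length := by
    rw [Walk.length_support, Walk.length_support, hp.2, hp'.2]
  obtain ⟨h1, h2⟩ := List.append_inj h' hl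
  have e1 : p = p' := Walk.support_injective h1
  have e2 : q = q' := by
    apply Walk.support_injective
    rw [← q.cons_tail_support, ← q'.cons_tail_support, h2]
  rw [e1, e2]

theorem append_mem_shortestPaths {s v t : V} (h : G.IsBetween s v t) {p : G.Walk s v}
    {q : G.Walk v t} (hp : p ∈ G.shortestPaths s v) (hq : q ∈ G.shortestPaths v t) :
    p.append q ∈ G.shortestPaths s t := by
  rw [mem_shortestPaths] at *
  rw [Walk.length_append, hp, hq, h]

/-- Cutting at `v` gives two pieces at least as long as the respective distances; their total length
is `G.dist s t`, so the triangle inequality forces equality throughout. -/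
theorem Connected.exists_append_of_mem_support (hG : G.Connected) {s v t : V} {p : G.Walk s t}
    (hp : p ∈ G.shortestPaths s t) (hv : v ∈ p.support) :
    G.IsBetween s v t ∧ ∃ q ∈ G.shortestPaths s v, ∃ r ∈ G.shortestPaths v t, q.append r = p := by
  classical
  have hs := p.take_spec hv
  have hl := congrArg Walk.length hs
  rw [Walk.length_append, mem_shortestPaths.1 hp] at hl
  have h1 := dist_le (p.takeUntil v hv)
  have h2 := dist_le (p.dropUntil v hv)
  have h3 : G.dist s t ≤ G.dist s v + G.dist v t := hG.dist_triangle
  refine ⟨?_, p.takeUntil v hv, ?_, p.dropUntil v hv, ?_, hs⟩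
  · unfold IsBetween; omega
  · rw [mem_shortestPaths]; omega
  · rw [mem_shortestPaths]; omega

/-- The shortest paths through `v` are the concatenations of shortest paths to and from `v`. -/
theorem Connected.ncard_through (hG : G.Connected) [Finite V] (P : V → Prop) (s v t : V) :
    {p ∈ G.shortestPaths s t | v ∈ p.support ∧ ∀ w ∈ p.support, P w}.ncard =
      if G.IsBetween s v t then G.numWithin P s v * G.numWithin P v t else 0 := by
  split_ifs with h
  · rw [numWithin, numWithin, ← Set.ncard_prod]
    rw [← ((append_injOn_shortestPaths s v t).mono
      (Set.prod_mono (Set.sep_subset _ _) (Set.sep_subset _ _))).ncard_image]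
    congr 1
    ext p
    constructor
    · rintro ⟨hp, hv, hw⟩
      obtain ⟨-, q, hq, r, hr, rfl⟩ := hG.exists_append_of_mem_support hp hv
      refine ⟨(q, r), ⟨⟨hq, fun w h => hw w ?_⟩, ⟨hr, fun w h => hw w ?_⟩⟩, rfl⟩
      · rw [Walk.mem_support_append_iff]; exact Or.inl h
      · rw [Walk.mem_support_append_iff]; exact Or.inr h
    · rintro ⟨⟨q, r⟩, ⟨⟨hq, hq'⟩, ⟨hr, hr'⟩⟩, rfl⟩
      refine ⟨append_mem_shortestPaths h hq hr, ?_, ?_⟩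
      · rw [Walk.mem_support_append_iff]; exact Or.inl q.end_mem_support
      · intro w hw
        rw [Walk.mem_support_append_iff] at hw
        exact hw.elim (hq' w) (hr' w)
  · rw [Set.ncard_eq_zero (Set.Finite.subset (finite_shortestPaths s t) (Set.sep_subset _ _))]
    rw [Set.eq_empty_iff_forall_notMem]
    rintro p ⟨hp, hv, -⟩
    exact h (hG.exists_append_of_mem_support hp hv).1

/-- Forbidding the node `v`. -/
theorem Connected.numWithin_eq_add (hG : G.Connected) [Finite V] (P : V → Prop) (s v t : V) :
    G.numWithin P s t = G.numWithin (fun w => P w ∧ w ≠ v) s t +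
      if G.IsBetween s v t then G.numWithin P s v * G.numWithin P v t else 0 := by
  have hf := finite_shortestPaths (G := G) s t
  rw [← hG.ncard_through P s v t, numWithin, numWithin, ← Set.ncard_union_eq ?_
    (hf.subset (Set.sep_subset _ _)) (hf.subset (Set.sep_subset _ _))]
  · congr 1
    ext p
    simp only [Set.mem_union, Set.mem_ofPred_eq]
    constructor
    · rintro ⟨h1, h2⟩
      by_cases hv : v ∈ p.support
      · exact Or.inr ⟨h1, hv, h2⟩
      · exact Or.inl ⟨h1, fun w hw => ⟨h2 w hw, fun h => hv (h ▸ hw)⟩⟩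
    · rintro (⟨h1, h2⟩ | ⟨h1, h2, h3⟩)
      · exact ⟨h1, fun w hw => (h2 w hw).1⟩
      · exact ⟨h1, h3⟩
  · rw [Set.disjoint_left]
    rintro p ⟨-, h⟩ ⟨-, hv, -⟩
    exact (h v hv).2 rfl

theorem numWithin_comm (P : V → Prop) (s t : V) : G.numWithin P s t = G.numWithin P t s := by
  have key : ∀ s t : V, Walk.reverse '' {p ∈ G.shortestPaths s t | ∀ w ∈ p.support, P w} =
      {p ∈ G.shortestPaths t s | ∀ w ∈ p.support, P w} := by
    intro s t
    ext p
    simp only [Set.mem_image, Set.mem_ofPred_eq, mem_shortestPaths]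
    constructor
    · rintro ⟨q, ⟨h1, h2⟩, rfl⟩
      exact ⟨by rw [Walk.length_reverse, h1, dist_comm], by simpa using h2⟩
    · rintro ⟨h1, h2⟩
      exact ⟨p.reverse, ⟨by rw [Walk.length_reverse, h1, dist_comm], by simpa using h2⟩, by simp⟩
  rw [numWithin, numWithin, ← key s t, Set.ncard_image_of_injective _ Walk.reverse_injective]

theorem numWithin_congr {P Q : V → Prop} {s t : V}
    (h : ∀ p ∈ G.shortestPaths s t, ∀ w ∈ p.support, (P w ↔ Q w)) :
    G.numWithin P s t = G.numWithin Q s t := by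
  unfold numWithin
  congr 1
  ext p
  exact and_congr_right fun hp => forall₂_congr (h p hp)

theorem numWithin_eq_zero_left [Finite V] {P : V → Prop} {s t : V} (h : ¬ P s) :
    G.numWithin P s t = 0 := by
  rw [numWithin, Set.ncard_eq_zero (Set.Finite.subset (finite_shortestPaths s t)
    (Set.sep_subset _ _)), Set.eq_empty_iff_forall_notMem]
  exact fun p hp => h (hp.2 s p.start_mem_support)

theorem numWithin_eq_zero_right [Finite V] {P : V → Prop} {s t : V} (h : ¬ P t) :
    G.numWithin P s t = 0 := by
  rw [numWithin_comm, numWithin_eq_zero_left h]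

theorem shortestPaths_self (s : V) : G.shortestPaths s s = {Walk.nil} := by
  ext p
  rw [mem_shortestPaths, dist_self, Set.mem_singleton_iff, Walk.length_eq_zero_iff]
  exact Walk.eq_nil_iff_nil.symm

theorem numWithin_self {P : V → Prop} {s : V} (h : P s) : G.numWithin P s s = 1 := by
  rw [numWithin, Set.ncard_eq_one]
  refine ⟨Walk.nil, ?_⟩
  ext p
  rw [shortestPaths_self]
  simp only [Set.mem_singleton_iff, Set.mem_ofPred_eq, and_iff_left_iff_imp]
  rintro rfl
  simpa using h

theorem numWithin_true (s t : V) : G.numWithin (fun _ => True) s t = G.numShortest s t := by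
  simp [numWithin, numShortest]

theorem Connected.numShortest_pos (hG : G.Connected) [Finite V] (s t : V) :
    0 < G.numShortest s t := by
  rw [numShortest, Set.ncard_pos (finite_shortestPaths s t)]
  obtain ⟨p, hp⟩ := hG.exists_walk_length_eq_dist s t
  exact ⟨p, mem_shortestPaths.2 hp⟩

theorem numWithin_adj {P : V → Prop} {s t : V} (h : G.Adj s t) (hs : P s) (ht : P t) :
    G.numWithin P s t = 1 := by
  rw [numWithin, Set.ncard_eq_one]
  have hd : G.dist s t = 1 := dist_eq_one_iff_adj.2 h
  refine ⟨Walk.cons h Walk.nil, ?_⟩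
  ext p
  simp only [Set.mem_singleton_iff, Set.mem_ofPred_eq, mem_shortestPaths, hd]
  constructor
  · rintro ⟨h1, -⟩
    cases p with
    | nil => simp at h1
    | cons h' q =>
      cases q with
      | nil => rfl
      | cons _ _ => simp at h1
  · rintro rfl
    simp [hs, ht]

/-- The number of shortest paths from `s` to `t` all of whose inner nodes satisfy `Q`. -/
noncomputable def numVia (G : SimpleGraph V) (Q : V → Prop) (s t : V) : ℕ :=
  G.numWithin (fun w => Q w ∨ w = s ∨ w = t) s t

/-! ### Restricted inner nodes: the Floyd–Warshall recursions -/

theorem numVia_of_forall {Q : V → Prop} (h : ∀ w, Q w) (s t : V) :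
    G.numVia Q s t = G.numShortest s t := by
  rw [← numWithin_true, numVia]
  exact numWithin_congr fun _ _ w _ => by simp [h w]

theorem IsBetween.symm {s v t : V} (h : G.IsBetween s v t) : G.IsBetween t v s := by
  unfold IsBetween at *
  rw [dist_comm (u := t) (v := v), dist_comm (u := v) (v := s), dist_comm (u := t) (v := s)]
  omega

theorem isBetween_comm {s v t : V} : G.IsBetween s v t ↔ G.IsBetween t v s :=
  ⟨IsBetween.symm, IsBetween.symm⟩

/-- Here `t` is strictly farther from `s` than `v` is, hence too far away for a shortest path to
`v`. -/
theorem Connected.notMem_support_of_isBetween (hG : G.Connected) {s v t : V}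
    (h : G.IsBetween s v t) (hvt : v ≠ t) {p : G.Walk s v} (hp : p ∈ G.shortestPaths s v) :
    t ∉ p.support := by
  intro ht
  have h1 := (hG.exists_append_of_mem_support hp ht).1
  have h2 := hG.pos_dist_of_ne hvt
  unfold IsBetween at *
  omega

/-- When a path from `s` to `t` is cut at `v`, its halves inherit the permission to visit both `s`
and `t`. The half from `s` to `v` cannot reach `t`, so the permission is void and the count is the
one belonging to the pair (s, v). -/
theorem Connected.numWithin_eq_numVia (hG : G.Connected) {P Q : V → Prop} {s v t : V}
    (hP : ∀ w, P w ↔ Q w ∨ w = v ∨ w = s ∨ w = t) (h : G.IsBetween s v t) (hvt : v ≠ t) :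
    G.numWithin P s v = G.numVia Q s v := by
  refine numWithin_congr fun p hp w hw => ?_
  have : w ≠ t := fun e => hG.notMem_support_of_isBetween h hvt hp (e ▸ hw)
  rw [hP]
  tauto

theorem numVia_comm (Q : V → Prop) (s t : V) : G.numVia Q s t = G.numVia Q t s := by
  rw [numVia, numVia, numWithin_comm]
  exact numWithin_congr fun _ _ w _ => by tauto

-- Permitting `v` as inner node adds exactly the paths through `v`, and their halves use only
-- previously permitted inner nodes. If `v` is an end point nothing changes, so the values in row
-- and column `v` are the same before and after; this is what allows a computation in place.
open Classical in
theorem Connected.numVia_insert (hG : G.Connected) [Finite V] {Q Q' : V → Prop} {v : V}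
    (hQ : ∀ w, Q' w ↔ Q w ∨ w = v) (hv : ¬ Q v) (s t : V) :
    G.numVia Q' s t = G.numVia Q s t +
      if s ≠ v ∧ t ≠ v ∧ G.IsBetween s v t then G.numVia Q s v * G.numVia Q v t else 0 := by
  by_cases hs : s = v
  · rw [if_neg (by simp [hs]), add_zero]
    exact numWithin_congr fun _ _ w _ => by rw [hQ, ← hs]; tauto
  by_cases ht : t = v
  · rw [if_neg (by simp [ht]), add_zero]
    exact numWithin_congr fun _ _ w _ => by rw [hQ, ← ht]; tauto
  simp only [ne_eq, hs, ht, not_false_eq_true, true_and]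
  rw [numVia, hG.numWithin_eq_add _ s v t]
  congr 1
  · refine numWithin_congr fun _ _ w _ => ?_
    rw [hQ]
    constructor
    · tauto
    · rintro (h | h | h)
      · exact ⟨by tauto, fun e => hv (e ▸ h)⟩
      · exact ⟨by tauto, fun e => hs (h ▸ e)⟩
      · exact ⟨by tauto, fun e => ht (h ▸ e)⟩
  · split_ifs with h
    · rw [hG.numWithin_eq_numVia (Q := Q) (fun w => by rw [hQ]; tauto) h (Ne.symm ht),
        numWithin_comm, hG.numWithin_eq_numVia (Q := Q) (fun w => by rw [hQ]; tauto) h.symm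
          (Ne.symm hs), numVia_comm Q t v]
    · rfl

open Classical in
theorem numVia_empty [Finite V] {Q : V → Prop} (hQ : ∀ w, ¬ Q w)
    (s t : V) : G.numVia Q s t = if s = t ∨ G.Adj s t then 1 else 0 := by
  split_ifs with h
  · rcases h with rfl | h
    · exact numWithin_self (by simp)
    · exact numWithin_adj h (by simp) (by simp)
  · have hf := finite_shortestPaths (G := G) s t
    rw [numVia, numWithin, Set.ncard_eq_zero (hf.subset (Set.sep_subset _ _)),
      Set.eq_empty_iff_forall_notMem]
    rintro p ⟨hp, hp'⟩
    cases p with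
    | nil => simp at h
    | @cons _ w _ h' q =>
      have hw := hp' w (by simp)
      rcases hw with hw | hw | hw
      · exact hQ w hw
      · exact h'.ne hw.symm
      · exact h (Or.inr (hw ▸ h'))

/-- One stage of the Floyd--Warshall recursion for distances. -/
theorem Connected.floydWarshall_step (hG : G.Connected) [Finite V] {Q Q' : V → Prop} {v : V}
    (hQ : ∀ w, Q' w ↔ Q w ∨ w = v) (hv : ¬ Q v) {D : V → V → ℕ}
    (hD : ∀ s t, G.dist s t ≤ D s t ∧ (G.numVia Q s t ≠ 0 → D s t ≤ G.dist s t)) (s t : V) :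
    G.dist s t ≤ min (D s t) (D s v + D v t) ∧
      (G.numVia Q' s t ≠ 0 → min (D s t) (D s v + D v t) ≤ G.dist s t) := by
  classical
  have h1 := hD s t
  have h2 := hD s v
  have h3 := hD v t
  refine ⟨le_min h1.1 (hG.dist_triangle.trans (add_le_add h2.1 h3.1)), fun h => ?_⟩
  rw [hG.numVia_insert hQ hv] at h
  -- The entry is always an upper bound, but exact only once some shortest path has all inner nodes
  -- permitted. If there was none before, the new path consists of two permitted halves through `v`,
  -- where `D` is already exact.
  by_cases h0 : G.numVia Q s t = 0
  · rw [h0, zero_add] at h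
    split_ifs at h with hc
    · rw [mul_ne_zero_iff] at h
      have h4 := h2.2 h.1
      have h5 := h3.2 h.2
      have h6 : G.dist s v + G.dist v t = G.dist s t := hc.2.2
      exact (min_le_right _ _).trans (by omega)
    · exact absurd rfl h
  · exact (min_le_left _ _).trans (h1.2 h0)

/-! ### Paths avoiding a set, marginal gains and their update -/

variable (G) in
/-- The number of shortest paths from `s` to `t` that avoid `C`. -/
noncomputable def numAvoid (C : Finset V) (s t : V) : ℝ :=
  G.numWithin (fun w => w ∉ C) s t

variable (G) in
/-- The reciprocal of the number of shortest paths between distinct nodes. -/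
noncomputable def pairWeight [DecidableEq V] (s t : V) : ℝ :=
  if s = t then 0 else 1 / (G.numShortest s t : ℝ)

theorem numAvoid_comm (C : Finset V) (s t : V) : G.numAvoid C s t = G.numAvoid C t s := by
  rw [numAvoid, numWithin_comm, numAvoid]

theorem numShortest_comm (s t : V) : G.numShortest s t = G.numShortest t s := by
  rw [← numWithin_true, numWithin_comm, numWithin_true]

theorem pairWeight_comm [DecidableEq V] (s t : V) : G.pairWeight s t = G.pairWeight t s := by
  simp only [pairWeight, numShortest_comm s t, eq_comm (a := s)]

theorem numAvoid_empty (s t : V) : G.numAvoid ∅ s t = G.numShortest s t := by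
  rw [numAvoid, ← numWithin_true]
  simp

theorem Connected.numAvoid_insert (hG : G.Connected) [Finite V] [DecidableEq V] (C : Finset V) (u s t : V) :
    G.numAvoid (insert u C) s t = G.numAvoid C s t -
      if G.IsBetween s u t then G.numAvoid C s u * G.numAvoid C u t else 0 := by
  have h := hG.numWithin_eq_add (fun w => w ∉ C) s u t
  have h' : G.numWithin (fun w => w ∉ insert u C) s t =
      G.numWithin (fun w => w ∉ C ∧ w ≠ u) s t :=
    numWithin_congr fun _ _ w _ => by rw [Finset.mem_insert]; tauto
  unfold numAvoid
  rw [h', h]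
  push_cast
  split_ifs <;> ring

variable (G) in
/-- The number of shortest paths from `s` to `t` that avoid `C` and contain `v`. -/
noncomputable def numThrough (C : Finset V) (s v t : V) : ℝ :=
  if G.IsBetween s v t then G.numAvoid C s v * G.numAvoid C v t else 0

theorem numAvoid_nonneg (C : Finset V) (s t : V) : 0 ≤ G.numAvoid C s t := by
  unfold numAvoid; positivity

theorem numAvoid_anti [Finite V] {C D : Finset V} (h : C ⊆ D) (s t : V) :
    G.numAvoid D s t ≤ G.numAvoid C s t := by
  unfold numAvoid numWithin
  refine Nat.cast_le.2 (Set.ncard_le_ncard ?_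
    ((finite_shortestPaths s t).subset (Set.sep_subset _ _)))
  exact fun p hp => ⟨hp.1, fun w hw hC => hp.2 w hw (h hC)⟩

theorem numThrough_nonneg (C : Finset V) (s v t : V) : 0 ≤ G.numThrough C s v t := by
  unfold numThrough
  split_ifs
  · exact mul_nonneg (numAvoid_nonneg _ _ _) (numAvoid_nonneg _ _ _)
  · exact le_rfl

variable [DecidableEq V]

theorem pairWeight_nonneg (s t : V) : 0 ≤ G.pairWeight s t := by
  unfold pairWeight; split_ifs <;> positivity

variable [Fintype V]

/-- The paths meeting `C` are all paths minus those avoiding `C`; the weight `0` on the diagonal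
allows a full double sum. -/
theorem gbc_eq (C : Finset V) :
    G.gbc C = ∑ s, ∑ t, G.pairWeight s t * (G.numShortest s t - G.numAvoid C s t) := by
  rw [gbc, ← Fintype.sum_prod_type', ← Finset.univ_product_univ,
    ← Finset.sum_filter_add_sum_filter_not (Finset.univ ×ˢ Finset.univ) (fun x : V × V => x.1 ≠ x.2)]
  rw [Finset.sum_eq_zero (s := Finset.filter (fun x : V × V => ¬ x.1 ≠ x.2) _), add_zero]
  · refine Finset.sum_congr (by ext; simp) ?_
    rintro ⟨s, t⟩ h
    have hst : s ≠ t := by simpa using h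
    have hf := finite_shortestPaths (G := G) s t
    have : G.numShortest s t =
        G.numShortestMeeting C s t + G.numWithin (fun w => w ∉ C) s t := by
      rw [numShortest, numShortestMeeting, numWithin, ← Set.ncard_union_eq ?_
        (hf.subset (Set.sep_subset _ _)) (hf.subset (Set.sep_subset _ _))]
      · congr 1
        ext p
        by_cases h : ∃ v ∈ C, v ∈ p.support
        · simp only [Set.mem_union, Set.mem_ofPred_eq, h]; tauto
        · have h' : ∀ w ∈ p.support, w ∉ C := fun w hw hC => h ⟨w, hC, hw⟩
          simp only [Set.mem_union, Set.mem_ofPred_eq, h]; tauto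
      · rw [Set.disjoint_left]
        rintro p ⟨-, v, h1, h2⟩ ⟨-, h3⟩
        exact h3 v h2 h1
    simp only [pairWeight, hst, if_false, numAvoid]
    rw [this]
    push_cast
    ring
  · rintro ⟨s, t⟩ h
    have hst : s = t := by simpa using h
    simp [pairWeight, hst]

variable (G) in
/-- The increase of group betweenness centrality if `v` is added to `C`. -/
noncomputable def gain (C : Finset V) (v : V) : ℝ :=
  ∑ s, ∑ t, G.pairWeight s t * G.numThrough C s v t

theorem Connected.gbc_insert (hG : G.Connected) (C : Finset V) (v : V) :
    G.gbc (insert v C) = G.gbc C + G.gain C v := by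
  rw [gbc_eq, gbc_eq, gain, ← Finset.sum_add_distrib]
  refine Finset.sum_congr rfl fun s _ => ?_
  rw [← Finset.sum_add_distrib]
  refine Finset.sum_congr rfl fun t _ => ?_
  rw [hG.numAvoid_insert, numThrough]
  ring

theorem gbc_empty : G.gbc ∅ = 0 := by
  simp [gbc_eq, numAvoid_empty]

theorem gain_nonneg (C : Finset V) (v : V) : 0 ≤ G.gain C v :=
  Finset.sum_nonneg fun _ _ => Finset.sum_nonneg fun _ _ =>
    mul_nonneg (pairWeight_nonneg _ _) (numThrough_nonneg _ _ _ _)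

/-- Submodularity: the paths through `v` are counted by a product of two avoiding counts, each of
which decreases in the set. -/
theorem gain_anti {C D : Finset V} (h : C ⊆ D) (v : V) : G.gain D v ≤ G.gain C v := by
  refine Finset.sum_le_sum fun s _ => Finset.sum_le_sum fun t _ =>
    mul_le_mul_of_nonneg_left ?_ (pairWeight_nonneg _ _)
  unfold numThrough
  split_ifs
  · exact mul_le_mul (numAvoid_anti h _ _) (numAvoid_anti h _ _) (numAvoid_nonneg _ _ _)
      (numAvoid_nonneg _ _ _)
  · exact le_rfl

theorem gain_of_mem {C : Finset V} {v : V} (h : v ∈ C) : G.gain C v = 0 := by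
  refine Finset.sum_eq_zero fun s _ => Finset.sum_eq_zero fun t _ => ?_
  have : G.numAvoid C s v = 0 := by
    rw [numAvoid, numWithin_eq_zero_right (by simpa using h), Nat.cast_zero]
  simp [numThrough, this]

variable (G) in
/-- The weighted number of shortest paths avoiding `C` from any node to `u`, over those pairs with
end node `t` for which `u` lies between. -/
noncomputable def dependency (C : Finset V) (u t : V) : ℝ :=
  ∑ s, if G.IsBetween s u t then G.pairWeight s t * G.numAvoid C s u else 0

/-- The loss consists of the paths avoiding `C` that pass through both `u` and `v`. Either node may
come first, and reversing paths exchanges the two cases, whence the factor 2. With `u` first, the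
sum over the start `s` does not involve `v` and is `dependency`, so all gains together can be
updated with quadratically many operations. -/
theorem Connected.gain_insert (hG : G.Connected) (C : Finset V) {u v : V} (h : v ≠ u) :
    G.gain (insert u C) v = G.gain C v - 2 * G.numAvoid C u v *
      ∑ t, if G.IsBetween u v t then G.numAvoid C v t * G.dependency C u t else 0 := by
  have hd := hG.pos_dist_of_ne h
  -- Both sides say that going from `s` via `u` and then `v` to `t` is shortest.
  have e1 : ∀ s t, G.IsBetween s v t ∧ G.IsBetween s u v ↔
      G.IsBetween s u t ∧ G.IsBetween u v t := by
    intro s t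
    have h1 : G.dist s t ≤ G.dist s u + G.dist u t := hG.dist_triangle
    have h2 : G.dist s v ≤ G.dist s u + G.dist u v := hG.dist_triangle
    have h3 : G.dist u t ≤ G.dist u v + G.dist v t := hG.dist_triangle
    have h4 : G.dist s t ≤ G.dist s v + G.dist v t := hG.dist_triangle
    unfold IsBetween
    omega
  -- A shortest path cannot visit `u` both before and after `v`. Hence the product of the two
  -- corrections vanishes when the factors of `numThrough (insert u C)` are multiplied out in
  -- `hsplit`.
  have e2 : ∀ s t, ¬ (G.IsBetween s v t ∧ G.IsBetween s u v ∧ G.IsBetween v u t) := by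
    intro s t
    have h1 : G.dist s t ≤ G.dist s u + G.dist u t := hG.dist_triangle
    unfold IsBetween
    rw [dist_comm (u := u) (v := v)]
    omega
  -- The weighted paths that visit `u` before `v`; `X t s` covers the opposite order.
  set X : V → V → ℝ := fun s t => if G.IsBetween s v t ∧ G.IsBetween s u v then
    G.pairWeight s t * (G.numAvoid C s u * G.numAvoid C u v * G.numAvoid C v t) else 0 with hX
  have hsplit : ∀ s t, G.pairWeight s t * G.numThrough (insert u C) s v t =
      G.pairWeight s t * G.numThrough C s v t - X s t - X t s := by
    intro s t
    have e3 := e2 s t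
    have e4 := numAvoid_comm (G := G) C v u
    simp only [hX, numThrough, hG.numAvoid_insert, isBetween_comm (s := t) (v := v) (t := s),
      isBetween_comm (s := t) (v := u) (t := v)]
    rw [pairWeight_comm t s,
      numAvoid_comm C t u, numAvoid_comm C v s]
    by_cases a : G.IsBetween s v t <;> by_cases b : G.IsBetween s u v <;>
      by_cases c : G.IsBetween v u t <;> simp only [a, b, c, and_self, and_true, and_false,
        e4, if_true, if_false, not_true_eq_false] at e3 ⊢ <;> ring
  have hsum : G.gain (insert u C) v = G.gain C v - 2 * ∑ t, ∑ s, X s t := by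
    simp only [gain, hsplit, Finset.sum_sub_distrib]
    rw [Finset.sum_comm (f := fun s t => X s t)]
    ring
  rw [hsum, mul_assoc, Finset.mul_sum (a := G.numAvoid C u v)]
  congr 2
  refine Finset.sum_congr rfl fun t _ => ?_
  split_ifs with ht
  · rw [dependency, Finset.mul_sum, Finset.mul_sum]
    refine Finset.sum_congr rfl fun s _ => ?_
    simp only [hX, e1 s t, ht, and_true]
    split_ifs <;> ring
  · rw [mul_zero]
    exact Finset.sum_eq_zero fun s _ => by simp [hX, e1 s t, ht]

end SimpleGraph

/-! ### Greedy steps for a monotone submodular function -/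

namespace MBC

variable {I : MBC}

/-- The total cost of a set of nodes. -/
noncomputable def totalCost (I : MBC) (C : Finset (Fin I.n)) : ℝ := ∑ v ∈ C, I.cost v

/-- The increase of the objective function if `v` is added to `C`. -/
noncomputable def gain (I : MBC) (C : Finset (Fin I.n)) (v : Fin I.n) : ℝ := I.graph.gain C v

theorem gbc_insert (C : Finset (Fin I.n)) (v : Fin I.n) :
    I.gbc (insert v C) = I.gbc C + I.gain C v :=
  I.connected.gbc_insert C v

theorem gbc_empty : I.gbc ∅ = 0 := SimpleGraph.gbc_empty

theorem gain_nonneg (C : Finset (Fin I.n)) (v : Fin I.n) : 0 ≤ I.gain C v :=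
  SimpleGraph.gain_nonneg C v

theorem gain_anti {C D : Finset (Fin I.n)} (h : C ⊆ D) (v : Fin I.n) : I.gain D v ≤ I.gain C v :=
  SimpleGraph.gain_anti h v

theorem gbc_singleton (v : Fin I.n) : I.gbc {v} = I.gain ∅ v := by
  rw [← insert_empty_eq, gbc_insert, gbc_empty, zero_add]

theorem feasible_iff {C : Finset (Fin I.n)} : I.Feasible C ↔ I.totalCost C ≤ I.budget := Iff.rfl

theorem totalCost_nonneg (C : Finset (Fin I.n)) : 0 ≤ I.totalCost C :=
  Finset.sum_nonneg fun v _ => I.cost_nonneg v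

theorem totalCost_mono {C D : Finset (Fin I.n)} (h : C ⊆ D) : I.totalCost C ≤ I.totalCost D :=
  Finset.sum_le_sum_of_subset_of_nonneg h fun v _ _ => I.cost_nonneg v

theorem Feasible.mono {C D : Finset (Fin I.n)} (hD : I.Feasible D) (h : C ⊆ D) : I.Feasible C :=
  (totalCost_mono h).trans hD

theorem totalCost_insert {C : Finset (Fin I.n)} {v : Fin I.n} (h : v ∉ C) :
    I.totalCost (insert v C) = I.cost v + I.totalCost C :=
  Finset.sum_insert h

theorem totalCost_sdiff {C D : Finset (Fin I.n)} (h : C ⊆ D) :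
    I.totalCost (D \ C) + I.totalCost C = I.totalCost D :=
  Finset.sum_sdiff h

theorem feasible_empty : I.Feasible ∅ := by
  simpa [Feasible] using I.budget_nonneg

/-- The nodes of `X` are added one at a time; by submodularity each gains no more than it would at
`C`. -/
theorem gbc_union_bounds (C X : Finset (Fin I.n)) :
    I.gbc C ≤ I.gbc (C ∪ X) ∧ I.gbc (C ∪ X) ≤ I.gbc C + ∑ v ∈ X, I.gain C v := by
  induction X using Finset.induction_on with
  | empty => simp
  | insert a X ha ih =>
    rw [Finset.union_insert, gbc_insert, Finset.sum_insert ha]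
    have h1 := gain_nonneg (C ∪ X) a
    have h2 := gain_anti (I := I) (C := C) Finset.subset_union_left a (D := C ∪ X)
    constructor <;> linarith

theorem gbc_mono {C D : Finset (Fin I.n)} (h : C ⊆ D) : I.gbc C ≤ I.gbc D := by
  have := (gbc_union_bounds C D).1
  rwa [Finset.union_eq_right.2 h] at this

theorem gbc_nonneg (C : Finset (Fin I.n)) : 0 ≤ I.gbc C :=
  gbc_empty.symm.le.trans (gbc_mono (Finset.empty_subset C))

theorem gbc_le_add_sum_gain (C T : Finset (Fin I.n)) :
    I.gbc T ≤ I.gbc C + ∑ v ∈ T \ C, I.gain C v := by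
  refine (gbc_mono ?_).trans (gbc_union_bounds C (T \ C)).2
  rw [Finset.union_sdiff_self_eq_union]
  exact Finset.subset_union_right

theorem relGain_eq (C : Finset (Fin I.n)) (v : Fin I.n) :
    I.relGain C v = ENNReal.ofReal (I.gain C v) / ENNReal.ofReal (I.cost v) := by
  rw [relGain, gbc_insert, add_sub_cancel_left]

/-- The comparison of quotients is cross-multiplied, so that it also makes sense for nodes of cost
zero. -/
theorem IsArgMax.gain_mul_le {C U : Finset (Fin I.n)} {u v : Fin I.n} (h : I.IsArgMax C U u)
    (hv : v ∈ U) : I.gain C v * I.cost u ≤ I.gain C u * I.cost v := by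
  have hr := h.2 v hv
  rw [relGain_eq, relGain_eq] at hr
  have g1 := gain_nonneg C u
  have g2 := gain_nonneg C v
  rcases (I.cost_nonneg u).eq_or_lt with hu | hu
  · rw [← hu, mul_zero]
    exact mul_nonneg g1 (I.cost_nonneg v)
  rcases (I.cost_nonneg v).eq_or_lt with hv | hv
  · rw [← hv, mul_zero]
    -- If `v` is free and has positive gain, its quotient is infinite, whereas that of `u` is finite
    -- because `u` has positive cost.
    rcases g2.eq_or_lt with g2 | g2
    · rw [← g2, zero_mul]
    · rw [← hv, ENNReal.ofReal_zero, ENNReal.div_zero (by simpa using g2), top_le_iff,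
        ENNReal.div_eq_top] at hr
      simp at hr
      linarith
  · rw [← ENNReal.ofReal_div_of_pos hu, ← ENNReal.ofReal_div_of_pos hv,
      ENNReal.ofReal_le_ofReal_iff (by positivity), div_le_div_iff₀ hv hu] at hr
    exact hr

/-- One step of the greedy algorithm decreases the deficit geometrically. -/
theorem IsArgMax.deficit_le {C U T : Finset (Fin I.n)} {u : Fin I.n} (h : I.IsArgMax C U u)
    (hT : T ⊆ C ∪ U) {β M : ℝ} (hβ : I.totalCost (T \ C) ≤ β) (hM : 0 ≤ M)
    (hd : I.gbc T - I.gbc C ≤ M) :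
    I.gbc T - I.gbc (insert u C) ≤ M * Real.exp (-I.cost u / β) := by
  have hβ0 : 0 ≤ β := (totalCost_nonneg _).trans hβ
  have hg := gain_nonneg C u
  have hc := I.cost_nonneg u
  rw [gbc_insert]
  rcases hβ0.eq_or_lt with h0 | hpos
  -- For `β = 0` the quotient is `0` by convention and the factor is 1, so monotonicity suffices.
  · rw [← h0, div_zero, Real.exp_zero]
    linarith
  -- Averaging: the deficit is at most the sum of the gains over `T \ C`, and none of these nodes
  -- beats the gain per cost of `u`.
  have key : (I.gbc T - I.gbc C) * I.cost u ≤ I.gain C u * β := by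
    calc (I.gbc T - I.gbc C) * I.cost u ≤ (∑ v ∈ T \ C, I.gain C v) * I.cost u :=
          mul_le_mul_of_nonneg_right (by linarith [gbc_le_add_sum_gain C T]) hc
      _ ≤ I.gain C u * I.totalCost (T \ C) := by
          rw [totalCost, Finset.sum_mul, Finset.mul_sum]
          refine Finset.sum_le_sum fun v hv => h.gain_mul_le ?_
          rw [Finset.mem_sdiff] at hv
          exact (Finset.mem_union.1 (hT hv.1)).resolve_left hv.2
      _ ≤ I.gain C u * β := mul_le_mul_of_nonneg_left hβ hg
  rcases le_total (I.gbc T - I.gbc C) 0 with hn | hp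
  · have := mul_nonneg hM (Real.exp_nonneg (-I.cost u / β))
    linarith
  · have h1 : (I.gbc T - I.gbc C) * (I.cost u / β) ≤ I.gain C u := by
      rw [← mul_div_assoc, div_le_iff₀ hpos]
      exact key
    have h2 := Real.add_one_le_exp (-I.cost u / β)
    calc I.gbc T - (I.gbc C + I.gain C u)
        ≤ (I.gbc T - I.gbc C) * (-I.cost u / β + 1) := by
          rw [neg_div]; linarith
      _ ≤ (I.gbc T - I.gbc C) * Real.exp (-I.cost u / β) := mul_le_mul_of_nonneg_left h2 hp
      _ ≤ _ := mul_le_mul_of_nonneg_right hd (Real.exp_nonneg _)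

theorem Augment.subset {C U D : Finset (Fin I.n)} (h : I.Augment C U D) : C ⊆ D := by
  induction h with
  | finish C => exact subset_rfl
  | take _ _ _ ih => exact (Finset.subset_insert _ _).trans ih
  | drop _ _ _ ih => exact ih

theorem Augment.feasible {C U D : Finset (Fin I.n)} (h : I.Augment C U D) (hC : I.Feasible C) :
    I.Feasible D := by
  induction h with
  | finish C => exact hC
  | take _ hf _ ih => exact ih hf
  | drop _ _ _ ih => exact ih hC

/-- Either the inner loop collects all of `T`, or there is a first element `u` of `T` that is
dropped; the deficit of the solution `S` at that moment is controlled by the cost of `S`. -/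
theorem Augment.exists_first_drop {C U D : Finset (Fin I.n)} (h : I.Augment C U D)
    (hdis : Disjoint C U) (hC : I.Feasible C) {T : Finset (Fin I.n)} (hT : T ⊆ C ∪ U) {β M : ℝ}
    (hβ : I.totalCost (T \ C) ≤ β) (hM : 0 ≤ M) (hd : I.gbc T - I.gbc C ≤ M) :
    T ⊆ D ∨ ∃ S U' u, C ⊆ S ∧ I.Feasible S ∧ Disjoint S U' ∧ T ⊆ S ∪ U' ∧ u ∈ T ∧ u ∉ S ∧
      I.IsArgMax S U' u ∧ ¬ I.Feasible (insert u S) ∧ I.Augment S (U'.erase u) D ∧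
      I.gbc T - I.gbc S ≤ M * Real.exp (-(I.totalCost S - I.totalCost C) / β) := by
  induction h generalizing M with
  | finish C => exact Or.inl (by simpa using hT)
  | @take C U D u hu hf hA ih =>
    have huC : u ∉ C := fun hc => Finset.disjoint_left.1 hdis hc hu.1
    have hT' : T ⊆ insert u C ∪ U.erase u := by
      intro w hw
      have := hT hw
      simp only [Finset.mem_union, Finset.mem_insert, Finset.mem_erase] at this ⊢
      tauto
    have hdis' : Disjoint (insert u C) (U.erase u) := by
      rw [Finset.disjoint_insert_left]
      exact ⟨Finset.notMem_erase _ _, hdis.mono_right (Finset.erase_subset _ _)⟩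
    have hβ' : I.totalCost (T \ insert u C) ≤ β :=
      (totalCost_mono (Finset.sdiff_subset_sdiff subset_rfl (Finset.subset_insert _ _))).trans hβ
    -- The induction continues with the bound M·exp(-c(u)/β); the exponents add up to the cost of
    -- the nodes taken.
    rcases ih hdis' hf hT' hβ' (mul_nonneg hM (Real.exp_nonneg _)) (hu.deficit_le hT hβ hM hd) with
      h | ⟨S, U', u', h1, h2, h3, h4, h5, h6, h7, h8, h9, h10⟩
    · exact Or.inl h
    · refine Or.inr ⟨S, U', u', (Finset.subset_insert _ _).trans h1, h2, h3, h4, h5, h6, h7, h8,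
        h9, h10.trans (le_of_eq ?_)⟩
      rw [mul_assoc, ← Real.exp_add, totalCost_insert huC]
      congr 2
      ring
  | @drop C U D u hu hf hA ih =>
    -- Only a rejected node of `T` ends the argument; rejecting another node keeps `T` inside `C ∪
    -- U`.
    by_cases huT : u ∈ T
    · refine Or.inr ⟨C, U, u, subset_rfl, hC, hdis, hT, huT,
        fun hc => Finset.disjoint_left.1 hdis hc hu.1, hu, hf, hA, ?_⟩
      simpa using hd
    · refine ih (hdis.mono_right (Finset.erase_subset _ _)) hC ?_ hβ hM hd
      intro w hw
      have := hT hw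
      have hwu : w ≠ u := fun e => huT (e ▸ hw)
      simp only [Finset.mem_union, Finset.mem_erase] at this ⊢
      tauto

/-! ### The two approximation guarantees -/

theorem cost_pos_of_not_feasible {S : Finset (Fin I.n)} {u : Fin I.n} (hS : I.Feasible S)
    (hu : u ∉ S) (h : ¬ I.Feasible (insert u S)) : 0 < I.cost u := by
  rw [feasible_iff, totalCost_insert hu] at h
  rw [feasible_iff] at hS
  linarith

/-- Starting from a suitable set of at most three nodes, the inner loop ends with a
`(1 - 1/e)`-approximate solution. -/
theorem exists_good_start {O : Finset (Fin I.n)} (hO : I.Feasible O) :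
    ∃ C : Finset (Fin I.n), C.card ≤ 3 ∧ I.Feasible C ∧
      ∀ D, I.Augment C Cᶜ D → (1 - 1 / Real.exp 1) * I.gbc O ≤ I.gbc D := by
  have he : (1 : ℝ) / 3 ≤ 1 / Real.exp 1 :=
    one_div_le_one_div_of_le (Real.exp_pos 1) (by linarith [Real.exp_one_lt_d9])
  have he1 : 1 / Real.exp 1 ≤ 1 := by
    rw [div_le_one (Real.exp_pos 1)]
    linarith [Real.add_one_le_exp 1]
  rcases O.eq_empty_or_nonempty with rfl | hne
  · exact ⟨∅, by simp, hO, fun D _ => by simpa [gbc_empty] using gbc_nonneg D⟩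
  -- The picks maximize the plain gain, not the relative gain, and may coincide.
  obtain ⟨a, ha, ha'⟩ := O.exists_max_image (I.gain ∅) hne
  obtain ⟨b, hb, hb'⟩ := O.exists_max_image (I.gain {a}) hne
  obtain ⟨c, hc, hc'⟩ := O.exists_max_image (I.gain {b, a}) hne
  set C : Finset (Fin I.n) := {c, b, a} with hCdef
  have hCO : C ⊆ O := by
    intro x hx
    simp only [hCdef, Finset.mem_insert, Finset.mem_singleton] at hx
    rcases hx with rfl | rfl | rfl <;> assumption
  have hCf : I.Feasible C := hO.mono hCO
  refine ⟨C, Finset.card_le_three, hCf, fun D hA => ?_⟩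
  have hC3 : I.gbc C = I.gain ∅ a + I.gain {a} b + I.gain {b, a} c := by
    rw [hCdef, gbc_insert, gbc_insert, gbc_singleton]
  have hCpos := gbc_nonneg C
  have hOpos := gbc_nonneg O
  have hCO' := gbc_mono hCO
  have hbud : I.totalCost (O \ C) + I.totalCost C ≤ I.budget := (totalCost_sdiff hCO).trans_le hO
  rcases hA.exists_first_drop (T := O) (β := I.totalCost (O \ C)) (M := I.gbc O - I.gbc C)
    disjoint_compl_right hCf (by rw [Finset.union_compl]; exact Finset.subset_univ O) le_rfl
    (by linarith) le_rfl with h | ⟨S, U', u, h1, h2, h3, h4, h5, h6, h7, h8, h9, h10⟩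
  · have := gbc_mono h
    nlinarith
  have hS := gbc_mono h9.subset
  have hcu := cost_pos_of_not_feasible h2 h6 h8
  have hβ : 0 < I.totalCost (O \ C) := by
    refine hcu.trans_le (Finset.single_le_sum (f := I.cost) (fun v _ => I.cost_nonneg v) ?_)
    exact Finset.mem_sdiff.2 ⟨h5, fun h => h6 (h1 h)⟩
  -- The rejected node `u` is added fictitiously, as if the budget allowed it.
  have h11 := h7.deficit_le h4
    (totalCost_mono (Finset.sdiff_subset_sdiff subset_rfl h1))
    (mul_nonneg (by linarith) (Real.exp_nonneg _)) h10
  rw [mul_assoc, ← Real.exp_add] at h11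
  -- Since S + u exceeds the budget, the cost added beyond `C` is more than the budget minus c(C),
  -- which is at least c(O \ C); so the exponent is at most -1.
  have hexp : Real.exp (-(I.totalCost S - I.totalCost C) / I.totalCost (O \ C) +
      -I.cost u / I.totalCost (O \ C)) ≤ 1 / Real.exp 1 := by
    rw [one_div, ← Real.exp_neg, Real.exp_le_exp, ← add_div, div_le_iff₀ hβ]
    rw [feasible_iff, totalCost_insert h6] at h8
    linarith
  have h12 := h11.trans (mul_le_mul_of_nonneg_left hexp (by linarith : 0 ≤ I.gbc O - I.gbc C))
  rw [gbc_insert] at h12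
  -- By submodularity and the choice of `a`, `b`, `c`, the gain of `u` is at most each of the three
  -- summands of GBC(C), hence at most GBC(C)/3 ≤ GBC(C)/e.
  have g1 : I.gain S u ≤ I.gain {b, a} c :=
    (gain_anti ((Finset.subset_insert _ _).trans h1) u).trans (hc' u h5)
  have g2 : I.gain S u ≤ I.gain {a} b :=
    (gain_anti (((Finset.subset_insert _ _).trans (Finset.subset_insert _ _)).trans h1) u).trans
      (hb' u h5)
  have g3 : I.gain S u ≤ I.gain ∅ a := (gain_anti (Finset.empty_subset _) u).trans (ha' u h5)
  nlinarith

theorem Search.spec {L : List (Finset (Fin I.n))} {H H' : Finset (Fin I.n)}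
    (h : I.Search L H H') (hH : I.Feasible H) (hL : ∀ C ∈ L, I.Feasible C) :
    I.Feasible H' ∧ I.gbc H ≤ I.gbc H' ∧
      ∀ C ∈ L, ∃ D, I.Augment C Cᶜ D ∧ I.gbc D ≤ I.gbc H' := by
  induction h with
  | finish H => exact ⟨hH, le_rfl, by simp⟩
  | @better C D H H' L hA hlt _ ih =>
    obtain ⟨h1, h2, h3⟩ := ih (hA.feasible (hL C (by simp))) fun C hC => hL C (by simp [hC])
    refine ⟨h1, hlt.le.trans h2, fun C' hC' => ?_⟩
    rcases List.mem_cons.1 hC' with rfl | hC'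
    · exact ⟨D, hA, h2⟩
    · exact h3 C' hC'
  | @keep C D H H' L hA hlt _ ih =>
    obtain ⟨h1, h2, h3⟩ := ih hH fun C hC => hL C (by simp [hC])
    refine ⟨h1, h2, fun C' hC' => ?_⟩
    rcases List.mem_cons.1 hC' with rfl | hC'
    · exact ⟨D, hA, (not_lt.1 hlt).trans h2⟩
    · exact h3 C' hC'

theorem IsGreedyResult.isApproxSolution {H : Finset (Fin I.n)} (h : I.IsGreedyResult H) :
    I.IsApproxSolution (1 - 1 / Real.exp 1) H := by
  obtain ⟨L, -, hL, hS⟩ := h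
  obtain ⟨h1, -, h3⟩ := hS.spec feasible_empty fun C hC => ((hL C).1 hC).2
  refine ⟨h1, fun O hO => ?_⟩
  obtain ⟨C, hC, hCf, hC'⟩ := exists_good_start hO
  obtain ⟨D, hD, hD'⟩ := h3 C ((hL C).2 ⟨hC, hCf⟩)
  exact (hC' D hD).trans hD'

/-- After bounding `E` by 1/z^4, the difference of the two sides has the factor z - 1. The cofactor
is nonnegative because 4(2q - 1) ≥ q, which is exactly q ≥ 4/7. -/
theorem exp_deficit_bound {q z E : ℝ} (hq : 4 / 7 ≤ q) (hz : 1 ≤ z) (hE : E * z ^ 4 ≤ 1) :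
    E * (q - 1 + q * z) ≤ 2 * q - 1 := by
  have hz4 : 0 < z ^ 4 := by positivity
  have h1 : q - 1 + q * z ≤ (2 * q - 1) * z ^ 4 := by
    have : (2 * q - 1) * z ^ 4 - (q - 1 + q * z) =
        (z - 1) * ((2 * q - 1) * (z ^ 3 + z ^ 2 + z + 1) - q) := by ring
    have h3 : 4 ≤ z ^ 3 + z ^ 2 + z + 1 := by
      have := one_le_pow₀ hz (n := 3)
      have := one_le_pow₀ hz (n := 2)
      linarith
    have := mul_nonneg (sub_nonneg.2 hz)
      (by nlinarith : 0 ≤ (2 * q - 1) * (z ^ 3 + z ^ 2 + z + 1) - q)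
    linarith
  have h2 : 0 ≤ q - 1 + q * z := by nlinarith
  have hE' : E ≤ 1 / z ^ 4 := by rwa [le_div_iff₀ hz4]
  calc E * (q - 1 + q * z) ≤ 1 / z ^ 4 * (q - 1 + q * z) := mul_le_mul_of_nonneg_right hE' h2
    _ ≤ 1 / z ^ 4 * ((2 * q - 1) * z ^ 4) := mul_le_mul_of_nonneg_left h1 (by positivity)
    _ = 2 * q - 1 := by field_simp

/-- The square of 7/4 is 49/16, which exceeds e. -/
theorem four_sevenths_le_exp : (4 : ℝ) / 7 ≤ Real.exp (-(1 / 2)) := by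
  have h : Real.exp (1 / 2) * Real.exp (1 / 2) = Real.exp 1 := by
    rw [← Real.exp_add]; norm_num
  have h0 := Real.exp_pos (1 / 2)
  have h1 : Real.exp (1 / 2) ≤ 7 / 4 := by
    nlinarith [Real.exp_one_lt_d9]
  rw [Real.exp_neg, le_inv_comm₀ (by norm_num) h0]
  linarith

/-- The inner loop from the empty start together with the best single node yields a
`(1 - 1/√e)`-approximate solution. -/
theorem le_gbc_of_augment_empty {D H O : Finset (Fin I.n)} (hA : I.Augment ∅ Finset.univ D)
    (hD : I.gbc D ≤ I.gbc H) (hH : ∀ v, I.Feasible {v} → I.gbc {v} ≤ I.gbc H)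
    (hO : I.Feasible O) : (1 - Real.exp (-(1 / 2))) * I.gbc O ≤ I.gbc H := by
  set q := Real.exp (-(1 / 2)) with hqdef
  have hq := four_sevenths_le_exp
  rw [← hqdef] at hq
  have hq1 : q ≤ 1 := by rw [hqdef, Real.exp_le_one_iff]; norm_num
  have hF := gbc_nonneg O
  have hOb : I.totalCost O ≤ I.budget := hO
  rcases hA.exists_first_drop (T := O) (β := I.budget) (M := I.gbc O) (Finset.disjoint_empty_left _)
    feasible_empty (by simp) (by simpa using hOb) hF (by simp [gbc_empty]) with
    h | ⟨S, U, u, h1, h2, h3, h4, h5, h6, h7, h8, h9, h10⟩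
  · have := gbc_mono h
    nlinarith
  have hSD := gbc_mono h9.subset
  have hcu := cost_pos_of_not_feasible h2 h6 h8
  have hsingle : I.totalCost {u} ≤ I.budget := hO.mono (Finset.singleton_subset_iff.2 h5)
  have hbu : I.cost u ≤ I.budget := by simpa [totalCost] using hsingle
  have hu := hH u hsingle
  have hb : 0 < I.budget := hcu.trans_le hbu
  have hexc : I.budget < I.cost u + I.totalCost S := by
    rwa [feasible_iff, totalCost_insert h6, not_le] at h8
  set X := I.totalCost S with hX
  have hXpos : 0 < X := by linarith
  have h0 : I.totalCost ∅ = 0 := by simp [totalCost]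
  rw [h0, sub_zero] at h10
  -- With half of the budget spent, the deficit is already at most GBC(O)/√e.
  by_cases hhalf : I.budget / 2 ≤ X
  · have : Real.exp (-X / I.budget) ≤ q := by
      rw [hqdef, Real.exp_le_exp, div_le_iff₀ hb]
      linarith
    nlinarith
  push Not at hhalf
  by_cases hbig : (1 - q) * I.gbc O ≤ I.gbc {u}
  · exact hbig.trans hu
  push Not at hbig
  set O' := O.erase u with hO'
  have hO'c : I.totalCost O' = I.totalCost O - I.cost u := by
    rw [← Finset.insert_erase h5, totalCost_insert (Finset.notMem_erase u O)]
    ring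
  -- A node worth less than (1 - q)·GBC(O) cannot take more than that away from `O`.
  have hF' : q * I.gbc O ≤ I.gbc O' := by
    have e : I.gbc O = I.gbc O' + I.gain O' u := by
      rw [← gbc_insert, hO', Finset.insert_erase h5]
    have := gain_anti (Finset.empty_subset O') u
    rw [← gbc_singleton] at this
    linarith
  have hdis : Disjoint S (U.erase u) := h3.mono_right (Finset.erase_subset _ _)
  have hT : O' ⊆ S ∪ U.erase u := by
    intro w hw
    rw [hO', Finset.mem_erase] at hw
    have := h4 hw.2
    simp only [Finset.mem_union, Finset.mem_erase] at this ⊢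
    tauto
  by_cases hneg : I.gbc O' ≤ I.gbc S
  · nlinarith
  push Not at hneg
  -- Second phase, with target O - u. Its cost is at most the budget minus c(u), which is less than
  -- `X` because S + u exceeds the budget.
  rcases h9.exists_first_drop (T := O') (β := X) (M := I.gbc O' - I.gbc S) hdis h2 hT
    ((totalCost_mono Finset.sdiff_subset).trans (by linarith)) (by linarith) le_rfl with
    h | ⟨S', U', u', k1, k2, k3, k4, k5, k6, k7, k8, k9, k10⟩
  · have := gbc_mono h
    nlinarith
  have hSD' := gbc_mono k9.subset
  have hu' : I.cost u' ≤ I.totalCost O' :=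
    Finset.single_le_sum (f := I.cost) (fun v _ => I.cost_nonneg v) k5
  have hexc' : I.budget < I.cost u' + I.totalCost S' := by
    rwa [feasible_iff, totalCost_insert k6, not_le] at k8
  set E := Real.exp (-(I.totalCost S' - X) / X) with hE
  set z := Real.exp (1 / 2 - X / I.budget) with hz
  have hxb : X / I.budget < 1 / 2 := by rw [div_lt_iff₀ hb]; linarith
  have hz1 : 1 ≤ z := by
    rw [hz, Real.one_le_exp_iff]
    linarith
  have hqz : Real.exp (-X / I.budget) = q * z := by
    rw [hqdef, hz, ← Real.exp_add]
    congr 1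
    ring
  rw [hqz] at h10
  -- The next rejected node `u'` of the target costs less than `X`, so the cost added in the second
  -- phase exceeds b - 2X, with b the budget. As X < b/2, the quotient (b - 2X)/X is at least 2(b -
  -- 2X)/b, which is four times the exponent of `z`.
  have hEz : E * z ^ 4 ≤ 1 := by
    rw [hE, hz, ← Real.exp_nat_mul, ← Real.exp_add, Real.exp_le_one_iff]
    have e1 : (I.budget - 2 * X) / X ≤ (I.totalCost S' - X) / X :=
      div_le_div_of_nonneg_right (by linarith) hXpos.le
    have e2 : 2 * ((I.budget - 2 * X) / I.budget) ≤ (I.budget - 2 * X) / X := by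
      rw [← mul_div_assoc, div_le_div_iff₀ hb hXpos]
      nlinarith
    have e3 : 2 * ((I.budget - 2 * X) / I.budget) = 4 * (1 / 2 - X / I.budget) := by
      field_simp
      ring
    rw [neg_div]
    push_cast
    linarith
  have hE1 : E ≤ 1 := by
    have hE0 : 0 ≤ E := (Real.exp_pos _).le
    have := one_le_pow₀ hz1 (n := 4)
    nlinarith
  have hE0 : 0 ≤ E := (Real.exp_pos _).le
  have hfin := exp_deficit_bound hq hz1 hEz
  -- The final value is at least (1 - E)·GBC(O') + E·GBC(S), and GBC(S) ≥ (1 - qz)·GBC(O). This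
  -- leaves q - E(q - 1 + qz) ≥ 1 - q times GBC(O).
  have f1 : (1 - E) * (q * I.gbc O) ≤ (1 - E) * I.gbc O' :=
    mul_le_mul_of_nonneg_left hF' (by linarith)
  have f2 : E * (I.gbc O - I.gbc O * (q * z)) ≤ E * I.gbc S :=
    mul_le_mul_of_nonneg_left (by linarith) hE0
  have f3 := mul_le_mul_of_nonneg_right hfin hF
  nlinarith

theorem one_div_sqrt_exp : 1 / Real.sqrt (Real.exp 1) = Real.exp (-(1 / 2)) := by
  rw [Real.exp_neg, one_div, Real.exp_half]

end MBC

/-! ### Reasoning about programs of the machine -/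

namespace RealRAM

/-! ### Updates of the store -/

namespace Store

/-- Assign a natural register. -/
def setN (s : Store) (x v : ℕ) : Store := { s with nreg := Function.update s.nreg x v }

/-- Assign a real register. -/
def setR (s : Store) (x : ℕ) (v : ℝ) : Store := { s with rreg := Function.update s.rreg x v }

/-- Assign a cell of an array of natural numbers. -/
def setNA (s : Store) (A i j v : ℕ) : Store :=
  { s with
    narr := Function.update s.narr A
      (Function.update (s.narr A) i (Function.update (s.narr A i) j v)) }

/-- Assign a cell of an array of real numbers. -/
def setRA (s : Store) (A i j : ℕ) (v : ℝ) : Store :=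
  { s with
    rarr := Function.update s.rarr A
      (Function.update (s.rarr A) i (Function.update (s.rarr A i) j v)) }

variable (s : Store) (x v A i j : ℕ) (r : ℝ)

@[simp] theorem setN_nreg (y : ℕ) : (s.setN x v).nreg y = if y = x then v else s.nreg y :=
  Function.update_apply _ _ _ _
@[simp] theorem setN_rreg : (s.setN x v).rreg = s.rreg := rfl
@[simp] theorem setN_narr : (s.setN x v).narr = s.narr := rfl
@[simp] theorem setN_rarr : (s.setN x v).rarr = s.rarr := rfl
@[simp] theorem setR_rreg (y : ℕ) : (s.setR x r).rreg y = if y = x then r else s.rreg y :=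
  Function.update_apply _ _ _ _
@[simp] theorem setR_nreg : (s.setR x r).nreg = s.nreg := rfl
@[simp] theorem setR_narr : (s.setR x r).narr = s.narr := rfl
@[simp] theorem setR_rarr : (s.setR x r).rarr = s.rarr := rfl
@[simp] theorem setNA_nreg : (s.setNA A i j v).nreg = s.nreg := rfl
@[simp] theorem setNA_rreg : (s.setNA A i j v).rreg = s.rreg := rfl
@[simp] theorem setNA_rarr : (s.setNA A i j v).rarr = s.rarr := rfl
@[simp] theorem setRA_nreg : (s.setRA A i j r).nreg = s.nreg := rfl
@[simp] theorem setRA_rreg : (s.setRA A i j r).rreg = s.rreg := rfl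
@[simp] theorem setRA_narr : (s.setRA A i j r).narr = s.narr := rfl

@[simp] theorem setNA_narr (B a b : ℕ) : (s.setNA A i j v).narr B a b =
    if B = A ∧ a = i ∧ b = j then v else s.narr B a b := by
  simp only [setNA, Function.update_apply]
  by_cases h1 : B = A <;> by_cases h2 : a = i <;> by_cases h3 : b = j <;>
    simp [h1, h2, h3]

@[simp] theorem setRA_rarr (B a b : ℕ) : (s.setRA A i j r).rarr B a b =
    if B = A ∧ a = i ∧ b = j then r else s.rarr B a b := by
  simp only [setRA, Function.update_apply]
  by_cases h1 : B = A <;> by_cases h2 : a = i <;> by_cases h3 : b = j <;>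
    simp [h1, h2, h3]

end Store

attribute [simp] NExp.val RExp.val Test.Holds

/-! ### Registers and arrays that a program leaves alone -/

namespace Prog

/-- The program does not assign the natural register `y`. -/
def keepsN : Prog → ℕ → Bool
  | nop, _ => true
  | setNReg x _, y => y != x
  | setRReg _ _, _ => true
  | setNCell _ _ _ _, _ => true
  | setRCell _ _ _ _, _ => true
  | seq p q, y => p.keepsN y && q.keepsN y
  | ite _ p q, y => p.keepsN y && q.keepsN y
  | loop _ p, y => p.keepsN y

/-- The program does not assign the real register `y`. -/
def keepsR : Prog → ℕ → Bool
  | nop, _ => true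
  | setNReg _ _, _ => true
  | setRReg x _, y => y != x
  | setNCell _ _ _ _, _ => true
  | setRCell _ _ _ _, _ => true
  | seq p q, y => p.keepsR y && q.keepsR y
  | ite _ p q, y => p.keepsR y && q.keepsR y
  | loop _ p, y => p.keepsR y

/-- The program does not change the array `B` of natural numbers. -/
def keepsNA : Prog → ℕ → Bool
  | nop, _ => true
  | setNReg _ _, _ => true
  | setRReg _ _, _ => true
  | setNCell A _ _ _, B => B != A
  | setRCell _ _ _ _, _ => true
  | seq p q, y => p.keepsNA y && q.keepsNA y
  | ite _ p q, y => p.keepsNA y && q.keepsNA y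
  | loop _ p, y => p.keepsNA y

/-- The program does not change the array `B` of real numbers. -/
def keepsRA : Prog → ℕ → Bool
  | nop, _ => true
  | setNReg _ _, _ => true
  | setRReg _ _, _ => true
  | setNCell _ _ _ _, _ => true
  | setRCell A _ _ _, B => B != A
  | seq p q, y => p.keepsRA y && q.keepsRA y
  | ite _ p q, y => p.keepsRA y && q.keepsRA y
  | loop _ p, y => p.keepsRA y

end Prog

/-- The stores `s` and `s'` agree on everything that `p` does not assign. -/
structure Unch (p : Prog) (s s' : Store) : Prop where
  n : ∀ {y}, p.keepsN y = true → s'.nreg y = s.nreg y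
  r : ∀ {y}, p.keepsR y = true → s'.rreg y = s.rreg y
  na : ∀ {B}, p.keepsNA B = true → s'.narr B = s.narr B
  ra : ∀ {B}, p.keepsRA B = true → s'.rarr B = s.rarr B

theorem Unch.refl (p : Prog) (s : Store) : Unch p s s :=
  ⟨fun _ => rfl, fun _ => rfl, fun _ => rfl, fun _ => rfl⟩

theorem Unch.trans {p : Prog} {s s' s'' : Store} (h : Unch p s s') (h' : Unch p s' s'') :
    Unch p s s'' :=
  ⟨fun k => (h'.n k).trans (h.n k), fun k => (h'.r k).trans (h.r k),
    fun k => (h'.na k).trans (h.na k), fun k => (h'.ra k).trans (h.ra k)⟩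

theorem Unch.of_keeps {p q : Prog} {s s' : Store} (h : Unch p s s')
    (hn : ∀ y, q.keepsN y = true → p.keepsN y = true)
    (hr : ∀ y, q.keepsR y = true → p.keepsR y = true)
    (hna : ∀ y, q.keepsNA y = true → p.keepsNA y = true)
    (hra : ∀ y, q.keepsRA y = true → p.keepsRA y = true) : Unch q s s' :=
  ⟨fun k => h.n (hn _ k), fun k => h.r (hr _ k), fun k => h.na (hna _ k), fun k => h.ra (hra _ k)⟩

/-- The frame rule: what a program leaves alone is decided syntactically by Boolean functions, so
for concrete programs the side conditions are closed by `rfl`. -/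
theorem Run.unch {p : Prog} {s s' : Store} {t : ℕ} (h : Run p s t s') : Unch p s s' := by
  induction h with
  | nop s => exact Unch.refl _ _
  | setNReg s x e =>
    refine ⟨fun {y} k => ?_, fun _ => rfl, fun _ => rfl, fun _ => rfl⟩
    have : y ≠ x := by simpa [Prog.keepsN] using k
    exact Function.update_of_ne this _ _
  | setRReg s x e =>
    refine ⟨fun _ => rfl, fun {y} k => ?_, fun _ => rfl, fun _ => rfl⟩
    have : y ≠ x := by simpa [Prog.keepsR] using k
    exact Function.update_of_ne this _ _
  | setNCell s A i j e =>
    refine ⟨fun _ => rfl, fun _ => rfl, fun {y} k => ?_, fun _ => rfl⟩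
    have : y ≠ A := by simpa [Prog.keepsNA] using k
    exact Function.update_of_ne this _ _
  | setRCell s A i j e =>
    refine ⟨fun _ => rfl, fun _ => rfl, fun _ => rfl, fun {y} k => ?_⟩
    have : y ≠ A := by simpa [Prog.keepsRA] using k
    exact Function.update_of_ne this _ _
  | seq _ _ ih ih' =>
    refine Unch.trans (ih.of_keeps ?_ ?_ ?_ ?_) (ih'.of_keeps ?_ ?_ ?_ ?_) <;> intro y hy <;>
      simp_all [Prog.keepsN, Prog.keepsR, Prog.keepsNA, Prog.keepsRA]
  | iteTrue _ _ ih =>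
    refine ih.of_keeps ?_ ?_ ?_ ?_ <;> intro y hy <;>
      simp_all [Prog.keepsN, Prog.keepsR, Prog.keepsNA, Prog.keepsRA]
  | iteFalse _ _ ih =>
    refine ih.of_keeps ?_ ?_ ?_ ?_ <;> intro y hy <;>
      simp_all [Prog.keepsN, Prog.keepsR, Prog.keepsNA, Prog.keepsRA]
  | loopTrue _ _ _ ih ih' =>
    refine Unch.trans (ih.of_keeps ?_ ?_ ?_ ?_) ih' <;> intro y hy <;>
      simp_all [Prog.keepsN, Prog.keepsR, Prog.keepsNA, Prog.keepsRA]
  | loopFalse _ => exact Unch.refl _ _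

/-! ### Total correctness with time bounds -/

namespace Prog

/-- The time of a program all of whose loop bodies are executed at most once. -/
def size : Prog → ℕ
  | nop => 1
  | setNReg _ e => e.time + 1
  | setRReg _ e => e.time + 1
  | setNCell _ i j e => i.time + j.time + e.time + 1
  | setRCell _ i j e => i.time + j.time + e.time + 1
  | seq p q => p.size + q.size
  | ite b p q => b.time + p.size + q.size + 1
  | loop b p => b.time + p.size + 1

/-- The maximum nesting of loops. -/
def depth : Prog → ℕ
  | seq p q => max p.depth q.depth
  | ite _ p q => max p.depth q.depth
  | loop _ p => p.depth + 1
  | _ => 0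

end Prog

/-- Started in `s`, the program `p` halts in a store that satisfies `Q`, and its running time is
what is to be expected if every loop tests its condition at most `m` times. -/
def Ensures (m : ℕ) (p : Prog) (s : Store) (Q : Store → Prop) : Prop :=
  ∃ t s', Run p s t s' ∧ t ≤ p.size * m ^ p.depth ∧ Q s'

section rules

variable {m : ℕ} {p q : Prog} {s : Store} {Q Q' : Store → Prop}

/-- The frame information comes for free with every postcondition, so specifications need to mention
only what changes. -/
theorem Ensures.mono (h : Ensures m p s Q') (hQ : ∀ s', Unch p s s' → Q' s' → Q s') :
    Ensures m p s Q := by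
  obtain ⟨t, s', h1, h2, h3⟩ := h
  exact ⟨t, s', h1, h2, hQ s' h1.unch h3⟩

theorem Ensures.nop (h : Q s) : Ensures m .nop s Q :=
  ⟨1, s, .nop s, by simp [Prog.size, Prog.depth], h⟩

theorem Ensures.setNReg {x : ℕ} {e : NExp} (h : Q (s.setN x (e.val s))) :
    Ensures m (.setNReg x e) s Q :=
  ⟨_, _, .setNReg s x e, by simp [Prog.size, Prog.depth], h⟩

theorem Ensures.setRReg {x : ℕ} {e : RExp} (h : Q (s.setR x (e.val s))) :
    Ensures m (.setRReg x e) s Q :=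
  ⟨_, _, .setRReg s x e, by simp [Prog.size, Prog.depth], h⟩

theorem Ensures.setNCell {A : ℕ} {i j e : NExp}
    (h : Q (s.setNA A (i.val s) (j.val s) (e.val s))) : Ensures m (.setNCell A i j e) s Q :=
  ⟨_, _, .setNCell s A i j e, by simp [Prog.size, Prog.depth], h⟩

theorem Ensures.setRCell {A : ℕ} {i j : NExp} {e : RExp}
    (h : Q (s.setRA A (i.val s) (j.val s) (e.val s))) : Ensures m (.setRCell A i j e) s Q :=
  ⟨_, _, .setRCell s A i j e, by simp [Prog.size, Prog.depth], h⟩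

theorem Ensures.seq (hm : 1 ≤ m) (h : Ensures m p s (fun s' => Ensures m q s' Q)) :
    Ensures m (.seq p q) s Q := by
  obtain ⟨t, s', h1, h2, t', s'', h3, h4, h5⟩ := h
  refine ⟨_, _, .seq h1 h3, ?_, h5⟩
  have e1 : m ^ p.depth ≤ m ^ max p.depth q.depth := Nat.pow_le_pow_right hm (le_max_left _ _)
  have e2 : m ^ q.depth ≤ m ^ max p.depth q.depth := Nat.pow_le_pow_right hm (le_max_right _ _)
  rw [Prog.size, Prog.depth, add_mul]
  exact add_le_add (h2.trans (Nat.mul_le_mul_left _ e1)) (h4.trans (Nat.mul_le_mul_left _ e2))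

theorem Ensures.ite {b : Test} (hm : 1 ≤ m) (h1 : b.Holds s → Ensures m p s Q)
    (h2 : ¬ b.Holds s → Ensures m q s Q) : Ensures m (.ite b p q) s Q := by
  have e0 : 1 ≤ m ^ max p.depth q.depth := Nat.one_le_pow _ _ hm
  have e1 : m ^ p.depth ≤ m ^ max p.depth q.depth := Nat.pow_le_pow_right hm (le_max_left _ _)
  have e2 : m ^ q.depth ≤ m ^ max p.depth q.depth := Nat.pow_le_pow_right hm (le_max_right _ _)
  by_cases hb : b.Holds s
  · obtain ⟨t, s', h3, h4, h5⟩ := h1 hb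
    refine ⟨_, _, .iteTrue hb h3, ?_, h5⟩
    have h6 := h4.trans (Nat.mul_le_mul_left p.size e1)
    rw [Prog.size, Prog.depth]
    nlinarith
  · obtain ⟨t, s', h3, h4, h5⟩ := h2 hb
    refine ⟨_, _, .iteFalse hb h3, ?_, h5⟩
    have h6 := h4.trans (Nat.mul_le_mul_left q.size e2)
    rw [Prog.size, Prog.depth]
    nlinarith

/-- `for x := 0, …, N - 1 do p`, where `N` is the content of a register. -/
def forLoop (x N : ℕ) (p : Prog) : Prog :=
  .seq (.setNReg x (.const 0))
    (.loop (.nlt (.reg x) (.reg N)) (.seq p (.setNReg x (.add (.reg x) (.const 1)))))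

/-- Induction on the number of remaining iterations. The loop tests its condition `k + 1` times,
hence `k < m`; the body must assign neither the counter nor the bound. -/
theorem Ensures.forLoop {x N k : ℕ} (Inv : ℕ → Store → Prop) (hm : k < m) (hN : s.nreg N = k)
    (hxN : N ≠ x) (hpN : p.keepsN N = true) (hpx : p.keepsN x = true)
    (h0 : Inv 0 (s.setN x 0))
    (hstep : ∀ i s₁, i < k → s₁.nreg x = i → Unch (forLoop x N p) s s₁ → Inv i s₁ →
      Ensures m p s₁ (fun s₂ => Inv (i + 1) (s₂.setN x (i + 1))))
    (hQ : ∀ s', Unch (forLoop x N p) s s' → Inv k s' → Q s') :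
    Ensures m (forLoop x N p) s Q := by
  have hm1 : 1 ≤ m := by omega
  set L : Prog := .loop (.nlt (.reg x) (.reg N)) (.seq p (.setNReg x (.add (.reg x) (.const 1))))
  have hN' : (RealRAM.forLoop x N p).keepsN N = true := by
    simp [RealRAM.forLoop, Prog.keepsN, hpN, hxN]
  -- The increment takes 4 steps, and a successful test with its branching takes 4 more; so an
  -- iteration takes at most `c + 2` steps.
  set c := (4 + p.size * m ^ p.depth) + 2 with hc
  have key : ∀ d i s₁, i + d = k → s₁.nreg x = i → Unch (RealRAM.forLoop x N p) s s₁ → Inv i s₁ →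
      ∃ t s', Run L s₁ t s' ∧ t ≤ d * (c + 2) + 4 ∧ Unch (RealRAM.forLoop x N p) s s' ∧
        Inv k s' := by
    intro d
    induction d with
    | zero =>
      intro i s₁ hi hx hU hI
      refine ⟨_, s₁, .loopFalse ?_, ?_, hU, ?_⟩
      · simp [hx, hU.n hN', hN]; omega
      · simp [Test.time, NExp.time]
      · rwa [← hi, add_zero]
    | succ d ih =>
      intro i s₁ hi hx hU hI
      obtain ⟨t, s₂, h1, h2, h3⟩ := hstep i s₁ (by omega) hx hU hI
      have hx2 : s₂.nreg x = i := (h1.unch.n hpx).trans hx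
      have h4 : Run (.seq p (.setNReg x (.add (.reg x) (.const 1)))) s₁ (t + 4)
          (s₂.setN x (i + 1)) := by
        have := Run.setNReg s₂ x (.add (.reg x) (.const 1))
        simp only [NExp.val, hx2, NExp.time] at this
        exact .seq h1 this
      have hU2 : Unch (RealRAM.forLoop x N p) s (s₂.setN x (i + 1)) := by
        refine hU.trans (h4.unch.of_keeps ?_ ?_ ?_ ?_) <;> intro y hy <;>
          simp_all [L, RealRAM.forLoop, Prog.keepsN, Prog.keepsR, Prog.keepsNA, Prog.keepsRA]
      obtain ⟨t', s', h5, h6, h7, h8⟩ := ih (i + 1) (s₂.setN x (i + 1)) (by omega) (by simp) hU2 h3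
      refine ⟨_, s', .loopTrue ?_ h4 h5, ?_, h7, h8⟩
      · simp [hx, hU.n hN', hN]; omega
      · simp only [Test.time, NExp.time]
        rw [hc] at h6 ⊢
        linarith
  have hU0 : Unch (RealRAM.forLoop x N p) s (s.setN x 0) := by
    have : Run (.setNReg x (.const 0)) s 2 (s.setN x 0) := Run.setNReg s x (.const 0)
    refine this.unch.of_keeps ?_ ?_ ?_ ?_ <;> intro y hy <;>
      simp_all [RealRAM.forLoop, Prog.keepsN, Prog.keepsR, Prog.keepsNA, Prog.keepsRA]
  obtain ⟨t, s', h1, h2, h3, h4⟩ := key k 0 (s.setN x 0) (by omega) (by simp) hU0 h0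
  refine ⟨2 + t, s', .seq (Run.setNReg s x (.const 0)) h1, ?_, hQ s' h3 h4⟩
  simp only [RealRAM.forLoop, Prog.size, Prog.depth, NExp.time, Test.time]
  rw [show max 0 (max p.depth 0 + 1) = p.depth + 1 by simp, pow_succ]
  have e0 : 1 ≤ m ^ p.depth := Nat.one_le_pow _ _ hm1
  set y := m ^ p.depth
  -- The 6 extra steps are 2 for initializing the counter and 4 for the failing test; they fit
  -- because `k + 1 ≤ m`.
  have e1 : k * (c + 2) + 6 ≤ m * (c + 2) := by nlinarith
  have e2 : c + 2 ≤ (10 + p.size) * y := by rw [hc]; nlinarith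
  calc 2 + t ≤ m * (c + 2) := by omega
    _ ≤ m * ((10 + p.size) * y) := Nat.mul_le_mul_left _ e2
    _ ≤ _ := by nlinarith

end rules

end RealRAM

/-! ### Loops that fill arrays or add up sums -/

namespace RealRAM

theorem Unch.forLoop (x N : ℕ) {p : Prog} {s s' : Store} (h : Unch p s s') :
    Unch (forLoop x N p) s s' := by
  refine h.of_keeps ?_ ?_ ?_ ?_ <;> intro y hy <;>
    simp_all [RealRAM.forLoop, Prog.keepsN, Prog.keepsR, Prog.keepsNA, Prog.keepsRA]

section loops

variable {m : ℕ} {p q : Prog} {s : Store} {Q Q' : Store → Prop} {α : Type*}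

theorem Ensures.seq_unch (hm : 1 ≤ m) (h : Ensures m p s Q')
    (h' : ∀ s', Unch p s s' → Q' s' → Ensures m q s' Q) : Ensures m (.seq p q) s Q :=
  Ensures.seq hm (h.mono h')

/-- A loop whose `i`-th iteration assigns the value `f i` to cell `i` of an array. -/
theorem Ensures.forLoop_map {x N k : ℕ} (arr : Store → ℕ → α)
    (harr : ∀ s x v, arr (s.setN x v) = arr s) (f : Fin k → α) (hm : k < m) (hN : s.nreg N = k)
    (hxN : N ≠ x) (hpN : p.keepsN N = true) (hpx : p.keepsN x = true)
    (hstep : ∀ (i : Fin k) (s₁ : Store), s₁.nreg x = i → Unch (RealRAM.forLoop x N p) s s₁ →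
      arr s₁ i = arr s i →
      Ensures m p s₁ (fun s₂ => ∀ a : Fin k, arr s₂ a = if a = i then f i else arr s₁ a)) :
    Ensures m (RealRAM.forLoop x N p) s (fun s' => ∀ a : Fin k, arr s' a = f a) := by
  refine Ensures.forLoop
    (fun i s₁ => ∀ a : Fin k, arr s₁ a = if a.val < i then f a else arr s a) hm hN hxN hpN hpx
    (by simp [harr]) ?_ ?_
  · intro i s₁ hi hx hU hI
    have hI' := hI ⟨i, hi⟩
    rw [if_neg (by simp)] at hI'
    refine (hstep ⟨i, hi⟩ s₁ hx hU hI').mono fun s₂ _ h a => ?_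
    rw [harr, h a, hI a]
    by_cases h1 : a = ⟨i, hi⟩
    · simp [h1]
    · have h2 : a.val ≠ i := fun e => h1 (Fin.ext e)
      rw [if_neg h1]
      exact if_congr (by omega) rfl rfl
  · intro s' _ h a
    rw [h a, if_pos a.2]

/-- Two nested loops that assign the value `f i j` to cell `(i, j)` of an array. -/
theorem Ensures.forLoop_map₂ {x y N k : ℕ} (arr : Store → ℕ → ℕ → α)
    (harr : ∀ s x v, arr (s.setN x v) = arr s) (f : Fin k → Fin k → α) (hm : k < m)
    (hN : s.nreg N = k) (hxN : N ≠ x) (hyN : N ≠ y) (hxy : x ≠ y)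
    (hpN : p.keepsN N = true) (hpx : p.keepsN x = true) (hpy : p.keepsN y = true)
    (hstep : ∀ (i j : Fin k) (s₁ : Store), s₁.nreg x = i → s₁.nreg y = j →
      Unch (RealRAM.forLoop x N (RealRAM.forLoop y N p)) s s₁ → arr s₁ i j = arr s i j →
      (∀ a b : Fin k, arr s₁ a b = arr s a b ∨ arr s₁ a b = f a b) →
      Ensures m p s₁ (fun s₂ => ∀ a b : Fin k,
        arr s₂ a b = if a = i ∧ b = j then f i j else arr s₁ a b)) :
    Ensures m (RealRAM.forLoop x N (RealRAM.forLoop y N p)) s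
      (fun s' => ∀ a b : Fin k, arr s' a b = f a b) := by
  have hk : ∀ z, z ≠ y → p.keepsN z = true → (RealRAM.forLoop y N p).keepsN z = true := by
    intro z hz h
    simp [RealRAM.forLoop, Prog.keepsN, h, hz]
  refine Ensures.forLoop
    (fun i s₁ => ∀ a b : Fin k, arr s₁ a b = if a.val < i then f a b else arr s a b) hm hN hxN
    (hk N hyN hpN) (hk x hxy hpx) (by simp [harr]) ?_ ?_
  · intro i s₁ hi hx hU hI
    have hN1 : s₁.nreg N = k := by
      rw [hU.n (by simp [RealRAM.forLoop, Prog.keepsN, hpN, hxN, hyN]), hN]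
    refine Ensures.forLoop (fun j s₂ => ∀ a b : Fin k, arr s₂ a b =
      if a.val < i ∨ a.val = i ∧ b.val < j then f a b else arr s a b) hm hN1 hyN hpN hpy
      (by simpa [harr] using hI) ?_ ?_
    · intro j s₂ hj hy hU2 hI2
      have hx2 : s₂.nreg x = i := by rw [hU2.n (hk x hxy hpx), hx]
      have hI' := hI2 ⟨i, hi⟩ ⟨j, hj⟩
      rw [if_neg (by simp)] at hI'
      -- The body may read other cells of the array it overwrites; it learns that each holds its old
      -- or its final value, which is enough for updates in place.
      refine (hstep ⟨i, hi⟩ ⟨j, hj⟩ s₂ hx2 hy (hU.trans (hU2.forLoop x N)) hI' ?_).mono ?_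
      · intro a b
        rw [hI2 a b]
        split_ifs <;> simp
      · intro s₃ _ h a b
        rw [harr, h a b, hI2 a b]
        by_cases h1 : a = ⟨i, hi⟩ ∧ b = ⟨j, hj⟩
        · simp [h1.1, h1.2]
        · rw [if_neg h1]
          refine if_congr ?_ rfl rfl
          simp only [Fin.ext_iff] at h1
          omega
    · intro s₂ _ h a b
      rw [harr, h a b]
      refine if_congr ?_ rfl rfl
      have := b.2
      omega
  · intro s' _ h a b
    rw [h a b, if_pos a.2]

/-- A loop whose `i`-th iteration adds `f i` to the real register `r`. -/
theorem Ensures.forLoop_sum {x N k : ℕ} (r : ℕ) (f : Fin k → ℝ) (hm : k < m) (hN : s.nreg N = k)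
    (hxN : N ≠ x) (hpN : p.keepsN N = true) (hpx : p.keepsN x = true)
    (hstep : ∀ (i : Fin k) (s₁ : Store), s₁.nreg x = i → Unch (RealRAM.forLoop x N p) s s₁ →
      Ensures m p s₁ (fun s₂ => s₂.rreg r = s₁.rreg r + f i)) :
    Ensures m (RealRAM.forLoop x N p) s (fun s' => s'.rreg r = s.rreg r + ∑ i, f i) := by
  refine Ensures.forLoop (fun i s₁ => s₁.rreg r = s.rreg r +
    ∑ a ∈ Finset.univ.filter (fun a : Fin k => a.val < i), f a) hm hN hxN hpN hpx (by simp) ?_ ?_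
  · intro i s₁ hi hx hU hI
    refine (hstep ⟨i, hi⟩ s₁ hx hU).mono fun s₂ _ h => ?_
    have : Finset.univ.filter (fun a : Fin k => a.val < i + 1) =
        insert ⟨i, hi⟩ (Finset.univ.filter (fun a : Fin k => a.val < i)) := by
      ext a
      simp only [Finset.mem_filter, Finset.mem_univ, true_and, Finset.mem_insert, Fin.ext_iff]
      omega
    rw [Store.setN_rreg, h, hI, this, Finset.sum_insert (by simp)]
    ring
  · intro s' _ h
    rw [h]
    congr 1
    exact Finset.sum_congr (Finset.filter_true_of_mem fun a _ => a.2) fun _ _ => rfl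

end loops

/-- The numbers `e` and `f` are equal. -/
def Test.eq (e f : NExp) : Test := .and (.neg (.nlt e f)) (.neg (.nlt f e))

@[simp] theorem Test.eq_holds (s : Store) (e f : NExp) :
    (Test.eq e f).Holds s ↔ e.val s = f.val s := by
  simp only [Test.eq, Test.Holds]
  omega

/-! ### The programs

Natural registers: `0` holds `n` and `1` holds `n + 1`; `2`, `3`, `4` are loop counters; `5` is the
node to be added; `6` counts the rounds of the greedy algorithm; `7`, `8`, `9` describe the start
(the value `n` stands for no node).
Arrays of natural numbers: `0` adjacency, `1` output, `2` distances, `3` current solution, `4` nodes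
not yet considered.
Real registers: `0` budget, `1` cost and `2` value of the current solution, `3` value of the output,
`4` accumulator.
Arrays of real numbers: `0` costs, `1` numbers of shortest paths, `2` reciprocals of these off the
diagonal, `3` gains with respect to the empty set, `4` numbers of shortest paths avoiding the current
solution, `5` gains with respect to the current solution, `6` dependencies, `7` a row of array `4`. -/

/-- The contents of cell `(reg i, reg j)`. -/
def cellN (A i j : ℕ) : NExp := .cell A (.reg i) (.reg j)

/-- The contents of cell `(reg i, reg j)`. -/
def cellR (A i j : ℕ) : RExp := .cell A (.reg i) (.reg j)

/-- The contents of cell `(reg i, 0)`. -/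
def entryR (A i : ℕ) : RExp := .cell A (.reg i) (.const 0)

/-- The node in register `y` lies on a shortest path between those in `x` and `z`. -/
def betweenTest (x y z : ℕ) : Test :=
  .neg (.nlt (cellN 2 x z) (.add (cellN 2 x y) (cellN 2 y z)))

@[simp] theorem cellN_val (s : Store) (A i j : ℕ) :
    (cellN A i j).val s = s.narr A (s.nreg i) (s.nreg j) := rfl

@[simp] theorem cellR_val (s : Store) (A i j : ℕ) :
    (cellR A i j).val s = s.rarr A (s.nreg i) (s.nreg j) := rfl

@[simp] theorem entryR_val (s : Store) (A i : ℕ) :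
    (entryR A i).val s = s.rarr A (s.nreg i) 0 := rfl

/-- The distance matrix is available. -/
def HasDist (I : MBC) (s : Store) : Prop := ∀ x y : Fin I.n, s.narr 2 x y = I.graph.dist x y

/-- The test checks only one inequality; the other is the triangle inequality. -/
theorem betweenTest_holds {I : MBC} {s : Store} (h : HasDist I s) {x y z : ℕ} {a b c : Fin I.n}
    (ha : s.nreg x = a) (hb : s.nreg y = b) (hc : s.nreg z = c) :
    (betweenTest x y z).Holds s ↔ I.graph.IsBetween a b c := by
  have h1 : I.graph.dist a c ≤ I.graph.dist a b + I.graph.dist b c := I.connected.dist_triangle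
  simp only [betweenTest, Test.Holds, cellN_val, NExp.val, ha, hb, hc, h a b, h b c, h a c,
    SimpleGraph.IsBetween]
  omega

/-- Initial values of the distances. -/
def initDist : Prog :=
  forLoop 2 0 (forLoop 3 0
    (.ite (.eq (.reg 2) (.reg 3)) (.setNCell 2 (.reg 2) (.reg 3) (.const 0))
      (.ite (.nlt (.const 0) (cellN 0 2 3)) (.setNCell 2 (.reg 2) (.reg 3) (.const 1))
        (.setNCell 2 (.reg 2) (.reg 3) (.reg 0)))))

/-- One stage of the Floyd--Warshall algorithm. -/
def distStage : Prog :=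
  forLoop 2 0 (forLoop 3 0
    (.ite (.nlt (.add (cellN 2 2 4) (cellN 2 4 3)) (cellN 2 2 3))
      (.setNCell 2 (.reg 2) (.reg 3) (.add (cellN 2 2 4) (cellN 2 4 3))) .nop))

/-- Computation of all distances. -/
def allDist : Prog := .seq initDist (forLoop 4 0 distStage)

/-- Initial values of the numbers of shortest paths. -/
def initCount : Prog :=
  forLoop 2 0 (forLoop 3 0
    (.ite (.nlt (.const 1) (cellN 2 2 3)) (.setRCell 1 (.reg 2) (.reg 3) .zero)
      (.setRCell 1 (.reg 2) (.reg 3) .one)))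

/-- One stage of the computation of the numbers of shortest paths. -/
def countStage : Prog :=
  forLoop 2 0 (forLoop 3 0
    (.ite (.and (.neg (.eq (.reg 2) (.reg 4)))
        (.and (.neg (.eq (.reg 3) (.reg 4))) (betweenTest 2 4 3)))
      (.setRCell 1 (.reg 2) (.reg 3) (.add (cellR 1 2 3) (.mul (cellR 1 2 4) (cellR 1 4 3)))) .nop))

/-- Computation of the numbers of shortest paths. -/
def allCount : Prog := .seq initCount (forLoop 4 0 countStage)

/-- Computation of the reciprocals of the numbers of shortest paths. -/
def allWeight : Prog :=
  forLoop 2 0 (forLoop 3 0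
    (.ite (.eq (.reg 2) (.reg 3)) (.setRCell 2 (.reg 2) (.reg 3) .zero)
      (.setRCell 2 (.reg 2) (.reg 3) (.div .one (cellR 1 2 3)))))

/-- Computation of the gains with respect to the empty set. -/
def allGain : Prog :=
  forLoop 2 0 (.seq (.setRReg 4 .zero) (.seq
    (forLoop 3 0 (forLoop 4 0 (.ite (betweenTest 3 2 4)
      (.setRReg 4 (.add (.reg 4) (.mul (cellR 2 3 4) (.mul (cellR 1 3 2) (cellR 1 2 4))))) .nop)))
    (.setRCell 3 (.reg 2) (.const 0) (.reg 4))))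

/-! ### Correctness of the preprocessing -/

section preprocessing

variable {I : MBC} {s : Store} {m : ℕ}

/-- The number `n` plays the role of infinity: in a connected graph it exceeds all distances, and
without inner nodes only equal or adjacent nodes need exact entries. -/
theorem initDist_spec (hm : I.n < m) (hn : s.nreg 0 = I.n) (hadj : s.narr 0 = (input I).narr 0) :
    Ensures m initDist s (fun s' => ∀ x y : Fin I.n, I.graph.dist x y ≤ s'.narr 2 x y ∧
      (I.graph.numVia (fun _ => False) x y ≠ 0 → s'.narr 2 x y ≤ I.graph.dist x y)) := by
  classical
  have hm1 : 1 ≤ m := by omega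
  refine Ensures.mono (Ensures.forLoop_map₂ (fun s => s.narr 2) (fun _ _ _ => rfl)
    (fun i j => if i = j then 0 else if I.graph.Adj i j then 1 else I.n) hm hn (by decide)
    (by decide) (by decide) rfl rfl rfl ?_) ?_
  · intro i j s₁ hi hj hU h _
    have hn1 : s₁.nreg 0 = I.n := (hU.n rfl).trans hn
    have ha1 : s₁.narr 0 i j = if I.graph.Adj i j then 1 else 0 := by
      rw [hU.na (B := 0) rfl, hadj]
      simp [input]
    have hij : (Test.eq (.reg 2) (.reg 3)).Holds s₁ ↔ i = j := by
      rw [Test.eq_holds, NExp.val, NExp.val, hi, hj, Fin.val_inj]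
    refine Ensures.ite hm1 (fun h1 => ?_) fun h1 => Ensures.ite hm1 (fun h2 => ?_) fun h2 => ?_
    all_goals
      rw [hij] at h1
      refine Ensures.setNCell fun a b => ?_
      simp only [Store.setNA_narr, NExp.val, hi, hj, Fin.val_inj, true_and]
      refine if_congr Iff.rfl ?_ rfl
    · simp [h1]
    · have h3 : I.graph.Adj i j := by by_contra h3; simp [hi, hj, ha1, h3] at h2
      simp [h1, h3]
    · have h3 : ¬ I.graph.Adj i j := by intro h3; simp [hi, hj, ha1, h3] at h2
      simp [h1, h3, hn1]
  · intro s' _ h x y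
    rw [h x y, SimpleGraph.numVia_empty (fun _ h => h)]
    by_cases h1 : x = y
    · simp [h1]
    by_cases h2 : I.graph.Adj x y
    · simp [h1, h2, SimpleGraph.dist_eq_one_iff_adj.2 h2]
    · simp only [h1, h2, if_false, or_self, ne_eq, not_true_eq_false, false_implies, and_true]
      obtain ⟨p, hp, hp'⟩ := I.connected.exists_path_of_dist x y
      rw [← hp']
      have := hp.length_lt
      simp only [Fintype.card_fin] at this
      exact this.le

theorem distStage_spec (hm : I.n < m) (hn : s.nreg 0 = I.n) {v : Fin I.n} (hv : s.nreg 4 = v) :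
    Ensures m distStage s (fun s' => ∀ x y : Fin I.n, s'.narr 2 x y =
      min (s.narr 2 x y) (s.narr 2 x v + s.narr 2 v y)) := by
  have hm1 : 1 ≤ m := by omega
  refine Ensures.forLoop_map₂ (fun s => s.narr 2) (fun _ _ _ => rfl) _ hm hn (by decide)
    (by decide) (by decide) rfl rfl rfl ?_
  intro i j s₁ hi hj hU h hall
  have hv1 : s₁.nreg 4 = v := (hU.n rfl).trans hv
  -- Row and column `v` survive the stage even if already processed, since adding the natural number
  -- D(v, v) cannot lower the minimum.
  have e1 : s₁.narr 2 i v = s.narr 2 i v := (hall i v).elim id fun h => by rw [h]; simp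
  have e2 : s₁.narr 2 v j = s.narr 2 v j := (hall v j).elim id fun h => by rw [h]; simp
  refine Ensures.ite hm1 (fun h1 => Ensures.setNCell fun a b => ?_)
    (fun h1 => Ensures.nop fun a b => ?_)
  all_goals simp only [Test.Holds, NExp.val, cellN_val, hi, hj, hv1, e1, e2, h] at h1
  · simp only [Store.setNA_narr, NExp.val, cellN_val, hi, hj, hv1, Fin.val_inj, true_and, e1, e2]
    refine if_congr Iff.rfl ?_ rfl
    omega
  · split_ifs with h2
    · rw [h2.1, h2.2, h]
      omega
    · rfl

theorem allDist_spec (hm : I.n < m) (hn : s.nreg 0 = I.n) (hadj : s.narr 0 = (input I).narr 0) :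
    Ensures m allDist s (HasDist I) := by
  have hm1 : 1 ≤ m := by omega
  refine Ensures.seq_unch hm1 (initDist_spec hm hn hadj) fun s₁ hU h => ?_
  refine Ensures.forLoop (fun k s₂ => ∀ x y : Fin I.n, I.graph.dist x y ≤ s₂.narr 2 x y ∧
    (I.graph.numVia (fun w => w.val < k) x y ≠ 0 → s₂.narr 2 x y ≤ I.graph.dist x y)) hm
    ((hU.n rfl).trans hn) (by decide) rfl rfl (by simpa using h) ?_ ?_
  · intro k s₂ hk hx hU2 hI
    refine (distStage_spec (v := ⟨k, hk⟩) hm ((hU2.n rfl).trans ((hU.n rfl).trans hn)) hx).mono ?_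
    intro s₃ _ h3 x y
    simp only [Store.setN_narr]
    rw [h3 x y]
    refine I.connected.floydWarshall_step (v := ⟨k, hk⟩) (Q := fun w => w.val < k) ?_ (by simp)
      (D := fun x y => s₂.narr 2 x y) hI x y
    intro w
    simp only [Fin.ext_iff]
    omega
  · intro s' _ h x y
    have := h x y
    -- With all nodes permitted every pair has a counted path, by connectedness, so the upper bounds
    -- have become exact.
    rw [SimpleGraph.numVia_of_forall (fun w => w.2)] at this
    exact le_antisymm (this.2 (I.connected.numShortest_pos x y).ne') this.1

theorem initCount_spec (hm : I.n < m) (hn : s.nreg 0 = I.n) (hd : HasDist I s) :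
    Ensures m initCount s (fun s' => ∀ x y : Fin I.n, s'.rarr 1 x y =
      I.graph.numVia (fun _ => False) x y) := by
  classical
  have hm1 : 1 ≤ m := by omega
  refine Ensures.forLoop_map₂ (fun s => s.rarr 1) (fun _ _ _ => rfl) _ hm hn (by decide)
    (by decide) (by decide) rfl rfl rfl ?_
  intro i j s₁ hi hj hU _ _
  have hd1 : s₁.narr 2 i j = I.graph.dist i j := by rw [hU.na (B := 2) rfl]; exact hd i j
  have key : I.graph.dist i j ≤ 1 ↔ i = j ∨ I.graph.Adj i j := by
    rw [← SimpleGraph.dist_eq_one_iff_adj, ← I.connected.dist_eq_zero_iff]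
    omega
  rw [SimpleGraph.numVia_empty (fun _ h => h)]
  refine Ensures.ite hm1 (fun h1 => Ensures.setRCell fun a b => ?_)
    (fun h1 => Ensures.setRCell fun a b => ?_)
  all_goals
    simp only [Test.Holds, NExp.val, cellN_val, hi, hj, hd1] at h1
    simp only [Store.setRA_rarr, NExp.val, RExp.val, hi, hj, Fin.val_inj, true_and]
    refine if_congr Iff.rfl ?_ rfl
  · rw [if_neg (by rw [← key]; omega), Nat.cast_zero]
  · rw [if_pos (by rw [← key]; omega), Nat.cast_one]

open Classical in
theorem countStage_spec (hm : I.n < m) (hn : s.nreg 0 = I.n) (hd : HasDist I s) {v : Fin I.n}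
    (hv : s.nreg 4 = v) :
    Ensures m countStage s (fun s' => ∀ x y : Fin I.n, s'.rarr 1 x y = s.rarr 1 x y +
      if x ≠ v ∧ y ≠ v ∧ I.graph.IsBetween x v y then s.rarr 1 x v * s.rarr 1 v y else 0) := by
  have hm1 : 1 ≤ m := by omega
  refine Ensures.forLoop_map₂ (fun s => s.rarr 1) (fun _ _ _ => rfl) _ hm hn (by decide)
    (by decide) (by decide) rfl rfl rfl ?_
  intro i j s₁ hi hj hU h hall
  have hv1 : s₁.nreg 4 = v := (hU.n rfl).trans hv
  have hd1 : HasDist I s₁ := by unfold HasDist; rw [hU.na (B := 2) rfl]; exact hd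
  -- The test excludes pairs with end point `v`, so the factors are still the old ones.
  have e1 : s₁.rarr 1 i v = s.rarr 1 i v := (hall i v).elim id fun h => by rw [h]; simp
  have e2 : s₁.rarr 1 v j = s.rarr 1 v j := (hall v j).elim id fun h => by rw [h]; simp
  refine Ensures.ite hm1 (fun h1 => Ensures.setRCell fun a b => ?_)
    (fun h1 => Ensures.nop fun a b => ?_)
  all_goals simp only [Test.Holds, Test.eq_holds, betweenTest_holds hd1 hi hv1 hj, NExp.val, hi, hj,
    hv1, Fin.val_inj] at h1
  · simp only [Store.setRA_rarr, NExp.val, RExp.val, cellR_val, hi, hj, hv1, Fin.val_inj, true_and,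
      e1, e2, h]
    refine if_congr Iff.rfl ?_ rfl
    rw [if_pos h1]
  · rw [if_neg h1, add_zero]
    split_ifs with h2
    · rw [h2.1, h2.2, h]
    · rfl

theorem allCount_spec (hm : I.n < m) (hn : s.nreg 0 = I.n) (hd : HasDist I s) :
    Ensures m allCount s (fun s' => ∀ x y : Fin I.n, s'.rarr 1 x y = I.graph.numShortest x y) := by
  classical
  have hm1 : 1 ≤ m := by omega
  refine Ensures.seq_unch hm1 (initCount_spec hm hn hd) fun s₁ hU h => ?_
  refine Ensures.forLoop (fun k s₂ => ∀ x y : Fin I.n,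
    s₂.rarr 1 x y = I.graph.numVia (fun w => w.val < k) x y) hm
    ((hU.n rfl).trans hn) (by decide) rfl rfl (by simpa using h) ?_ ?_
  · intro k s₂ hk hx hU2 hI
    have hd2 : HasDist I s₂ := by
      unfold HasDist; rw [hU2.na (B := 2) rfl, hU.na (B := 2) rfl]; exact hd
    refine (countStage_spec (v := ⟨k, hk⟩) hm ((hU2.n rfl).trans ((hU.n rfl).trans hn)) hd2
      hx).mono ?_
    intro s₃ _ h3 x y
    simp only [Store.setN_rarr]
    have hQ : ∀ w : Fin I.n, w.val < k + 1 ↔ w.val < k ∨ w = ⟨k, hk⟩ := by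
      intro w
      simp only [Fin.ext_iff]
      omega
    rw [h3 x y, hI x y, I.connected.numVia_insert hQ (by simp) x y, hI x, hI _ y]
    push_cast
    rfl
  · intro s' _ h x y
    rw [h x y, SimpleGraph.numVia_of_forall (fun w => w.2)]

theorem allWeight_spec (hm : I.n < m) (hn : s.nreg 0 = I.n)
    (hc : ∀ x y : Fin I.n, s.rarr 1 x y = I.graph.numShortest x y) :
    Ensures m allWeight s (fun s' => ∀ x y : Fin I.n, s'.rarr 2 x y = I.graph.pairWeight x y) := by
  have hm1 : 1 ≤ m := by omega
  refine Ensures.forLoop_map₂ (fun s => s.rarr 2) (fun _ _ _ => rfl) _ hm hn (by decide)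
    (by decide) (by decide) rfl rfl rfl ?_
  intro i j s₁ hi hj hU _ _
  have hc1 : s₁.rarr 1 i j = I.graph.numShortest i j := by rw [hU.ra (B := 1) rfl]; exact hc i j
  refine Ensures.ite hm1 (fun h1 => Ensures.setRCell fun a b => ?_)
    (fun h1 => Ensures.setRCell fun a b => ?_)
  all_goals
    simp only [Test.eq_holds, NExp.val, hi, hj, Fin.val_inj] at h1
    simp only [Store.setRA_rarr, NExp.val, RExp.val, cellR_val, hi, hj, Fin.val_inj, true_and, hc1]
    refine if_congr Iff.rfl ?_ rfl
    simp [SimpleGraph.pairWeight, h1]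

theorem allGain_spec (hm : I.n < m) (hn : s.nreg 0 = I.n) (hd : HasDist I s)
    (hc : ∀ x y : Fin I.n, s.rarr 1 x y = I.graph.numShortest x y)
    (hw : ∀ x y : Fin I.n, s.rarr 2 x y = I.graph.pairWeight x y) :
    Ensures m allGain s (fun s' => ∀ v : Fin I.n, s'.rarr 3 v 0 = I.gain ∅ v) := by
  have hm1 : 1 ≤ m := by omega
  refine Ensures.forLoop_map (fun s a => s.rarr 3 a 0) (fun _ _ _ => rfl) _ hm hn (by decide)
    rfl rfl ?_
  intro v s₁ hv hU _
  refine Ensures.seq hm1 (Ensures.setRReg ?_)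
  refine Ensures.seq hm1 ?_
  refine Ensures.mono (Ensures.forLoop_sum 4 (fun x : Fin I.n => ∑ y : Fin I.n,
    I.graph.pairWeight x y * I.graph.numThrough ∅ x v y) hm ((hU.n rfl).trans hn) (by decide)
    rfl rfl ?_) ?_
  · intro x s₂ hx hU2
    have hn2 : s₂.nreg 0 = I.n := (hU2.n rfl).trans ((hU.n rfl).trans hn)
    refine Ensures.forLoop_sum 4 _ hm hn2 (by decide) rfl rfl ?_
    intro y s₃ hy hU3
    have hd3 : HasDist I s₃ := by
      unfold HasDist; rw [hU3.na (B := 2) rfl, hU2.na (B := 2) rfl]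
      exact (hU.na (B := 2) rfl).symm ▸ hd
    have hv3 : s₃.nreg 2 = v := (hU3.n rfl).trans ((hU2.n rfl).trans hv)
    have hx3 : s₃.nreg 3 = x := (hU3.n rfl).trans hx
    have hw3 : s₃.rarr 2 x y = I.graph.pairWeight x y := by
      rw [hU3.ra (B := 2) rfl, hU2.ra (B := 2) rfl, ← hw]
      exact congrFun (congrFun (hU.ra (B := 2) rfl) _) _
    have hc3 : ∀ x y : Fin I.n, s₃.rarr 1 x y = I.graph.numShortest x y := by
      intro x y
      rw [hU3.ra (B := 1) rfl, hU2.ra (B := 1) rfl, ← hc]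
      exact congrFun (congrFun (hU.ra (B := 1) rfl) _) _
    rw [SimpleGraph.numThrough, SimpleGraph.numAvoid_empty, SimpleGraph.numAvoid_empty]
    refine Ensures.ite hm1 (fun h => Ensures.setRReg ?_) (fun h => Ensures.nop ?_)
    all_goals rw [betweenTest_holds hd3 hx3 hv3 hy] at h
    · simp [h, hv3, hx3, hy, hw3, hc3]
    · simp [h]
  · intro s₂ hU2 h
    have hv2 : s₂.nreg 2 = v := (hU2.n rfl).trans hv
    refine Ensures.setRCell fun a => ?_
    have h3 : s₂.rarr 3 = s₁.rarr 3 := hU2.ra (B := 3) rfl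
    simp only [Store.setRA_rarr, NExp.val, RExp.val, hv2, Fin.val_inj, true_and, and_true, h, h3]
    refine if_congr Iff.rfl ?_ rfl
    simp [MBC.gain, SimpleGraph.gain]

/-- The data that are computed once for an instance. -/
structure Base (I : MBC) (s : Store) : Prop where
  n : s.nreg 0 = I.n
  n_succ : s.nreg 1 = I.n + 1
  budget : s.rreg 0 = I.budget
  cost : ∀ v : Fin I.n, s.rarr 0 v 0 = I.cost v
  dist : HasDist I s
  count : ∀ x y : Fin I.n, s.rarr 1 x y = I.graph.numShortest x y
  weight : ∀ x y : Fin I.n, s.rarr 2 x y = I.graph.pairWeight x y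
  gain : ∀ v : Fin I.n, s.rarr 3 v 0 = I.gain ∅ v

theorem Base.unch {s' : Store} {p : Prog} (h : Base I s) (hU : Unch p s s')
    (hp : (p.keepsN 0 && p.keepsN 1 && p.keepsR 0 && p.keepsNA 2 && p.keepsRA 0 && p.keepsRA 1 &&
      p.keepsRA 2 && p.keepsRA 3) = true) : Base I s' := by
  simp only [Bool.and_eq_true] at hp
  obtain ⟨⟨⟨⟨⟨⟨⟨h1, h2⟩, h3⟩, h4⟩, h5⟩, h6⟩, h7⟩, h8⟩ := hp
  refine ⟨(hU.n h1).trans h.n, (hU.n h2).trans h.n_succ, (hU.r h3).trans h.budget, ?_, ?_, ?_, ?_,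
    ?_⟩
  · rw [hU.ra h5]; exact h.cost
  · unfold HasDist; rw [hU.na h4]; exact h.dist
  · rw [hU.ra h6]; exact h.count
  · rw [hU.ra h7]; exact h.weight
  · rw [hU.ra h8]; exact h.gain

/-- The computation of the data that are needed once. -/
def preprocess : Prog :=
  .seq (.setNReg 1 (.add (.reg 0) (.const 1)))
    (.seq allDist (.seq allCount (.seq allWeight allGain)))

theorem preprocess_spec (hm : I.n < m) : Ensures m preprocess (input I) (Base I) := by
  have hm1 : 1 ≤ m := by omega
  refine Ensures.seq hm1 (Ensures.setNReg ?_)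
  set s₀ := (input I).setN 1 (NExp.val (input I) (.add (.reg 0) (.const 1))) with hs₀
  have n0 : s₀.nreg 0 = I.n := by simp [hs₀, input]
  refine Ensures.seq_unch hm1 (allDist_spec hm n0 rfl) fun s₁ h1 hd => ?_
  have n1 : s₁.nreg 0 = I.n := (h1.n rfl).trans n0
  refine Ensures.seq_unch hm1 (allCount_spec hm n1 hd) fun s₂ h2 hc => ?_
  have n2 : s₂.nreg 0 = I.n := (h2.n rfl).trans n1
  have hd2 : HasDist I s₂ := by unfold HasDist; rw [h2.na (B := 2) rfl]; exact hd
  refine Ensures.seq_unch hm1 (allWeight_spec hm n2 hc) fun s₃ h3 hw => ?_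
  have n3 : s₃.nreg 0 = I.n := (h3.n rfl).trans n2
  have hd3 : HasDist I s₃ := by unfold HasDist; rw [h3.na (B := 2) rfl]; exact hd2
  have hc3 : ∀ x y : Fin I.n, s₃.rarr 1 x y = I.graph.numShortest x y := by
    rw [h3.ra (B := 1) rfl]; exact hc
  refine (allGain_spec hm n3 hd3 hc3 hw).mono fun s₄ h4 hg => ?_
  have n4 : s₄.nreg 0 = I.n := (h4.n rfl).trans n3
  refine ⟨n4, ?_, ?_, ?_, ?_, ?_, ?_, hg⟩
  · rw [h4.n (y := 1) rfl, h3.n (y := 1) rfl, h2.n (y := 1) rfl, h1.n (y := 1) rfl]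
    simp [hs₀, input]
  · rw [h4.r (y := 0) rfl, h3.r (y := 0) rfl, h2.r (y := 0) rfl, h1.r (y := 0) rfl]
    simp [hs₀, input]
  · rw [h4.ra (B := 0) rfl, h3.ra (B := 0) rfl, h2.ra (B := 0) rfl, h1.ra (B := 0) rfl]
    simp [hs₀, input]
  · unfold HasDist; rw [h4.na (B := 2) rfl]; exact hd3
  · rw [h4.ra (B := 1) rfl]; exact hc3
  · rw [h4.ra (B := 2) rfl]; exact hw

end preprocessing

end RealRAM

namespace MBC

variable {I : MBC}

theorem relGain_eq_top {C : Finset (Fin I.n)} {v : Fin I.n} (h : 0 < I.gain C v)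
    (hc : ¬ 0 < I.cost v) : I.relGain C v = ⊤ := by
  rw [relGain_eq, ENNReal.ofReal_of_nonpos (not_lt.1 hc), ENNReal.div_zero]
  simpa using h

/-- The machine convention x/0 = 0 agrees with the relative gain outside the infinite case, because
a free node then has gain zero. -/
theorem relGain_eq_ofReal {C : Finset (Fin I.n)} {v : Fin I.n}
    (h : ¬ (0 < I.gain C v ∧ ¬ 0 < I.cost v)) :
    I.relGain C v = ENNReal.ofReal (I.gain C v / I.cost v) := by
  rw [relGain_eq]
  by_cases hc : 0 < I.cost v
  · rw [ENNReal.ofReal_div_of_pos hc]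
  · have h0 : I.gain C v = 0 :=
      le_antisymm (not_lt.1 fun h' => h ⟨h', hc⟩) (gain_nonneg C v)
    simp [h0]

end MBC

/-! ### Maintaining the data of the current solution -/

namespace RealRAM

/-- The data that describe the current solution `C`. -/
structure Cur (I : MBC) (s : Store) (C : Finset (Fin I.n)) : Prop where
  mem : ∀ v : Fin I.n, s.narr 3 v 0 = if v ∈ C then 1 else 0
  cost : s.rreg 1 = I.totalCost C
  value : s.rreg 2 = I.gbc C
  count : ∀ x y : Fin I.n, s.rarr 4 x y = I.graph.numAvoid C x y
  gain : ∀ v : Fin I.n, s.rarr 5 v 0 = I.gain C v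

/-- Initialization with the empty solution. -/
def reset : Prog :=
  .seq (.setRReg 1 .zero) (.seq (.setRReg 2 .zero)
    (.seq (forLoop 2 0 (.setNCell 3 (.reg 2) (.const 0) (.const 0)))
      (.seq (forLoop 2 0 (.setRCell 5 (.reg 2) (.const 0) (entryR 3 2)))
        (forLoop 2 0 (forLoop 3 0 (.setRCell 4 (.reg 2) (.reg 3) (cellR 1 2 3)))))))

/-- Computation of the dependencies for the node in register `5`. -/
def depLoop : Prog :=
  forLoop 2 0 (.seq (.setRReg 4 .zero) (.seq
    (forLoop 3 0 (.ite (betweenTest 3 5 2)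
      (.setRReg 4 (.add (.reg 4) (.mul (cellR 2 3 2) (cellR 4 3 5)))) .nop))
    (.setRCell 6 (.reg 2) (.const 0) (.reg 4))))

/-- Update of the gains. -/
def gainLoop : Prog :=
  forLoop 2 0 (.ite (.eq (.reg 2) (.reg 5)) (.setRCell 5 (.reg 2) (.const 0) .zero)
    (.seq (.setRReg 4 .zero) (.seq
      (forLoop 3 0 (.ite (betweenTest 5 2 3)
        (.setRReg 4 (.add (.reg 4) (.mul (cellR 4 2 3) (entryR 6 3)))) .nop))
      (.setRCell 5 (.reg 2) (.const 0)
        (.sub (entryR 5 2) (.mul (.mul (.add .one .one) (cellR 4 5 2)) (.reg 4)))))))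

/-- Copy of a row of the numbers of shortest paths. -/
def rowLoop : Prog := forLoop 2 0 (.setRCell 7 (.reg 2) (.const 0) (cellR 4 5 2))

/-- Update of the numbers of shortest paths. -/
def countLoop : Prog :=
  forLoop 2 0 (forLoop 3 0 (.ite (betweenTest 2 5 3)
    (.setRCell 4 (.reg 2) (.reg 3) (.sub (cellR 4 2 3) (.mul (entryR 7 2) (entryR 7 3)))) .nop))

/-- The node in register `5` is added to the current solution. -/
def addNode : Prog :=
  .seq (.setRReg 1 (.add (entryR 0 5) (.reg 1))) (.seq (.setRReg 2 (.add (.reg 2) (entryR 5 5)))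
    (.seq (.setNCell 3 (.reg 5) (.const 0) (.const 1))
      (.seq depLoop (.seq gainLoop (.seq rowLoop countLoop)))))

variable {I : MBC} {s : Store} {m : ℕ}

theorem reset_spec (hm : I.n < m) (hB : Base I s) : Ensures m reset s (fun s' => Cur I s' ∅) := by
  have hm1 : 1 ≤ m := by omega
  refine Ensures.seq hm1 (Ensures.setRReg (Ensures.seq hm1 (Ensures.setRReg ?_)))
  set s₀ := ((s.setR 1 _).setR 2 _) with hs₀
  have h01 : s₀.rreg 1 = 0 := by simp [hs₀]
  have h02 : s₀.rreg 2 = 0 := by simp [hs₀]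
  have n0 : s₀.nreg 0 = I.n := hB.n
  have hg0 : ∀ v : Fin I.n, s₀.rarr 3 v 0 = I.gain ∅ v := hB.gain
  have hc0 : ∀ x y : Fin I.n, s₀.rarr 1 x y = I.graph.numShortest x y := hB.count
  clear_value s₀
  refine Ensures.seq_unch hm1 (Ensures.forLoop_map (fun s a => s.narr 3 a 0) (fun _ _ _ => rfl)
    (fun _ => 0) hm n0 (by decide) rfl rfl ?_) fun s₁ h1 hmem => ?_
  · intro i s₁ hi _ _
    refine Ensures.setNCell fun a => ?_
    simp [hi, Fin.val_inj]
  have n1 : s₁.nreg 0 = I.n := (h1.n rfl).trans n0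
  refine Ensures.seq_unch hm1 (Ensures.forLoop_map (fun s a => s.rarr 5 a 0) (fun _ _ _ => rfl)
    (fun v => I.gain ∅ v) hm n1 (by decide) rfl rfl ?_) fun s₂ h2 hgain => ?_
  · intro i s₂ hi hU _
    refine Ensures.setRCell fun a => ?_
    have : s₂.rarr 3 i 0 = I.gain ∅ i := by
      rw [hU.ra (B := 3) rfl, h1.ra (B := 3) rfl, hg0]
    simp [hi, Fin.val_inj, this]
  have n2 : s₂.nreg 0 = I.n := (h2.n rfl).trans n1
  refine Ensures.mono (Ensures.forLoop_map₂ (fun s => s.rarr 4) (fun _ _ _ => rfl)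
    (fun x y => I.graph.numAvoid ∅ x y) hm n2 (by decide) (by decide) (by decide) rfl rfl rfl ?_) ?_
  · intro i j s₃ hi hj hU _ _
    refine Ensures.setRCell fun a b => ?_
    have : s₃.rarr 1 i j = I.graph.numShortest i j := by
      rw [hU.ra (B := 1) rfl, h2.ra (B := 1) rfl, h1.ra (B := 1) rfl, hc0]
    simp [hi, hj, Fin.val_inj, this, SimpleGraph.numAvoid_empty]
  · intro s₃ h3 hcount
    refine ⟨?_, ?_, ?_, hcount, ?_⟩
    · rw [h3.na (B := 3) rfl, h2.na (B := 3) rfl]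
      simpa using hmem
    · rw [h3.r (y := 1) rfl, h2.r (y := 1) rfl, h1.r (y := 1) rfl, h01]
      simp [MBC.totalCost]
    · rw [h3.r (y := 2) rfl, h2.r (y := 2) rfl, h1.r (y := 2) rfl, h02, MBC.gbc_empty]
    · rw [h3.ra (B := 5) rfl]
      exact hgain

theorem depLoop_spec (hm : I.n < m) (hB : Base I s) {C : Finset (Fin I.n)}
    (hc : ∀ x y : Fin I.n, s.rarr 4 x y = I.graph.numAvoid C x y) {u : Fin I.n}
    (hu : s.nreg 5 = u) :
    Ensures m depLoop s (fun s' => ∀ t : Fin I.n, s'.rarr 6 t 0 = I.graph.dependency C u t) := by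
  have hm1 : 1 ≤ m := by omega
  refine Ensures.forLoop_map (fun s a => s.rarr 6 a 0) (fun _ _ _ => rfl) _ hm hB.n (by decide)
    rfl rfl ?_
  intro t s₁ ht hU _
  refine Ensures.seq hm1 (Ensures.setRReg ?_)
  have hB1 : Base I (s₁.setR 4 (RExp.zero.val s₁)) := by
    have h := hB.unch hU rfl
    exact ⟨h.n, h.n_succ, by simpa using h.budget, h.cost, h.dist, h.count, h.weight, h.gain⟩
  have hc1 : ∀ x y : Fin I.n, s₁.rarr 4 x y = I.graph.numAvoid C x y := by
    rw [hU.ra (B := 4) rfl]; exact hc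
  have hu1 : s₁.nreg 5 = u := (hU.n rfl).trans hu
  refine Ensures.seq_unch hm1 (Ensures.forLoop_sum 4 (fun x : Fin I.n =>
    if I.graph.IsBetween x u t then I.graph.pairWeight x t * I.graph.numAvoid C x u else 0) hm hB1.n
    (by decide) rfl rfl ?_) ?_
  · intro x s₂ hx hU2
    have hB2 := hB1.unch hU2 rfl
    have hu2 : s₂.nreg 5 = u := (hU2.n rfl).trans hu1
    have ht2 : s₂.nreg 2 = t := (hU2.n rfl).trans ht
    have hc2 : s₂.rarr 4 x u = I.graph.numAvoid C x u := by
      rw [hU2.ra (B := 4) rfl]; exact hc1 x u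
    refine Ensures.ite hm1 (fun h => Ensures.setRReg ?_) (fun h => Ensures.nop ?_)
    all_goals rw [betweenTest_holds hB2.dist hx hu2 ht2] at h
    · simp [h, hx, hu2, ht2, hc2, hB2.weight]
    · simp [h]
  · intro s₂ hU2 h
    have ht2 : s₂.nreg 2 = t := (hU2.n rfl).trans ht
    have h6 : s₂.rarr 6 = s₁.rarr 6 := hU2.ra (B := 6) rfl
    refine Ensures.setRCell fun a => ?_
    simp only [Store.setRA_rarr, NExp.val, RExp.val, ht2, Fin.val_inj, true_and, and_true, h, h6]
    refine if_congr Iff.rfl ?_ rfl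
    simp [SimpleGraph.dependency]

/-- This evaluates `SimpleGraph.Connected.gain_insert`, which requires v ≠ u; the added node itself
gets gain zero. -/
theorem gainLoop_spec (hm : I.n < m) (hB : Base I s) {C : Finset (Fin I.n)}
    (hc : ∀ x y : Fin I.n, s.rarr 4 x y = I.graph.numAvoid C x y)
    (hg : ∀ v : Fin I.n, s.rarr 5 v 0 = I.gain C v) {u : Fin I.n} (hu : s.nreg 5 = u)
    (hd : ∀ t : Fin I.n, s.rarr 6 t 0 = I.graph.dependency C u t) :
    Ensures m gainLoop s (fun s' => ∀ v : Fin I.n, s'.rarr 5 v 0 = I.gain (insert u C) v) := by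
  have hm1 : 1 ≤ m := by omega
  refine Ensures.forLoop_map (fun s a => s.rarr 5 a 0) (fun _ _ _ => rfl) _ hm hB.n (by decide)
    rfl rfl ?_
  intro v s₁ hv hU hgv
  have hu1 : s₁.nreg 5 = u := (hU.n rfl).trans hu
  refine Ensures.ite hm1 (fun h => Ensures.setRCell fun a => ?_) (fun h => ?_)
  all_goals rw [Test.eq_holds, NExp.val, NExp.val, hv, hu1, Fin.val_inj] at h
  · simp only [Store.setRA_rarr, NExp.val, RExp.val, hv, Fin.val_inj, true_and, and_true]
    refine if_congr Iff.rfl ?_ rfl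
    rw [h]
    exact (SimpleGraph.gain_of_mem (Finset.mem_insert_self u C)).symm
  refine Ensures.seq hm1 (Ensures.setRReg ?_)
  have hB1 : Base I (s₁.setR 4 (RExp.zero.val s₁)) := by
    have h := hB.unch hU rfl
    exact ⟨h.n, h.n_succ, by simpa using h.budget, h.cost, h.dist, h.count, h.weight, h.gain⟩
  have hc1 : ∀ x y : Fin I.n, s₁.rarr 4 x y = I.graph.numAvoid C x y := by
    rw [hU.ra (B := 4) rfl]; exact hc
  have hd1 : ∀ t : Fin I.n, s₁.rarr 6 t 0 = I.graph.dependency C u t := by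
    rw [hU.ra (B := 6) rfl]; exact hd
  refine Ensures.seq_unch hm1 (Ensures.forLoop_sum 4 (fun t : Fin I.n =>
    if I.graph.IsBetween u v t then I.graph.numAvoid C v t * I.graph.dependency C u t else 0) hm
    hB1.n (by decide) rfl rfl ?_) ?_
  · intro t s₂ ht hU2
    have hB2 := hB1.unch hU2 rfl
    have hu2 : s₂.nreg 5 = u := (hU2.n rfl).trans hu1
    have hv2 : s₂.nreg 2 = v := (hU2.n rfl).trans hv
    have hc2 : s₂.rarr 4 v t = I.graph.numAvoid C v t := by
      rw [hU2.ra (B := 4) rfl]; exact hc1 v t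
    have hd2 : s₂.rarr 6 t 0 = I.graph.dependency C u t := by
      rw [hU2.ra (B := 6) rfl]; exact hd1 t
    refine Ensures.ite hm1 (fun h => Ensures.setRReg ?_) (fun h => Ensures.nop ?_)
    all_goals rw [betweenTest_holds hB2.dist hu2 hv2 ht] at h
    · simp [h, hv2, ht, hc2, hd2]
    · simp [h]
  · intro s₂ hU2 hsum
    have hu2 : s₂.nreg 5 = u := (hU2.n rfl).trans hu1
    have hv2 : s₂.nreg 2 = v := (hU2.n rfl).trans hv
    have h5 : s₂.rarr 5 = s₁.rarr 5 := hU2.ra (B := 5) rfl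
    have hc2 : s₂.rarr 4 u v = I.graph.numAvoid C u v := by
      rw [hU2.ra (B := 4) rfl]; exact hc1 u v
    refine Ensures.setRCell fun a => ?_
    simp only [Store.setRA_rarr, NExp.val, RExp.val, hv2, Fin.val_inj, true_and, and_true, hsum, h5,
      entryR_val, cellR_val, hu2, hc2]
    refine if_congr Iff.rfl ?_ rfl
    have hg1 : s₁.rarr 5 v 0 = I.gain C v := hgv.trans (hg v)
    rw [hg1]
    have := I.connected.gain_insert C h
    rw [MBC.gain, MBC.gain, this]
    simp only [Store.setR_rreg, if_true, zero_add]
    norm_num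

/-- The copy is needed because the update of the counts works in place and alters row `u`, on which
all other entries depend. -/
theorem rowLoop_spec (hm : I.n < m) (hn : s.nreg 0 = I.n) {C : Finset (Fin I.n)}
    (hc : ∀ x y : Fin I.n, s.rarr 4 x y = I.graph.numAvoid C x y) {u : Fin I.n}
    (hu : s.nreg 5 = u) :
    Ensures m rowLoop s (fun s' => ∀ t : Fin I.n, s'.rarr 7 t 0 = I.graph.numAvoid C u t) := by
  refine Ensures.forLoop_map (fun s a => s.rarr 7 a 0) (fun _ _ _ => rfl) _ hm hn (by decide)
    rfl rfl ?_
  intro t s₁ ht hU _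
  have hu1 : s₁.nreg 5 = u := (hU.n rfl).trans hu
  have hc1 : s₁.rarr 4 u t = I.graph.numAvoid C u t := by
    rw [hU.ra (B := 4) rfl]; exact hc u t
  refine Ensures.setRCell fun a => ?_
  simp [ht, Fin.val_inj, hu1, hc1]

theorem countLoop_spec (hm : I.n < m) (hB : Base I s) {C : Finset (Fin I.n)}
    (hc : ∀ x y : Fin I.n, s.rarr 4 x y = I.graph.numAvoid C x y) {u : Fin I.n}
    (hu : s.nreg 5 = u) (hr : ∀ t : Fin I.n, s.rarr 7 t 0 = I.graph.numAvoid C u t) :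
    Ensures m countLoop s
      (fun s' => ∀ x y : Fin I.n, s'.rarr 4 x y = I.graph.numAvoid (insert u C) x y) := by
  have hm1 : 1 ≤ m := by omega
  refine Ensures.forLoop_map₂ (fun s => s.rarr 4) (fun _ _ _ => rfl) _ hm hB.n (by decide)
    (by decide) (by decide) rfl rfl rfl ?_
  intro x y s₁ hx hy hU hxy _
  have hB1 := hB.unch hU rfl
  have hu1 : s₁.nreg 5 = u := (hU.n rfl).trans hu
  have hr1 : ∀ t : Fin I.n, s₁.rarr 7 t 0 = I.graph.numAvoid C u t := by
    rw [hU.ra (B := 7) rfl]; exact hr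
  have hxy1 : s₁.rarr 4 x y = I.graph.numAvoid C x y := hxy.trans (hc x y)
  -- By symmetry the saved row also serves as column `u`.
  rw [I.connected.numAvoid_insert, SimpleGraph.numAvoid_comm C x u]
  refine Ensures.ite hm1 (fun h => Ensures.setRCell fun a b => ?_)
    (fun h => Ensures.nop fun a b => ?_)
  all_goals rw [betweenTest_holds hB1.dist hx hu1 hy] at h
  · simp [h, hx, hy, Fin.val_inj, hr1, hxy1]
  · simp only [h, if_false, sub_zero]
    split_ifs with h2
    · rw [h2.1, h2.2, hxy1]
    · rfl

/-- The order matters: value, dependencies and gains are computed from the old avoiding counts,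
which are overwritten last. -/
theorem addNode_spec (hm : I.n < m) (hB : Base I s) {C : Finset (Fin I.n)} (hC : Cur I s C)
    {u : Fin I.n} (hu : s.nreg 5 = u) (huC : u ∉ C) :
    Ensures m addNode s (fun s' => Cur I s' (insert u C)) := by
  have hm1 : 1 ≤ m := by omega
  refine Ensures.seq hm1 (Ensures.setRReg (Ensures.seq hm1 (Ensures.setRReg
    (Ensures.seq hm1 (Ensures.setNCell ?_)))))
  set s₀ := Store.setNA _ 3 _ _ _ with hs₀
  have hB0 : Base I s₀ :=
    ⟨hB.n, hB.n_succ, by simpa [hs₀] using hB.budget, hB.cost,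
      fun x y => by simpa [hs₀] using hB.dist x y, hB.count, hB.weight, hB.gain⟩
  have hu0 : s₀.nreg 5 = u := hu
  have hc0 : ∀ x y : Fin I.n, s₀.rarr 4 x y = I.graph.numAvoid C x y := hC.count
  have hg0 : ∀ v : Fin I.n, s₀.rarr 5 v 0 = I.gain C v := hC.gain
  have hcost0 : s₀.rreg 1 = I.totalCost (insert u C) := by
    simp [hs₀, hu, hB.cost, hC.cost, MBC.totalCost_insert huC]
  have hval0 : s₀.rreg 2 = I.gbc (insert u C) := by
    simp [hs₀, hu, hC.gain, hC.value, MBC.gbc_insert]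
  have hmem0 : ∀ v : Fin I.n, s₀.narr 3 v 0 = if v ∈ insert u C then 1 else 0 := by
    intro v
    by_cases h : v = u
    · simp [hs₀, hu, h]
    · simp [hs₀, hu, h, Fin.val_inj, hC.mem]
  clear_value s₀
  refine Ensures.seq_unch hm1 (depLoop_spec hm hB0 hc0 hu0) fun s₁ h1 hd => ?_
  have hB1 := hB0.unch h1 rfl
  have hu1 : s₁.nreg 5 = u := (h1.n rfl).trans hu0
  have hc1 : ∀ x y : Fin I.n, s₁.rarr 4 x y = I.graph.numAvoid C x y := by
    rw [h1.ra (B := 4) rfl]; exact hc0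
  have hg1 : ∀ v : Fin I.n, s₁.rarr 5 v 0 = I.gain C v := by
    rw [h1.ra (B := 5) rfl]; exact hg0
  refine Ensures.seq_unch hm1 (gainLoop_spec hm hB1 hc1 hg1 hu1 hd) fun s₂ h2 hg2 => ?_
  have hB2 := hB1.unch h2 rfl
  have hu2 : s₂.nreg 5 = u := (h2.n rfl).trans hu1
  have hc2 : ∀ x y : Fin I.n, s₂.rarr 4 x y = I.graph.numAvoid C x y := by
    rw [h2.ra (B := 4) rfl]; exact hc1
  refine Ensures.seq_unch hm1 (rowLoop_spec hm hB2.n hc2 hu2) fun s₃ h3 hr => ?_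
  have hB3 := hB2.unch h3 rfl
  have hu3 : s₃.nreg 5 = u := (h3.n rfl).trans hu2
  have hc3 : ∀ x y : Fin I.n, s₃.rarr 4 x y = I.graph.numAvoid C x y := by
    rw [h3.ra (B := 4) rfl]; exact hc2
  refine (countLoop_spec hm hB3 hc3 hu3 hr).mono fun s₄ h4 hc4 => ?_
  refine ⟨?_, ?_, ?_, hc4, ?_⟩
  · rw [h4.na (B := 3) rfl, h3.na (B := 3) rfl, h2.na (B := 3) rfl, h1.na (B := 3) rfl]
    exact hmem0
  · rw [h4.r (y := 1) rfl, h3.r (y := 1) rfl, h2.r (y := 1) rfl, h1.r (y := 1) rfl, hcost0]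
  · rw [h4.r (y := 2) rfl, h3.r (y := 2) rfl, h2.r (y := 2) rfl, h1.r (y := 2) rfl, hval0]
  · rw [h4.ra (B := 5) rfl, h3.ra (B := 5) rfl]
    exact hg2

end RealRAM

/-! ### The inner loop and the treatment of one start -/

namespace RealRAM

/-- At least one of the tests succeeds. -/
def Test.or (b c : Test) : Test := .neg (.and (.neg b) (.neg c))

@[simp] theorem Test.or_holds (s : Store) (b c : Test) :
    (Test.or b c).Holds s ↔ b.Holds s ∨ c.Holds s := by
  simp only [Test.or, Test.Holds]
  tauto

/-- The node in register `x` has infinite relative gain. -/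
def infTest (x : ℕ) : Test := .and (.rlt .zero (entryR 5 x)) (.neg (.rlt .zero (entryR 0 x)))

/-- The node in register `2` replaces the candidate in register `5`. -/
def betterTest : Test :=
  .or (.eq (.reg 5) (.reg 0)) (.or (infTest 2) (.and (.neg (infTest 5))
    (.rlt (.div (entryR 5 5) (entryR 0 5)) (.div (entryR 5 2) (entryR 0 2)))))

/-- Search for a node of maximum relative gain; the result `n` says that there is no node left. -/
def pick : Prog :=
  .seq (.setNReg 5 (.reg 0)) (forLoop 2 0
    (.ite (.nlt (.const 0) (.cell 4 (.reg 2) (.const 0)))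
      (.ite betterTest (.setNReg 5 (.reg 2)) .nop) .nop))

/-- One iteration of the inner loop. -/
def round : Prog :=
  .seq pick (.ite (.nlt (.reg 5) (.reg 0))
    (.seq (.setNCell 4 (.reg 5) (.const 0) (.const 0))
      (.ite (.neg (.rlt (.reg 0) (.add (entryR 0 5) (.reg 1)))) addNode .nop)) .nop)

/-- The inner loop. -/
def greedy : Prog :=
  .seq (forLoop 2 0 (.setNCell 4 (.reg 2) (.const 0)
    (.sub (.const 1) (.cell 3 (.reg 2) (.const 0))))) (forLoop 6 0 round)

/-- The node in register `x`, if there is one, is added to the current solution. -/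
def tryAdd (x : ℕ) : Prog :=
  .ite (.nlt (.reg x) (.reg 0)) (.ite (.eq (.cell 3 (.reg x) (.const 0)) (.const 0))
    (.seq (.setNReg 5 (.reg x)) addNode) .nop) .nop

/-- The current solution becomes the output. -/
def record : Prog :=
  .seq (.setRReg 3 (.reg 2))
    (forLoop 2 0 (.setNCell 1 (.reg 2) (.const 0) (.cell 3 (.reg 2) (.const 0))))

/-- One iteration of the outer loop, with the start given by the registers `7`, `8`, `9`. -/
def processStart : Prog :=
  .seq reset (.seq (tryAdd 7) (.seq (tryAdd 8) (.seq (tryAdd 9)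
    (.ite (.neg (.rlt (.reg 0) (.reg 1)))
      (.seq greedy (.ite (.rlt (.reg 3) (.reg 2)) record .nop)) .nop))))

variable {I : MBC} {s : Store} {m : ℕ}

theorem Base.of_eq {s' : Store} (h : Base I s) (hn : s'.nreg 0 = s.nreg 0)
    (hn1 : s'.nreg 1 = s.nreg 1) (hr : s'.rreg = s.rreg) (hna : s'.narr 2 = s.narr 2)
    (hra : s'.rarr = s.rarr) : Base I s' :=
  ⟨hn.trans h.n, hn1.trans h.n_succ, by rw [hr]; exact h.budget, by rw [hra]; exact h.cost,
    by unfold HasDist; rw [hna]; exact h.dist, by rw [hra]; exact h.count,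
    by rw [hra]; exact h.weight, by rw [hra]; exact h.gain⟩

theorem Cur.of_eq {s' : Store} {C : Finset (Fin I.n)} (h : Cur I s C) (hna : s'.narr 3 = s.narr 3)
    (h1 : s'.rreg 1 = s.rreg 1) (h2 : s'.rreg 2 = s.rreg 2) (h4 : s'.rarr 4 = s.rarr 4)
    (h5 : s'.rarr 5 = s.rarr 5) : Cur I s' C :=
  ⟨by rw [hna]; exact h.mem, h1.trans h.cost, h2.trans h.value, by rw [h4]; exact h.count,
    by rw [h5]; exact h.gain⟩

theorem Cur.unch {s' : Store} {C : Finset (Fin I.n)} {p : Prog} (h : Cur I s C) (hU : Unch p s s')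
    (hp : (p.keepsNA 3 && p.keepsR 1 && p.keepsR 2 && p.keepsRA 4 && p.keepsRA 5) = true) :
    Cur I s' C := by
  simp only [Bool.and_eq_true] at hp
  obtain ⟨⟨⟨⟨h1, h2⟩, h3⟩, h4⟩, h5⟩ := hp
  exact h.of_eq (hU.na h1) (hU.r h2) (hU.r h3) (hU.ra h4) (hU.ra h5)

/-- Array `4` represents the set `U`. -/
def Remaining (I : MBC) (s : Store) (U : Finset (Fin I.n)) : Prop :=
  ∀ v : Fin I.n, s.narr 4 v 0 = if v ∈ U then 1 else 0

theorem infTest_holds (hB : Base I s) {C : Finset (Fin I.n)} (hC : Cur I s C) {x : ℕ}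
    {v : Fin I.n} (hv : s.nreg x = v) :
    (infTest x).Holds s ↔ 0 < I.gain C v ∧ ¬ 0 < I.cost v := by
  simp [infTest, hv, hC.gain, hB.cost]

/-- Register `5` holds `n` as long as there is no candidate, and otherwise the best remaining node
seen so far. Infinite relative gains are recognized by a separate test, and only finite ones are
compared as real quotients. -/
theorem pick_spec (hm : I.n < m) (hB : Base I s) {C U : Finset (Fin I.n)} (hC : Cur I s C)
    (hU : Remaining I s U) :
    Ensures m pick s (fun s' => (s'.nreg 5 = I.n ∧ U = ∅) ∨
      ∃ u : Fin I.n, s'.nreg 5 = u ∧ I.IsArgMax C U u) := by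
  have hm1 : 1 ≤ m := by omega
  refine Ensures.seq hm1 (Ensures.setNReg ?_)
  refine Ensures.forLoop (fun k s₁ => (s₁.nreg 5 = I.n ∧ ∀ v ∈ U, ¬ v.val < k) ∨
    ∃ u ∈ U, s₁.nreg 5 = u ∧ ∀ v ∈ U, v.val < k → I.relGain C v ≤ I.relGain C u) hm hB.n
    (by decide) rfl rfl (Or.inl ?_) ?_ ?_
  · simp [hB.n]
  · intro k s₁ hk h2 hU1 hI
    have hB1 : Base I s₁ :=
      Base.unch (s := s.setN 5 (s.nreg 0)) (hB.of_eq rfl rfl rfl rfl rfl) hU1 rfl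
    have hC1 : Cur I s₁ C :=
      Cur.unch (s := s.setN 5 (s.nreg 0)) (hC.of_eq rfl rfl rfl rfl rfl) hU1 rfl
    have hR1 : Remaining I s₁ U := by
      unfold Remaining; rw [hU1.na (B := 4) rfl]; exact hU
    set w : Fin I.n := ⟨k, hk⟩ with hw
    have h2' : s₁.nreg 2 = w := h2
    have hcase : ∀ v : Fin I.n, v.val < k + 1 → v.val < k ∨ v = w := by
      intro v hv
      simp only [hw, Fin.ext_iff]
      omega
    refine Ensures.ite hm1 (fun h => ?_) (fun h => Ensures.nop ?_)
    all_goals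
      rw [Test.Holds, NExp.val, NExp.val, NExp.val, NExp.val, h2', hR1 w] at h
    · have hwU : w ∈ U := by by_contra h'; simp [h'] at h
      refine Ensures.ite hm1 (fun hb => Ensures.setNReg (Or.inr ?_)) (fun hb => Ensures.nop ?_)
      · refine ⟨w, hwU, by simp [h2'], fun v hv hvk => ?_⟩
        rcases hcase v hvk with hvk | rfl
        swap
        · exact le_rfl
        rcases hI with ⟨-, hI⟩ | ⟨u, hu, h5, hI⟩
        · exact absurd hvk (hI v hv)
        refine (hI v hv hvk).trans ?_
        rw [betterTest, Test.or_holds, Test.or_holds, infTest_holds hB1 hC1 h2', Test.Holds,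
          Test.Holds, Test.Holds, infTest_holds hB1 hC1 h5] at hb
        rcases hb with hb | hb | hb
        · rw [Test.eq_holds, NExp.val, NExp.val, h5, hB1.n] at hb
          exact absurd hb u.2.ne
        · rw [MBC.relGain_eq_top hb.1 hb.2]
          exact le_top
        · by_cases hi : 0 < I.gain C w ∧ ¬ 0 < I.cost w
          · rw [MBC.relGain_eq_top hi.1 hi.2]
            exact le_top
          rw [MBC.relGain_eq_ofReal hb.1, MBC.relGain_eq_ofReal hi]
          have h3 := hb.2
          simp only [RExp.val, entryR_val, h5, h2', hC1.gain, hB1.cost] at h3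
          exact ENNReal.ofReal_le_ofReal h3.le
      · rw [betterTest, Test.or_holds, Test.or_holds, infTest_holds hB1 hC1 h2', Test.Holds,
          Test.Holds] at hb
        push Not at hb
        obtain ⟨hb1, hb2, hb3⟩ := hb
        rcases hI with ⟨h5, -⟩ | ⟨u, hu, h5, hI⟩
        · rw [Test.eq_holds, NExp.val, NExp.val, h5, hB1.n] at hb1
          exact absurd rfl hb1
        refine Or.inr ⟨u, hu, by simpa using h5, fun v hv hvk => ?_⟩
        rcases hcase v hvk with hvk | rfl
        · exact hI v hv hvk
        rw [Test.Holds, infTest_holds hB1 hC1 h5] at hb3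
        by_cases hi : 0 < I.gain C u ∧ ¬ 0 < I.cost u
        · rw [MBC.relGain_eq_top hi.1 hi.2]
          exact le_top
        rw [MBC.relGain_eq_ofReal hi, MBC.relGain_eq_ofReal (by push Not; exact hb2)]
        have h3 := hb3 hi
        simp only [RExp.val, entryR_val, h5, h2', hC1.gain, hB1.cost] at h3
        exact ENNReal.ofReal_le_ofReal h3
    · have hwU : w ∉ U := by intro h'; simp [h'] at h
      have hcase' : ∀ v ∈ U, v.val < k + 1 → v.val < k := fun v hv hvk =>
        (hcase v hvk).resolve_right fun e => hwU (e ▸ hv)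
      rcases hI with ⟨h5, hI⟩ | ⟨u, hu, h5, hI⟩
      · exact Or.inl ⟨by simpa using h5, fun v hv hvk => hI v hv (hcase' v hv hvk)⟩
      · exact Or.inr ⟨u, hu, by simpa using h5, fun v hv hvk => hI v hv (hcase' v hv hvk)⟩
  · rintro s' - (⟨h5, h⟩ | ⟨u, hu, h5, h⟩)
    · exact Or.inl ⟨h5, Finset.eq_empty_of_forall_notMem fun v hv => h v hv v.2⟩
    · exact Or.inr ⟨u, h5, hu, fun v hv => h v hv v.2⟩

/-- The conclusion speaks of continuations because derivations of `MBC.Augment` are built from their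
end. Once `U` is empty a round does nothing; the truncated subtraction covers this case. -/
theorem round_spec (hm : I.n < m) (hB : Base I s) {C U : Finset (Fin I.n)} (hC : Cur I s C)
    (hU : Remaining I s U) (hdis : Disjoint C U) :
    Ensures m round s (fun s' => ∃ C' U', Cur I s' C' ∧ Remaining I s' U' ∧ Disjoint C' U' ∧
      U'.card ≤ U.card - 1 ∧ ∀ D, I.Augment C' U' D → I.Augment C U D) := by
  have hm1 : 1 ≤ m := by omega
  refine Ensures.seq_unch hm1 (pick_spec hm hB hC hU) fun s₁ h1 h => ?_
  have hB1 := hB.unch h1 rfl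
  have hC1 := hC.unch h1 rfl
  have hU1 : Remaining I s₁ U := by unfold Remaining; rw [h1.na (B := 4) rfl]; exact hU
  rcases h with ⟨h5, rfl⟩ | ⟨u, h5, hu⟩
  · refine Ensures.ite hm1 (fun h => ?_) (fun _ => Ensures.nop ?_)
    · rw [Test.Holds, NExp.val, NExp.val, h5, hB1.n] at h
      exact absurd h (lt_irrefl _)
    · exact ⟨C, ∅, hC1, hU1, hdis, by simp, fun D h => h⟩
  have huC : u ∉ C := fun h => Finset.disjoint_left.1 hdis h hu.1
  refine Ensures.ite hm1 (fun _ => ?_) (fun h => ?_)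
  swap
  · rw [Test.Holds, NExp.val, NExp.val, h5, hB1.n] at h
    exact absurd u.2 h
  refine Ensures.seq hm1 (Ensures.setNCell ?_)
  set s₂ := Store.setNA _ 4 _ _ _ with hs₂
  have hB2 : Base I s₂ := hB1.of_eq rfl rfl rfl (by ext; simp [hs₂]) rfl
  have hC2 : Cur I s₂ C := hC1.of_eq (by ext; simp [hs₂]) rfl rfl rfl rfl
  have h52 : s₂.nreg 5 = u := h5
  have hU2 : Remaining I s₂ (U.erase u) := by
    intro v
    by_cases hv : v = u
    · simp [hs₂, h5, hv]
    · simp [hs₂, h5, hv, Fin.val_inj, hU1 v]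
  clear_value s₂
  have hcard : (U.erase u).card ≤ U.card - 1 := (Finset.card_erase_of_mem hu.1).le
  have hfeas : (¬ I.budget < I.cost u + I.totalCost C) ↔ I.Feasible (insert u C) := by
    rw [MBC.feasible_iff, MBC.totalCost_insert huC, not_lt]
  refine Ensures.ite hm1 (fun h => ?_) (fun h => Ensures.nop ?_)
  all_goals simp only [Test.Holds, RExp.val, entryR_val, h52, hB2.cost, hB2.budget, hC2.cost] at h
  · refine (addNode_spec hm hB2 hC2 h52 huC).mono fun s₃ h3 hC3 => ?_
    refine ⟨_, U.erase u, hC3, ?_, ?_, hcard, fun D hD => .take hu (hfeas.1 h) hD⟩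
    · unfold Remaining; rw [h3.na (B := 4) rfl]; exact hU2
    · rw [Finset.disjoint_insert_left]
      exact ⟨Finset.notMem_erase _ _, hdis.mono_right (Finset.erase_subset _ _)⟩
  · exact ⟨C, U.erase u, hC2, hU2, hdis.mono_right (Finset.erase_subset _ _), hcard,
      fun D hD => .drop hu (fun hf => h (hfeas.2 hf)) hD⟩

theorem greedy_spec (hm : I.n < m) (hB : Base I s) {C : Finset (Fin I.n)} (hC : Cur I s C) :
    Ensures m greedy s (fun s' => ∃ D, I.Augment C Cᶜ D ∧ Cur I s' D) := by
  have hm1 : 1 ≤ m := by omega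
  refine Ensures.seq_unch hm1 (Ensures.forLoop_map (fun s a => s.narr 4 a 0) (fun _ _ _ => rfl)
    (fun v => if v ∈ Cᶜ then 1 else 0) hm hB.n (by decide) rfl rfl ?_) fun s₁ h1 hU1 => ?_
  · intro v s₁ hv h1 _
    refine Ensures.setNCell fun a => ?_
    have : s₁.narr 3 v 0 = if v ∈ C then 1 else 0 := by
      rw [h1.na (B := 3) rfl]; exact hC.mem v
    simp only [Store.setNA_narr, NExp.val, hv, Fin.val_inj, true_and, and_true, this]
    refine if_congr Iff.rfl ?_ rfl
    by_cases h : v ∈ C <;> simp [h]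
  have hB1 := hB.unch h1 rfl
  have hC1 := hC.unch h1 rfl
  -- After `k` rounds at most `n - k` nodes remain, so `n` rounds replace the while-loop.
  refine Ensures.forLoop (fun k s₂ => ∃ C' U', Cur I s₂ C' ∧ Remaining I s₂ U' ∧ Disjoint C' U' ∧
      U'.card ≤ I.n - k ∧ ∀ D, I.Augment C' U' D → I.Augment C Cᶜ D) hm hB1.n (by decide) rfl rfl
    ?_ ?_ ?_
  · refine ⟨C, Cᶜ, hC1.of_eq rfl rfl rfl rfl rfl, hU1, disjoint_compl_right, ?_, fun D h => h⟩
    exact (Finset.card_le_univ _).trans (by simp)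
  · rintro k s₂ hk - h2 ⟨C', U', hC2, hU2, hdis, hcard, hA⟩
    refine (round_spec hm (hB1.unch h2 rfl) hC2 hU2 hdis).mono ?_
    rintro s₃ - ⟨C'', U'', hC3, hU3, hdis3, hcard3, hA3⟩
    exact ⟨C'', U'', hC3.of_eq rfl rfl rfl rfl rfl, hU3, hdis3, by omega,
      fun D hD => hA D (hA3 D hD)⟩
  · rintro s' - ⟨C', U', hC2, -, -, hcard, hA⟩
    have : U' = ∅ := by
      rw [← Finset.card_eq_zero]
      omega
    subst this
    exact ⟨C', hA C' (.finish C'), hC2⟩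

/-- The set that consists of the node `x`; it is empty if `x` is not a node. -/
def atMostOne (n x : ℕ) : Finset (Fin n) := Finset.univ.filter (fun v => v.val = x)

theorem mem_atMostOne {n x : ℕ} {v : Fin n} : v ∈ atMostOne n x ↔ v.val = x := by
  simp [atMostOne]

/-- A start is built by successive additions, which keeps gains and counts up to date. The value `n`
and repeated nodes are skipped, and the budget plays no role until the start is complete. -/
theorem tryAdd_spec (hm : I.n < m) (hB : Base I s) {C : Finset (Fin I.n)} (hC : Cur I s C) (x : ℕ) :
    Ensures m (tryAdd x) s (fun s' => Cur I s' (C ∪ atMostOne I.n (s.nreg x))) := by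
  have hm1 : 1 ≤ m := by omega
  refine Ensures.ite hm1 (fun h => Ensures.ite hm1 (fun h' => ?_) (fun h' => Ensures.nop ?_))
    (fun h => Ensures.nop ?_)
  all_goals simp only [Test.Holds, NExp.val, hB.n] at h
  · obtain ⟨u, hu⟩ : ∃ u : Fin I.n, s.nreg x = u := ⟨⟨_, h⟩, rfl⟩
    have hone : atMostOne I.n (s.nreg x) = {u} := by
      ext v; simp [mem_atMostOne, hu, Fin.val_inj]
    rw [Test.eq_holds, NExp.val, NExp.val, NExp.val, NExp.val, hu, hC.mem] at h'
    have huC : u ∉ C := by intro h''; simp [h''] at h'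
    rw [hone, Finset.union_comm, ← Finset.insert_eq]
    refine Ensures.seq hm1 (Ensures.setNReg (addNode_spec (s := s.setN 5 (s.nreg x)) hm (hB.of_eq rfl rfl rfl rfl rfl)
      (hC.of_eq rfl rfl rfl rfl rfl) ?_ huC))
    simpa using hu
  · obtain ⟨u, hu⟩ : ∃ u : Fin I.n, s.nreg x = u := ⟨⟨_, h⟩, rfl⟩
    have hone : atMostOne I.n (s.nreg x) = {u} := by
      ext v; simp [mem_atMostOne, hu, Fin.val_inj]
    rw [Test.eq_holds, NExp.val, NExp.val, NExp.val, NExp.val, hu, hC.mem] at h'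
    have huC : u ∈ C := by by_contra h''; simp [h''] at h'
    rw [hone, Finset.union_comm, ← Finset.insert_eq, Finset.insert_eq_of_mem huC]
    exact hC
  · have hone : atMostOne I.n (s.nreg x) = ∅ := by
      ext v
      have := v.2
      simp only [mem_atMostOne, Finset.notMem_empty, iff_false]
      omega
    rwa [hone, Finset.union_empty]

/-- The output is `H`, and its value is stored. -/
structure Best (I : MBC) (s : Store) (H : Finset (Fin I.n)) : Prop where
  mem : ∀ v : Fin I.n, s.narr 1 v 0 = if v ∈ H then 1 else 0
  value : s.rreg 3 = I.gbc H

theorem Best.unch {s' : Store} {H : Finset (Fin I.n)} {p : Prog} (h : Best I s H)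
    (hU : Unch p s s') (hp : (p.keepsNA 1 && p.keepsR 3) = true) : Best I s' H := by
  rw [Bool.and_eq_true] at hp
  exact ⟨by rw [hU.na hp.1]; exact h.mem, (hU.r hp.2).trans h.value⟩

theorem Best.output_eq {H : Finset (Fin I.n)} (h : Best I s H) : output I.n s = H := by
  ext v
  simp [output, h.mem v]

/-- The start that is described by three numbers. -/
def startSet (n i j k : ℕ) : Finset (Fin n) := atMostOne n i ∪ atMostOne n j ∪ atMostOne n k

theorem record_spec (hm : I.n < m) (hB : Base I s) {D : Finset (Fin I.n)} (hD : Cur I s D) :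
    Ensures m record s (fun s' => Best I s' D) := by
  have hm1 : 1 ≤ m := by omega
  refine Ensures.seq hm1 (Ensures.setRReg ?_)
  refine Ensures.mono (Ensures.forLoop_map (fun s a => s.narr 1 a 0) (fun _ _ _ => rfl)
    (fun v => if v ∈ D then 1 else 0) hm hB.n (by decide) rfl rfl ?_) ?_
  · intro v s₁ hv h1 _
    refine Ensures.setNCell fun a => ?_
    have : s₁.narr 3 v 0 = if v ∈ D then 1 else 0 := by
      rw [h1.na (B := 3) rfl]; exact hD.mem v
    simp [hv, Fin.val_inj, this]
  · intro s' hU h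
    refine ⟨h, ?_⟩
    rw [hU.r (y := 3) rfl]
    simpa using hD.value

theorem processStart_spec (hm : I.n < m) (hB : Base I s) {H : Finset (Fin I.n)} (hH : Best I s H)
    {C : Finset (Fin I.n)} (hC : C = startSet I.n (s.nreg 7) (s.nreg 8) (s.nreg 9)) :
    Ensures m processStart s (fun s' => ∃ H', Best I s' H' ∧ (¬ I.Feasible C → H' = H) ∧
      (I.Feasible C → ∃ D, I.Augment C Cᶜ D ∧
        (I.gbc H < I.gbc D ∧ H' = D ∨ ¬ I.gbc H < I.gbc D ∧ H' = H))) := by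
  have hm1 : 1 ≤ m := by omega
  refine Ensures.seq_unch hm1 (reset_spec hm hB) fun s₁ h1 hC1 => ?_
  refine Ensures.seq_unch hm1 (tryAdd_spec hm (hB.unch h1 rfl) hC1 7) fun s₂ h2 hC2 => ?_
  refine Ensures.seq_unch hm1 (tryAdd_spec hm ((hB.unch h1 rfl).unch h2 rfl) hC2 8)
    fun s₃ h3 hC3 => ?_
  refine Ensures.seq_unch hm1 (tryAdd_spec hm (((hB.unch h1 rfl).unch h2 rfl).unch h3 rfl) hC3 9)
    fun s₄ h4 hC4 => ?_
  have hB4 : Base I s₄ := (((hB.unch h1 rfl).unch h2 rfl).unch h3 rfl).unch h4 rfl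
  have hH4 : Best I s₄ H := (((hH.unch h1 rfl).unch h2 rfl).unch h3 rfl).unch h4 rfl
  have e7 : s₁.nreg 7 = s.nreg 7 := h1.n rfl
  have e8 : s₂.nreg 8 = s.nreg 8 := (h2.n rfl).trans (h1.n rfl)
  have e9 : s₃.nreg 9 = s.nreg 9 := (h3.n rfl).trans ((h2.n rfl).trans (h1.n rfl))
  rw [e7, e8, e9, Finset.empty_union] at hC4
  change Cur I s₄ (startSet I.n (s.nreg 7) (s.nreg 8) (s.nreg 9)) at hC4
  rw [← hC] at hC4
  have hfeas : (¬ I.budget < I.totalCost C) ↔ I.Feasible C := by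
    rw [MBC.feasible_iff, not_lt]
  refine Ensures.ite hm1 (fun h => ?_) (fun h => Ensures.nop ?_)
  all_goals
    simp only [Test.Holds, RExp.val, hB4.budget, hC4.cost] at h
    rw [hfeas] at h
  swap
  · exact ⟨H, hH4, fun _ => rfl, fun h' => absurd h' h⟩
  refine Ensures.seq_unch hm1 (greedy_spec hm hB4 hC4) fun s₅ h5 hD => ?_
  obtain ⟨D, hA, hD⟩ := hD
  have hH5 := hH4.unch h5 rfl
  refine Ensures.ite hm1 (fun hlt => ?_) (fun hlt => Ensures.nop ?_)
  all_goals simp only [Test.Holds, RExp.val, hH5.value, hD.value] at hlt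
  · refine (record_spec hm (hB4.unch h5 rfl) hD).mono fun s₆ _ hR => ?_
    exact ⟨D, hR, fun h' => absurd h h', fun _ => ⟨D, hA, Or.inl ⟨hlt, rfl⟩⟩⟩
  · exact ⟨H, hH5, fun _ => rfl, fun _ => ⟨D, hA, Or.inr ⟨hlt, rfl⟩⟩⟩

end RealRAM

/-! ### Enumeration of the starts -/

namespace MBC

variable {I : MBC}

theorem Search.append {L L' : List (Finset (Fin I.n))} {H H' H'' : Finset (Fin I.n)}
    (h : I.Search L H H') (h' : I.Search L' H' H'') : I.Search (L ++ L') H H'' := by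
  induction h with
  | finish H => exact h'
  | better hA hlt _ ih => exact .better hA hlt (ih h')
  | keep hA hlt _ ih => exact .keep hA hlt (ih h')

end MBC

namespace RealRAM

/-- The numbers `i`, `j`, `k` are increasing, except that the value `n` may be repeated. -/
def Canonical (n i j k : ℕ) : Prop := (i < j ∨ j = n) ∧ (j < k ∨ k = n)

theorem mem_startSet {n i j k : ℕ} {v : Fin n} :
    v ∈ startSet n i j k ↔ v.val = i ∨ v.val = j ∨ v.val = k := by
  simp [startSet, mem_atMostOne]

/-- A canonical triple lists the set in increasing order, padded with `n`, so its entries can be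
recovered one after the other. -/
theorem startSet_injective {n i j k i' j' k' : ℕ} (hi : i ≤ n) (hj : j ≤ n) (hk : k ≤ n)
    (hi' : i' ≤ n) (hj' : j' ≤ n) (hk' : k' ≤ n) (hc : Canonical n i j k)
    (hc' : Canonical n i' j' k') (h : startSet n i j k = startSet n i' j' k') :
    i = i' ∧ j = j' ∧ k = k' := by
  have key : ∀ v, v < n → ((v = i ∨ v = j ∨ v = k) ↔ (v = i' ∨ v = j' ∨ v = k')) := by
    intro v hv
    have := Finset.ext_iff.1 h ⟨v, hv⟩
    rwa [mem_startSet, mem_startSet] at this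
  unfold Canonical at hc hc'
  have e1 : i = i' := by
    have h1 := key i
    have h2 := key i'
    omega
  subst e1
  have e2 : j = j' := by
    have h1 := key j
    have h2 := key j'
    omega
  subst e2
  have h1 := key k
  have h2 := key k'
  omega

/-- The minimum is split off; the empty set is represented by `n`. Three applications produce a
canonical triple. -/
theorem exists_eq_atMostOne_union {n c : ℕ} {C : Finset (Fin n)} (hC : C.card ≤ c + 1) :
    ∃ i C', i ≤ n ∧ C = atMostOne n i ∪ C' ∧ C'.card ≤ c ∧ ∀ v ∈ C', i < v.val := by
  rcases C.eq_empty_or_nonempty with rfl | hne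
  · refine ⟨n, ∅, le_rfl, ?_, by simp, by simp⟩
    ext v
    simpa [mem_atMostOne] using v.2.ne
  · refine ⟨C.min' hne, C.erase (C.min' hne), (C.min' hne).2.le, ?_, ?_, fun v hv => ?_⟩
    · ext v
      rw [Finset.mem_union, mem_atMostOne, Fin.val_inj, Finset.mem_erase]
      constructor
      · intro h
        by_cases hv : v = C.min' hne
        · exact Or.inl hv
        · exact Or.inr ⟨hv, h⟩
      · rintro (h | h)
        · exact h ▸ C.min'_mem hne
        · exact h.2
    · rw [Finset.card_erase_of_mem (C.min'_mem hne)]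
      omega
    · exact Finset.min'_lt_of_mem_erase_min' _ _ hv

theorem exists_eq_startSet {n : ℕ} {C : Finset (Fin n)} (hC : C.card ≤ 3) :
    ∃ i j k, i ≤ n ∧ j ≤ n ∧ k ≤ n ∧ Canonical n i j k ∧ C = startSet n i j k := by
  obtain ⟨i, C₁, hi, h1, hc1, hlt1⟩ := exists_eq_atMostOne_union hC
  obtain ⟨j, C₂, hj, h2, hc2, hlt2⟩ := exists_eq_atMostOne_union hc1
  obtain ⟨k, C₃, hk, h3, hc3, -⟩ := exists_eq_atMostOne_union hc2
  rw [Nat.le_zero, Finset.card_eq_zero] at hc3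
  refine ⟨i, j, k, hi, hj, hk, ⟨?_, ?_⟩, ?_⟩
  · rcases hj.lt_or_eq with hj | hj
    · exact Or.inl (hlt1 ⟨j, hj⟩ (by rw [h2, Finset.mem_union, mem_atMostOne]; exact Or.inl rfl))
    · exact Or.inr hj
  · rcases hk.lt_or_eq with hk | hk
    · exact Or.inl (hlt2 ⟨k, hk⟩ (by rw [h3, Finset.mem_union, mem_atMostOne]; exact Or.inl rfl))
    · exact Or.inr hk
  · rw [h1, h2, h3, hc3, startSet, Finset.union_empty, Finset.union_assoc]

theorem card_startSet_le (n i j k : ℕ) : (startSet n i j k).card ≤ 3 := by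
  have h : ∀ x, (atMostOne n x).card ≤ 1 := by
    intro x
    rw [Finset.card_le_one]
    intro a ha b hb
    rw [mem_atMostOne] at ha hb
    exact Fin.ext (ha.trans hb.symm)
  have h1 := Finset.card_union_le (atMostOne n i ∪ atMostOne n j) (atMostOne n k)
  have h2 := Finset.card_union_le (atMostOne n i) (atMostOne n j)
  have := h i
  have := h j
  have := h k
  unfold startSet
  omega

/-- The numbers in the registers `7`, `8`, `9` form a canonical description of a start. -/
def canonicalTest : Test :=
  .and (.or (.nlt (.reg 7) (.reg 8)) (.eq (.reg 8) (.reg 0)))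
    (.or (.nlt (.reg 8) (.reg 9)) (.eq (.reg 9) (.reg 0)))

/-- The greedy algorithm with enumeration of starts. -/
def enumGreedy : Prog :=
  .seq preprocess (forLoop 7 1 (forLoop 8 1 (forLoop 9 1 (.ite canonicalTest processStart .nop))))

/-- Search for a feasible single node of maximum value. -/
def findSingle : Prog :=
  forLoop 2 0 (.ite (.and (.neg (.rlt (.reg 0) (entryR 0 2)))
    (.or (.eq (.reg 7) (.reg 0)) (.rlt (entryR 3 7) (entryR 3 2)))) (.setNReg 7 (.reg 2)) .nop)

/-- The greedy algorithm with the empty start and with the best single node as start. -/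
def fastGreedy : Prog :=
  .seq preprocess (.seq (.setNReg 7 (.reg 0)) (.seq (.setNReg 8 (.reg 0))
    (.seq (.setNReg 9 (.reg 0)) (.seq processStart (.seq findSingle processStart)))))

variable {I : MBC} {s : Store} {m : ℕ}

theorem Best.of_eq {s' : Store} {H : Finset (Fin I.n)} (h : Best I s H)
    (h1 : s'.narr 1 = s.narr 1) (h3 : s'.rreg 3 = s.rreg 3) : Best I s' H :=
  ⟨by rw [h1]; exact h.mem, h3.trans h.value⟩

theorem best_input (I : MBC) : Best I (input I) ∅ := by
  refine ⟨fun v => ?_, ?_⟩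
  · simp [input]
  · simp [input, MBC.gbc_empty]

/-- The output is a possible best solution after the starts described by `R` have been tried. -/
def Tried (I : MBC) (R : ℕ → ℕ → ℕ → Prop) (s : Store) : Prop :=
  ∃ L H, L.Nodup ∧ (∀ C, C ∈ L ↔ I.Feasible C ∧ ∃ i j k, R i j k ∧ Canonical I.n i j k ∧
    C = startSet I.n i j k) ∧ I.Search L ∅ H ∧ Best I s H

theorem Tried.of_eq {s' : Store} {R R' : ℕ → ℕ → ℕ → Prop} (h : Tried I R s)
    (hR : ∀ i j k, R i j k ↔ R' i j k) (h1 : s'.narr 1 = s.narr 1) (h3 : s'.rreg 3 = s.rreg 3) :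
    Tried I R' s' := by
  obtain ⟨L, H, a, b, c, d⟩ := h
  have : R = R' := by ext i j k; exact hR i j k
  exact ⟨L, H, a, this ▸ b, c, d.of_eq h1 h3⟩

/-- The relation `R` collects the triples already visited. Injectivity of canonical descriptions
keeps the list free of duplicates; triples that are infeasible or not canonical leave it unchanged.
-/
theorem tryStart_spec (hm : I.n < m) (hB : Base I s) {R : ℕ → ℕ → ℕ → Prop} (hT : Tried I R s)
    (hR : ∀ i j k, R i j k → i ≤ I.n ∧ j ≤ I.n ∧ k ≤ I.n) {i j k : ℕ} (hi : i ≤ I.n) (hj : j ≤ I.n)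
    (hk : k ≤ I.n) (h7 : s.nreg 7 = i) (h8 : s.nreg 8 = j) (h9 : s.nreg 9 = k) (hn : ¬ R i j k) :
    Ensures m (.ite canonicalTest processStart .nop) s
      (Tried I (fun i' j' k' => R i' j' k' ∨ i' = i ∧ j' = j ∧ k' = k)) := by
  have hm1 : 1 ≤ m := by omega
  obtain ⟨L, H, hnd, hL, hS, hH⟩ := hT
  have hcan : canonicalTest.Holds s ↔ Canonical I.n i j k := by
    simp [canonicalTest, Canonical, h7, h8, h9, hB.n]
  refine Ensures.ite hm1 (fun hc => ?_) (fun hc => Ensures.nop ?_)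
  all_goals rw [hcan] at hc
  · refine (processStart_spec hm hB hH (C := startSet I.n i j k) (by rw [h7, h8, h9])).mono ?_
    rintro s' - ⟨H', hH', h1, h2⟩
    by_cases hf : I.Feasible (startSet I.n i j k)
    · obtain ⟨D, hA, hD⟩ := h2 hf
      refine ⟨L ++ [startSet I.n i j k], H', ?_, fun C => ?_, hS.append ?_, hH'⟩
      · rw [List.nodup_append]
        refine ⟨hnd, by simp, ?_⟩
        rintro C hC C' hC' rfl
        rw [List.mem_singleton] at hC'
        rw [hL] at hC
        obtain ⟨-, i', j', k', hR', hc', he⟩ := hC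
        obtain ⟨b1, b2, b3⟩ := hR _ _ _ hR'
        obtain ⟨rfl, rfl, rfl⟩ := startSet_injective hi hj hk b1 b2 b3 hc hc' (hC'.symm.trans he)
        exact hn hR'
      · rw [List.mem_append, hL, List.mem_singleton]
        constructor
        · rintro (⟨h1, i', j', k', h2, h3⟩ | rfl)
          · exact ⟨h1, i', j', k', Or.inl h2, h3⟩
          · exact ⟨hf, i, j, k, Or.inr ⟨rfl, rfl, rfl⟩, hc, rfl⟩
        · rintro ⟨h1, i', j', k', h2 | ⟨rfl, rfl, rfl⟩, h3, h4⟩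
          · exact Or.inl ⟨h1, i', j', k', h2, h3, h4⟩
          · exact Or.inr h4
      · rcases hD with ⟨hlt, rfl⟩ | ⟨hlt, rfl⟩
        · exact .better hA hlt (.finish _)
        · exact .keep hA hlt (.finish _)
    · obtain rfl := h1 hf
      refine ⟨L, H', hnd, fun C => ?_, hS, hH'⟩
      rw [hL]
      constructor
      · rintro ⟨h1, i', j', k', h2, h3⟩
        exact ⟨h1, i', j', k', Or.inl h2, h3⟩
      · rintro ⟨g1, i', j', k', g2 | ⟨rfl, rfl, rfl⟩, g3, g4⟩
        · exact ⟨g1, i', j', k', g2, g3, g4⟩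
        · exact absurd (g4 ▸ g1) hf
  · refine ⟨L, H, hnd, fun C => ?_, hS, hH⟩
    rw [hL]
    constructor
    · rintro ⟨h1, i', j', k', h2, h3⟩
      exact ⟨h1, i', j', k', Or.inl h2, h3⟩
    · rintro ⟨h1, i', j', k', h2 | ⟨rfl, rfl, rfl⟩, h3, h4⟩
      · exact ⟨h1, i', j', k', h2, h3, h4⟩
      · exact absurd h3 hc

/-- Triples of numbers up to `n` that precede `(i, j, k)` lexicographically. -/
def Before (n i j k : ℕ) (i' j' k' : ℕ) : Prop :=
  (i' ≤ n ∧ j' ≤ n ∧ k' ≤ n) ∧ (i' < i ∨ i' = i ∧ (j' < j ∨ j' = j ∧ k' < k))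

/-- The outer counters run up to and including `n`, which stands for a missing node; hence the loop
bound `n + 1` and the stronger hypothesis on `m`. The triples are visited in lexicographic order. -/
theorem enumGreedy_spec (hm : I.n + 1 < m) :
    Ensures m enumGreedy (input I) (fun s' => I.IsGreedyResult (output I.n s')) := by
  have hm0 : I.n < m := by omega
  refine Ensures.seq_unch (by omega) (preprocess_spec hm0) fun s h0 hB => ?_
  have hbest : Best I s ∅ := (best_input I).unch h0 rfl
  refine Ensures.forLoop (fun i => Tried I (Before I.n i 0 0)) hm hB.n_succ (by decide) rfl rfl
    ?_ ?_ ?_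
  · refine ⟨[], ∅, List.nodup_nil, fun C => ?_, .finish ∅, hbest.of_eq rfl rfl⟩
    simp [Before]
  · intro i s₁ hi h7 h1 hT1
    have hB1 := hB.unch h1 rfl
    refine Ensures.forLoop (fun j => Tried I (Before I.n i j 0)) hm hB1.n_succ (by decide) rfl rfl
      (hT1.of_eq (fun _ _ _ => Iff.rfl) rfl rfl) ?_ ?_
    · intro j s₂ hj h8 h2 hT2
      have hB2 := hB1.unch h2 rfl
      refine Ensures.forLoop (fun k => Tried I (Before I.n i j k)) hm hB2.n_succ (by decide) rfl rfl
        (hT2.of_eq (fun _ _ _ => Iff.rfl) rfl rfl) ?_ ?_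
      · intro k s₃ hk h9 h3 hT3
        refine (tryStart_spec hm0 (hB2.unch h3 rfl) hT3 (fun i j k h => h.1) (i := i) (j := j)
          (k := k) (by omega) (by omega) (by omega) (by rw [h3.n rfl, h2.n rfl, h7])
          (by rw [h3.n rfl, h8]) h9 (by unfold Before; omega)).mono fun s₄ _ h => ?_
        exact h.of_eq (fun i' j' k' => by unfold Before; omega) rfl rfl
      · intro s₃ _ h
        exact h.of_eq (fun i' j' k' => by unfold Before; omega) rfl rfl
    · intro s₂ _ h
      exact h.of_eq (fun i' j' k' => by unfold Before; omega) rfl rfl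
  · rintro s' - ⟨L, H, hnd, hL, hS, hH⟩
    rw [hH.output_eq]
    refine ⟨L, hnd, fun C => ?_, hS⟩
    rw [hL]
    constructor
    · rintro ⟨h1, i, j, k, -, -, rfl⟩
      exact ⟨card_startSet_le _ _ _ _, h1⟩
    · rintro ⟨h1, h2⟩
      obtain ⟨i, j, k, hi, hj, hk, hc, he⟩ := exists_eq_startSet h1
      exact ⟨h2, i, j, k, by unfold Before; omega, hc, he⟩

/-! ### The cubic-time algorithm and the conclusion -/

theorem findSingle_spec (hm : I.n < m) (hB : Base I s) (h7 : s.nreg 7 = I.n) :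
    Ensures m findSingle s (fun s' =>
      (s'.nreg 7 = I.n ∧ ∀ v : Fin I.n, ¬ I.cost v ≤ I.budget) ∨
      ∃ u : Fin I.n, s'.nreg 7 = u ∧ I.cost u ≤ I.budget ∧
        ∀ v : Fin I.n, I.cost v ≤ I.budget → I.gain ∅ v ≤ I.gain ∅ u) := by
  have hm1 : 1 ≤ m := by omega
  refine Ensures.forLoop (fun k s₁ =>
    (s₁.nreg 7 = I.n ∧ ∀ v : Fin I.n, v.val < k → ¬ I.cost v ≤ I.budget) ∨
      ∃ u : Fin I.n, s₁.nreg 7 = u ∧ I.cost u ≤ I.budget ∧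
        ∀ v : Fin I.n, v.val < k → I.cost v ≤ I.budget → I.gain ∅ v ≤ I.gain ∅ u) hm hB.n
    (by decide) rfl rfl (Or.inl ⟨by simpa using h7, by simp⟩) ?_ ?_
  · intro k s₁ hk h2 h1 hI
    have hB1 := hB.unch h1 rfl
    set w : Fin I.n := ⟨k, hk⟩ with hw
    have h2' : s₁.nreg 2 = w := h2
    have hcase : ∀ v : Fin I.n, v.val < k + 1 → v.val < k ∨ v = w := by
      intro v hv
      simp only [hw, Fin.ext_iff]
      omega
    refine Ensures.ite hm1 (fun h => Ensures.setNReg (Or.inr ?_)) (fun h => Ensures.nop ?_)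
    all_goals simp only [Test.Holds, Test.or_holds, Test.eq_holds, NExp.val, RExp.val, entryR_val,
      h2', hB1.cost, hB1.gain, hB1.budget, hB1.n, not_lt] at h
    · refine ⟨w, by simp [h2'], h.1, fun v hv hvb => ?_⟩
      rcases hcase v hv with hv | rfl
      swap
      · exact le_rfl
      rcases hI with ⟨-, hI⟩ | ⟨u, h7, -, hI⟩
      · exact absurd hvb (hI v hv)
      · rcases h.2 with h | h
        · exact absurd (h7.symm.trans h) u.2.ne
        · rw [h7, hB1.gain] at h
          exact (hI v hv hvb).trans h.le
    · rcases hI with ⟨h7, hI⟩ | ⟨u, h7, hu, hI⟩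
      · refine Or.inl ⟨by simpa using h7, fun v hv => ?_⟩
        rcases hcase v hv with hv | rfl
        · exact hI v hv
        · exact fun hb => h ⟨hb, Or.inl h7⟩
      · refine Or.inr ⟨u, by simpa using h7, hu, fun v hv hvb => ?_⟩
        rcases hcase v hv with hv | rfl
        · exact hI v hv hvb
        · rw [h7, hB1.gain] at h
          exact not_lt.1 fun hlt => h ⟨hvb, Or.inr hlt⟩
  · rintro s' - (⟨h7, h⟩ | ⟨u, h7, hu, h⟩)
    · exact Or.inl ⟨h7, fun v => h v v.2⟩
    · exact Or.inr ⟨u, h7, hu, fun v => h v v.2⟩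

theorem feasible_singleton {v : Fin I.n} : I.Feasible {v} ↔ I.cost v ≤ I.budget := by
  simp [MBC.Feasible]

theorem atMostOne_self (n : ℕ) : atMostOne n n = ∅ := by
  ext v
  simpa [mem_atMostOne] using v.2.ne

theorem atMostOne_val {n : ℕ} (v : Fin n) : atMostOne n v = {v} := by
  ext w
  simp [mem_atMostOne, Fin.val_inj]

/-- The second run serves only to get a solution at least as good as the best affordable single
node, since a run never removes nodes from its start. If no node is affordable, register `7` still
holds `n` and the empty start is repeated. -/
theorem fastGreedy_spec (hm : I.n < m) :
    Ensures m fastGreedy (input I) (fun s' => I.IsApproxSolution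
      (1 - 1 / Real.sqrt (Real.exp 1)) (output I.n s')) := by
  have hm1 : 1 ≤ m := by omega
  refine Ensures.seq_unch hm1 (preprocess_spec hm) fun s h0 hB => ?_
  have hbest : Best I s ∅ := (best_input I).unch h0 rfl
  refine Ensures.seq hm1 (Ensures.setNReg (Ensures.seq hm1 (Ensures.setNReg
    (Ensures.seq hm1 (Ensures.setNReg ?_)))))
  set s₀ := Store.setN _ 9 _ with hs₀
  have hB0 : Base I s₀ := hB.of_eq rfl rfl rfl rfl rfl
  have hbest0 : Best I s₀ ∅ := hbest.of_eq rfl rfl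
  have e7 : s₀.nreg 7 = I.n := by simp [hs₀, hB.n]
  have e8 : s₀.nreg 8 = I.n := by simp [hs₀, hB.n]
  have e9 : s₀.nreg 9 = I.n := by simp [hs₀, hB.n]
  clear_value s₀
  refine Ensures.seq_unch hm1 (processStart_spec hm hB0 hbest0 (C := ∅) ?_) fun s₁ h1 hP => ?_
  · simp [e7, e8, e9, startSet, atMostOne_self]
  obtain ⟨H₁, hH₁, -, hP⟩ := hP
  obtain ⟨D₁, hA₁, hD₁⟩ := hP MBC.feasible_empty
  have hH₁f : I.Feasible H₁ := by
    rcases hD₁ with ⟨-, rfl⟩ | ⟨-, rfl⟩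
    · exact hA₁.feasible MBC.feasible_empty
    · exact MBC.feasible_empty
  have hD₁' : I.gbc D₁ ≤ I.gbc H₁ := by
    rcases hD₁ with ⟨-, rfl⟩ | ⟨h, rfl⟩
    · exact le_rfl
    · exact not_lt.1 h
  rw [Finset.compl_empty] at hA₁
  have hB1 := hB0.unch h1 rfl
  refine Ensures.seq_unch hm1 (findSingle_spec hm hB1 ((h1.n rfl).trans e7)) fun s₂ h2 hF => ?_
  have hB2 := hB1.unch h2 rfl
  have hH₁' := hH₁.unch h2 rfl
  have e8' : s₂.nreg 8 = I.n := (h2.n rfl).trans ((h1.n rfl).trans e8)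
  have e9' : s₂.nreg 9 = I.n := (h2.n rfl).trans ((h1.n rfl).trans e9)
  refine (processStart_spec hm hB2 hH₁' rfl).mono ?_
  rintro s₃ - ⟨H, hH, hP1, hP2⟩
  rw [e8', e9'] at hP1 hP2
  simp only [startSet, atMostOne_self, Finset.union_empty] at hP1 hP2
  rw [hH.output_eq, MBC.one_div_sqrt_exp]
  have hfin : I.Feasible H ∧ I.gbc H₁ ≤ I.gbc H ∧
      (I.Feasible (atMostOne I.n (s₂.nreg 7)) → I.gbc (atMostOne I.n (s₂.nreg 7)) ≤ I.gbc H) := by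
    by_cases hf : I.Feasible (atMostOne I.n (s₂.nreg 7))
    · obtain ⟨D, hA, hD⟩ := hP2 hf
      have hsub := MBC.gbc_mono hA.subset
      rcases hD with ⟨h, rfl⟩ | ⟨h, rfl⟩
      · exact ⟨hA.feasible hf, h.le, fun _ => hsub⟩
      · exact ⟨hH₁f, le_rfl, fun _ => hsub.trans (not_lt.1 h)⟩
    · obtain rfl := hP1 hf
      exact ⟨hH₁f, le_rfl, fun h => absurd h hf⟩
  refine ⟨hfin.1, fun O hO => MBC.le_gbc_of_augment_empty hA₁ (hD₁'.trans hfin.2.1) ?_ hO⟩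
  intro v hv
  rcases hF with ⟨-, hF⟩ | ⟨u, h7, hu, hF⟩
  · exact absurd (feasible_singleton.1 hv) (hF v)
  · rw [MBC.gbc_singleton]
    refine (hF v (feasible_singleton.1 hv)).trans ?_
    rw [← MBC.gbc_singleton, ← atMostOne_val u, ← h7]
    refine hfin.2.2 ?_
    rw [h7, atMostOne_val]
    exact feasible_singleton.2 hu

/-- A connected graph has a node, so n + 2 ≤ 3n and the bound becomes a multiple of a pure power of
`n`. -/
theorem Ensures.returns {p : Prog} {d : ℕ} {Q : Finset (Fin I.n) → Prop} (hd : p.depth = d)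
    (h : Ensures (I.n + 2) p (input I) (fun s => Q (output I.n s))) :
    ∃ (t : ℕ) (C : Finset (Fin I.n)), Returns p I t C ∧ t ≤ p.size * 3 ^ d * I.n ^ d ∧ Q C := by
  obtain ⟨t, s, hrun, ht, hQ⟩ := h
  refine ⟨t, _, ⟨s, hrun, rfl⟩, ht.trans ?_, hQ⟩
  have hn : 0 < I.n := Fin.pos_iff_nonempty.2 I.connected.nonempty
  rw [hd, mul_assoc, ← mul_pow]
  exact Nat.mul_le_mul_left _ (Nat.pow_le_pow_left (by omega) _)

end RealRAM

theorem theorem1 :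
    (∃ (P : RealRAM.Prog) (K : ℕ), ∀ I : MBC, ∃ (t : ℕ) (C : Finset (Fin I.n)),
      RealRAM.Returns P I t C ∧ t ≤ K * I.n ^ 3 ∧
      I.IsApproxSolution (1 - 1 / Real.sqrt (Real.exp 1)) C) ∧
    (∃ (P : RealRAM.Prog) (K : ℕ), ∀ I : MBC, ∃ (t : ℕ) (C : Finset (Fin I.n)),
      RealRAM.Returns P I t C ∧ t ≤ K * I.n ^ 6 ∧
      I.IsGreedyResult C ∧ I.IsApproxSolution (1 - 1 / Real.exp 1) C) ∧
    (∀ (I : MBC) (C : Finset (Fin I.n)),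
      I.IsGreedyResult C → I.IsApproxSolution (1 - 1 / Real.exp 1) C) := by
  refine ⟨⟨RealRAM.fastGreedy, RealRAM.fastGreedy.size * 3 ^ 3, fun I =>
    -- Here and for `RealRAM.enumGreedy`, `rfl` computes the loop depth, which is the exponent of
    -- the time bound.
    (RealRAM.fastGreedy_spec (by omega)).returns rfl⟩,
    ⟨RealRAM.enumGreedy, RealRAM.enumGreedy.size * 3 ^ 6, fun I => ?_⟩,
    fun I C h => h.isApproxSolution⟩
  obtain ⟨t, C, h1, h2, h3⟩ := (RealRAM.enumGreedy_spec (I := I) (by omega)).returns rfl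
  exact ⟨t, C, h1, h2, h3, h3.isApproxSolution⟩
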